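/- **Setting.** Let $X$ be a finite-dimensional real normed space and $T>0$. Let $\Psi_0:X\to[0,\infty)$ be a gauge: $\Psi_0(v)>0$ for $v\ne0$, $\Psi_0(v_1+v_2)\le\Psi_0(v_1)+\Psi_0(v_2)$, $\Psi_0(\lambda v)=\lambda\Psi_0(v)$ for $\lambda\ge0$; put $K^*=\{w\in X^*:\langle w,z\rangle\le\Psi_0(z)\ \forall z\in X\}$. Let $\Psi:X\to[0,\infty)$ be convex with $\Psi(0)=0$, $\Psi(v)/\|v\|\to\infty$ as $\|v\|\to\infty$, and $\lim_{\varepsilon\downarrow0}\varepsilon^{-1}\Psi(\varepsilon v)=\Psi_0(v)$ for all $v$. Let $\mathcal E\in C^1([0,T]\times X)$ satisfy, for some $C>0$ and all $(t,x)$, $\mathcal E_t(x)\ge -C$ and $|\partial_t\mathcal E_t(x)|\le C(1+\mathcal E_t(x)^+)$. With $\Psi^*$ the conjugate of $\Psi$, define $$\mathfrak p(v,w)=\inf_{\varepsilon>0}\big(\varepsilon^{-1}\Psi(\varepsilon v)+\varepsilon^{-1}\Psi^*(w)\big),\qquad (v,w)\in X\times X^*,$$ and, for $\alpha\ge0$,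 $v\in X$, $p\in\mathbb R$, $w\in X^*$, $\mathfrak P(\alpha,v;p,w)=\Psi_0(v)+I_{K^*}(w)+\alpha p$ if $\alpha>0$ and $\mathfrak P(0,v;p,w)=\mathfrak p(v,w)$, where $I_{K^*}$ is $0$ on $K^*$ and $+\infty$ elsewhere. **Parametrized solutions.** A Lipschitz curve $(\mathsf t,\mathsf u):[0,\mathsf S]\to[0,T]\times X$, $\mathsf S>0$, with $\mathsf t$ nondecreasing is a *parametrized solution* if for all $0\le s_1\le s_2\le\mathsf S$ $$\int_{s_1}^{s_2}\mathfrak P\big(\dot{\mathsf t},\dot{\mathsf u};-\partial_t\mathcal E_{\mathsf t}(\mathsf u),-D\mathcal E_{\mathsf t}(\mathsf u)\big)\,ds+\mathcal E_{\mathsf t(s_2)}(\mathsf u(s_2))\le\mathcal E_{\mathsf t(s_1)}(\mathsf u(s_1)).$$ It is *nondegenerate* if $\dot{\mathsf t}+\Psi_0(\dot{\mathsf u})>0$ a.e. in $(0,\mathsf S)$, and *surjective* if $\mathsf t(0)=0$, $\mathsf t(\mathsf S)=T$. **BV solutions.** Let $u:[0,T]\to X$ be of (pointwise) bounded variation, with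 one-sided limits $u(t_\pm)$ (and $u(0_-)=u(0)$, $u(T_+)=u(T)$), jump set $J_u=\{t\in[0,T]:u(t_-)\ne u(t)\text{ or }u(t)\ne u(t_+)\}$, and let $u'_{\rm co}$ be the diffuse (non-atomic) part of its distributional derivative. For $x_0,x_1\in X$ let $$\Delta_t(x_0,x_1)=\inf\Big\{\int_{r_0}^{r_1}\mathfrak p\big(\dot\vartheta(r),-D\mathcal E_t(\vartheta(r))\big)dr:\ \vartheta\in AC([r_0,r_1];X),\ \vartheta(r_0)=x_0,\ \vartheta(r_1)=x_1\Big\}$$ and, for $a<b$, $$\mathrm{Var}_{\mathfrak p,\mathcal E}(u;[a,b])=\int_{(a,b)}\Psi_0\Big(\frac{du'_{\rm co}}{d|u'_{\rm co}|}\Big)\,d|u'_{\rm co}|+\Delta_a(u(a),u(a_+))+\Delta_b(u(b_-),u(b))+\sum_{t\in J_u\cap(a,b)}\big(\Delta_t(u(t_-),u(t))+\Delta_t(u(t),u(t_+))\big),$$ with value $0$ if $a=b$. The curve $u$ is a *BV solution* if $-D\mathcal E_t(u(t))\in K^*$ for a.e. $t\in[0,T]\setminus J_u$ and $$\mathrm{Var}_{\mathfrak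 p,\mathcal E}(u;[0,t])+\mathcal E_t(u(t))=\mathcal E_0(u(0))+\int_0^t\partial_t\mathcal E_s(u(s))\,ds\qquad\text{for all }t\in[0,T].$$ **Theorem 5.6.** (i) Let $(\mathsf t,\mathsf u):[0,\mathsf S]\to[0,T]\times X$ be a nondegenerate, surjective parametrized solution. Then every curve $u:[0,T]\to X$ with $$u(t)\in\{\mathsf u(s): s\in[0,\mathsf S],\ \mathsf t(s)=t\}\quad\text{for every }t\in[0,T]\tag{$*$}$$ is a BV solution. (ii) Conversely, if $u:[0,T]\to X$ is a BV solution, then there exist $\mathsf S>0$ and a nondegenerate, surjective parametrized solution $(\mathsf t,\mathsf u)$ on $[0,\mathsf S]$ such that $(*)$ holds. -/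

import Mathlib

open MeasureTheory Set Filter Topology
open scoped ENNReal

noncomputable section

namespace RateIndependent

section Potentials

variable {X : Type*} [NormedAddCommGroup X] [NormedSpace ℝ X]

/-- A gauge function on `X`: a nonnegative, non-degenerate, positively `1`-homogeneous,
subadditive (hence convex), finite dissipation; it need not be even. -/
structure IsGauge (Ψ₀ : X → ℝ) : Prop where
  nonneg : ∀ v, 0 ≤ Ψ₀ v
  pos : ∀ v, v ≠ 0 → 0 < Ψ₀ v
  add_le : ∀ v₁ v₂, Ψ₀ (v₁ + v₂) ≤ Ψ₀ v₁ + Ψ₀ v₂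
  smul : ∀ (c : ℝ) (v : X), 0 ≤ c → Ψ₀ (c • v) = c * Ψ₀ v

/-- The rescaled viscous potential `Ψ_ε(v) = ε⁻¹ Ψ(ε v)`. -/
def scaledPotential (Ψ : X → ℝ) (ε : ℝ) (v : X) : ℝ := ε⁻¹ * Ψ (ε • v)

/-- `Ψ` is a viscous potential for `Ψ₀`: convex, nonnegative, null at `0`, superlinear at infinity,
and `Ψ₀` is the limit of the rescalings `Ψ_ε` as `ε ↓ 0`. -/
structure IsViscousPotential (Ψ₀ Ψ : X → ℝ) : Prop where
  convexOn : ConvexOn ℝ univ Ψ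
  nonneg : ∀ v, 0 ≤ Ψ v
  map_zero : Ψ 0 = 0
  superlinear : Tendsto (fun v => Ψ v / ‖v‖) (Bornology.cobounded X) atTop
  tendsto : ∀ v, Tendsto (fun ε : ℝ => scaledPotential Ψ ε v) (𝓝[>] 0) (𝓝 (Ψ₀ v))

/-- The stable set `K* = ∂Ψ₀(0) ⊂ X*`. -/
def stableSet (Ψ₀ : X → ℝ) : Set (X →L[ℝ] ℝ) := {w | ∀ z, w z ≤ Ψ₀ z}

/-- The conjugate `Ψ*(w) = sup_v (⟨w, v⟩ - Ψ(v))`; the supremum is finite when `Ψ` is nonnegative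
and superlinear. -/
def conjugate (Ψ : X → ℝ) (w : X →L[ℝ] ℝ) : ℝ := ⨆ v : X, (w v - Ψ v)

/-- The vanishing viscosity contact potential
`𝔭(v, w) = inf_{ε > 0} (Ψ_ε(v) + Ψ_ε*(w))`, where `Ψ_ε* = ε⁻¹ Ψ*`. -/
def contactPotential (Ψ : X → ℝ) (v : X) (w : X →L[ℝ] ℝ) : ℝ :=
  ⨅ ε : {ε : ℝ // 0 < ε}, (scaledPotential Ψ ε v + (ε : ℝ)⁻¹ * conjugate Ψ w)

open scoped Classical in
/-- The augmented space-time contact potential `𝔓(α, v; p, w)` for `α ≥ 0`: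
it is `Ψ₀(v) + I_{K*}(w) + α p` if `α > 0`, and `𝔭(v, w)` if `α = 0`. -/
def augmentedPotential (Ψ₀ Ψ : X → ℝ) (α : ℝ) (v : X) (p : ℝ) (w : X →L[ℝ] ℝ) : EReal :=
  if 0 < α then
    if w ∈ stableSet Ψ₀ then ((Ψ₀ v + α * p : ℝ) : EReal) else ⊤
  else ((contactPotential Ψ v w : ℝ) : EReal)

/-- The partial time derivative `∂_t E_t(x)` on `[0, T]` (one-sided at the end points). -/
def timeDeriv (T : ℝ) (E : ℝ → X → ℝ) (t : ℝ) (x : X) : ℝ :=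
  derivWithin (fun r => E r x) (Icc 0 T) t

/-- The force `-D E_t(x) ∈ X*`. -/
def force (E : ℝ → X → ℝ) (t : ℝ) (x : X) : X →L[ℝ] ℝ := -fderiv ℝ (E t) x

/-- The standing assumptions on the energy: it is of class `C¹` on `[0, T] × X`, bounded from below,
and its time derivative is controlled by the energy. -/
structure IsAdmissibleEnergy (T : ℝ) (E : ℝ → X → ℝ) : Prop where
  contDiffOn : ContDiffOn ℝ 1 (fun q : ℝ × X => E q.1 q.2) (Icc 0 T ×ˢ univ)
  bounds : ∃ C : ℝ, 0 < C ∧ ∀ t ∈ Icc 0 T, ∀ x : X,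
    -C ≤ E t x ∧ |timeDeriv T E t x| ≤ C * (1 + max (E t x) 0)

end Potentials

section Parametrized

/-- The integral over `(a, b)` of an extended-real function, as the difference of the integrals of
its positive and negative parts. -/
def erealIntegral (f : ℝ → EReal) (a b : ℝ) : EReal :=
  ((∫⁻ s in Ioc a b, (f s).toENNReal : ℝ≥0∞) : EReal)
    - ((∫⁻ s in Ioc a b, (-f s).toENNReal : ℝ≥0∞) : EReal)

variable {X : Type*} [NormedAddCommGroup X] [NormedSpace ℝ X]

/-- `(t, u) : [a, b] → [0, T] × X` is a parametrized rate-independent solution: it is Lipschitz,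
`t` is nondecreasing, and the energy inequality driven by `𝔓` holds. Only the values on `[a, b]`
matter. -/
structure IsParametrizedSolution (T : ℝ) (Ψ₀ Ψ : X → ℝ) (E : ℝ → X → ℝ) (a b : ℝ)
    (tt : ℝ → ℝ) (uu : ℝ → X) : Prop where
  mapsTo : MapsTo tt (Icc a b) (Icc 0 T)
  lipschitz_time : ∃ L, LipschitzOnWith L tt (Icc a b)
  lipschitz_state : ∃ L, LipschitzOnWith L uu (Icc a b)
  monotone : MonotoneOn tt (Icc a b)
  energy_le : ∀ s₁ s₂, a ≤ s₁ → s₁ ≤ s₂ → s₂ ≤ b →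
    erealIntegral (fun s => augmentedPotential Ψ₀ Ψ (deriv tt s) (deriv uu s)
        (-timeDeriv T E (tt s) (uu s)) (force E (tt s) (uu s))) s₁ s₂
      + ((E (tt s₂) (uu s₂) : ℝ) : EReal) ≤ ((E (tt s₁) (uu s₁) : ℝ) : EReal)

/-- The pair `(t, u)` on `[a, b]` is nondegenerate. -/
def IsNondegenerate (Ψ₀ : X → ℝ) (a b : ℝ) (tt : ℝ → ℝ) (uu : ℝ → X) : Prop :=
  ∀ᵐ s, s ∈ Ioo a b → 0 < deriv tt s + Ψ₀ (deriv uu s)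

/-- The rescaling `t` on `[a, b]` is surjective. -/
def IsSurjective (T a b : ℝ) (tt : ℝ → ℝ) : Prop := tt a = 0 ∧ tt b = T

/-- The time section `{s ∈ [0, S] : t(s) = t}`. -/
def timeSection (S : ℝ) (tt : ℝ → ℝ) (t : ℝ) : Set ℝ := {s | s ∈ Icc 0 S ∧ tt s = t}

end Parametrized

section BV

variable {X : Type*} [NormedAddCommGroup X] [NormedSpace ℝ X]

/-- The Finsler cost at frozen time `t`: the infimum of the `𝔭`-length of the absolutely continuous
curves from `u₀` to `u₁`. -/
def finslerCost (Ψ : X → ℝ) (E : ℝ → X → ℝ) (t : ℝ) (u₀ u₁ : X) : ℝ≥0∞ :=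
  ⨅ (r₀ : ℝ) (r₁ : ℝ) (ϑ : ℝ → X) (_ : r₀ < r₁) (_ : AbsolutelyContinuousOnInterval ϑ r₀ r₁)
    (_ : ϑ r₀ = u₀) (_ : ϑ r₁ = u₁),
    ∫⁻ r in Ioc r₀ r₁, ENNReal.ofReal (contactPotential Ψ (deriv ϑ r) (force E t (ϑ r)))

/-- The extension of a curve on `[0, T]` to `ℝ` by its end values. Its one-sided limits obey the
convention `u(0₋) = u(0)`, `u(T₊) = u(T)`. -/
def extend (T : ℝ) (u : ℝ → X) (t : ℝ) : X := u (max 0 (min T t))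

/-- The left limit `u(t₋)`. -/
def leftValue (T : ℝ) (u : ℝ → X) (t : ℝ) : X := Function.leftLim (extend T u) t

/-- The right limit `u(t₊)`. -/
def rightValue (T : ℝ) (u : ℝ → X) (t : ℝ) : X := Function.rightLim (extend T u) t

/-- The pointwise jump set of a curve on `[0, T]`. -/
def jumpSet (T : ℝ) (u : ℝ → X) : Set ℝ :=
  {t | t ∈ Icc 0 T ∧ (leftValue T u t ≠ u t ∨ u t ≠ rightValue T u t)}

/-- The jump variation induced by `(𝔭, E)` on `[a, b]`, for `a < b`. -/
def jumpVar (T : ℝ) (Ψ : X → ℝ) (E : ℝ → X → ℝ) (u : ℝ → X) (a b : ℝ) : ℝ≥0∞ :=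
  finslerCost Ψ E a (u a) (rightValue T u a) + finslerCost Ψ E b (leftValue T u b) (u b)
    + ∑' t : ↥(jumpSet T u ∩ Ioo a b),
        (finslerCost Ψ E t (leftValue T u t) (u t) + finslerCost Ψ E t (u t) (rightValue T u t))

theorem boundedVariationOn_extend {T : ℝ} (hT : 0 ≤ T) {u : ℝ → X}
    (hu : BoundedVariationOn u (Icc 0 T)) : BoundedVariationOn (extend T u) univ := by
  have hm : MonotoneOn (fun t : ℝ => max 0 (min T t)) univ := by
    intro x _ y _ hxy
    exact max_le_max le_rfl (min_le_min le_rfl hxy)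
  have hmaps : MapsTo (fun t : ℝ => max 0 (min T t)) univ (Icc 0 T) := by
    intro x _
    exact ⟨le_max_left _ _, max_le hT (min_le_left _ _)⟩
  exact ne_top_of_le_ne_top hu (eVariationOn.comp_le_of_monotoneOn u _ hm hmaps)

variable [FiniteDimensional ℝ X]

/-- The Radon-Nikodym density `dν/dμ` of an `X`-valued measure, computed in coordinates. -/
def vectorDensity (ν : VectorMeasure ℝ X) (μ : Measure ℝ) (t : ℝ) : X :=
  ∑ i, SignedMeasure.rnDeriv
      (ν.mapRange ((Module.finBasis ℝ X).coord i).toAddMonoidHom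
        ((Module.finBasis ℝ X).coord i).continuous_of_finiteDimensional) μ t
    • Module.finBasis ℝ X i

/-- The diffuse part `u'_co` of the distributional derivative `u'` of a curve of bounded variation:
the restriction of the vector measure `u'` to the complement of the (countable) jump set. -/
def diffuseDerivative {T : ℝ} (hT : 0 ≤ T) {u : ℝ → X} (hu : BoundedVariationOn u (Icc 0 T)) :
    VectorMeasure ℝ X :=
  haveI : CompleteSpace X := FiniteDimensional.complete ℝ X
  (boundedVariationOn_extend hT hu).vectorMeasure.restrict (jumpSet T u)ᶜ

/-- The integral over `(a, b)` of `Ψ₀(u'_co)`, that is of `Ψ₀(du'_co/dμ)` with respect to `μ`.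
By homogeneity it does not depend on the reference measure `μ ≫ u'_co`; we take `μ = |u'_co|`. -/
def diffuseVar (Ψ₀ : X → ℝ) {T : ℝ} (hT : 0 ≤ T) {u : ℝ → X}
    (hu : BoundedVariationOn u (Icc 0 T)) (a b : ℝ) : ℝ≥0∞ :=
  ∫⁻ t in Ioo a b,
    ENNReal.ofReal (Ψ₀ (vectorDensity (diffuseDerivative hT hu) (diffuseDerivative hT hu).variation t))
      ∂(diffuseDerivative hT hu).variation

open scoped Classical in
/-- The pseudo-total variation induced by `(𝔭, E)` on `[a, b]`; it is `0` on a degenerate interval,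
where there is nothing to sum. -/
def pseudoVar (Ψ₀ Ψ : X → ℝ) (E : ℝ → X → ℝ) {T : ℝ} (hT : 0 ≤ T) {u : ℝ → X}
    (hu : BoundedVariationOn u (Icc 0 T)) (a b : ℝ) : ℝ≥0∞ :=
  if a < b then diffuseVar Ψ₀ hT hu a b + jumpVar T Ψ E u a b else 0

/-- `u : [0, T] → X` is a BV solution: it has bounded variation, it is locally stable, and it satisfies
the energy balance induced by `(𝔭, E)`. Only the values on `[0, T]` matter. -/
def IsBVSolution {T : ℝ} (hT : 0 ≤ T) (Ψ₀ Ψ : X → ℝ) (E : ℝ → X → ℝ) (u : ℝ → X) : Prop :=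
  ∃ hu : BoundedVariationOn u (Icc 0 T),
    (∀ᵐ t, t ∈ Icc 0 T \ jumpSet T u → force E t (u t) ∈ stableSet Ψ₀) ∧
    ∀ t ∈ Icc 0 T,
      ((pseudoVar Ψ₀ Ψ E hT hu 0 t : ℝ≥0∞) : EReal) + ((E t (u t) : ℝ) : EReal)
        = ((E 0 (u 0) + ∫ s in (0 : ℝ)..t, timeDeriv T E s (u s) : ℝ) : EReal)

end BV

end RateIndependent

end

/-! Both implications rest on one squeeze. Write w = -DE for the force. By the chain rule, minus the
derivative of the energy along a curve is ⟨w, u̇⟩ - ṫ ∂ₜE. The Fenchel-Young inequality ⟨w, v⟩ ≤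
𝔭(v, w), together with stability where ṫ > 0, shows that this never exceeds 𝔓
(`le_augmentedPotential`). So the energy inequality of a parametrized solution is an equality almost
everywhere, and at frozen time the Finsler cost between two points is at least the energy drop.

(i) The squeeze turns a parametrized solution into an `IsBalancedCurve`: stable where time runs,
with 𝔭(υ̇, w) = ⟨w, υ̇⟩ a.e. A curve u satisfying (∗) is υ ∘ σ for a right inverse σ of τ, and σ is
automatically monotone. Work minus energy along (τ, υ) then has derivative 𝔭(υ̇, w), so its
increments are integrals of 𝔭. The parameter interval is cut according to τ. The slices over jump
times give the Finsler costs (`finslerCost_eq`, `jumpSum_eq`). On the rest σ ∘ τ is the identity and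
the force is stable, so 𝔭 = Ψ₀; since u' is the image under τ of υ̇ ds (`vectorMeasure_apply`), this
part is the diffuse variation (`diffuseVar_eq`). Adding the pieces (`pseudoVar_eq`) gives the energy
balance.

(ii) Conversely, the energy W(t) dissipated by a BV solution on [0, t] is nondecreasing and controls
the Ψ₀-increments of u. Inverting the completed graph of s = t + W(t) yields a 1-Lipschitz time τ. A
jump of W is an energy drop at frozen time that equals the Finsler cost, so an optimal transition
exists (`exists_isTransition`) and fills the corresponding gap. Along the resulting curve the energy
is the initial energy plus the work minus (s - τ(s)) (`energy_eq`). Differentiating gives ⟨w, υ̇⟩ =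
1 - τ̇, from which nondegeneracy follows at once, and the energy inequality once 𝔓 is bounded above.

The contact potential is handled throughout by freezing c = Ψ*(w): for fixed c it is again a gauge
in v, to which Jensen's inequality and passage to the limit apply. -/

set_option linter.unusedSectionVars false

noncomputable section

namespace RateIndependent

/-! ### Gauges, the conjugate and the contact potential. -/

section PotentialTheory

variable {X : Type*} [NormedAddCommGroup X] [NormedSpace ℝ X]

theorem IsGauge.map_zero {N : X → ℝ} (hN : IsGauge N) : N 0 = 0 := by
  simpa using hN.smul 0 0 le_rfl

theorem IsGauge.convexOn {N : X → ℝ} (hN : IsGauge N) : ConvexOn ℝ univ N := by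
  refine ⟨convex_univ, fun x _ y _ a b ha hb _ => ?_⟩
  simpa only [hN.smul a x ha, hN.smul b y hb, smul_eq_mul] using hN.add_le (a • x) (b • y)

theorem IsGauge.sub_le {N : X → ℝ} (hN : IsGauge N) (x y z : X) :
    N (z - x) ≤ N (z - y) + N (y - x) := by
  simpa using hN.add_le (z - y) (y - x)

theorem IsGauge.eq_of_sub_le_zero {N : X → ℝ} (hN : IsGauge N) {x y : X} (h : N (y - x) ≤ 0) :
    y = x := by
  by_contra hxy
  exact absurd (hN.pos _ (sub_ne_zero.2 hxy)) (not_lt.2 h)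

/-- The scalar contact potential `inf_{ε > 0} (Ψ_ε(v) + ε⁻¹ c)`. -/
def contactAt (Ψ : X → ℝ) (c : ℝ) (v : X) : ℝ :=
  ⨅ ε : {ε : ℝ // 0 < ε}, (scaledPotential Ψ ε v + (ε : ℝ)⁻¹ * c)

/-- The force enters 𝔭 only through the number c = Ψ*(w). With c ≥ 0 frozen one has a gauge in v
(`isGauge_contactAt`), nondecreasing in c, so a lower bound on Ψ* along a curve is enough to apply
Jensen's inequality. -/
theorem contactPotential_eq_contactAt (Ψ : X → ℝ) (v : X) (w : X →L[ℝ] ℝ) :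
    contactPotential Ψ v w = contactAt Ψ (conjugate Ψ w) v := rfl

instance : Nonempty {ε : ℝ // 0 < ε} := ⟨⟨1, one_pos⟩⟩

variable {Ψ₀ Ψ : X → ℝ}

theorem IsViscousPotential.smul_le (hΨ : IsViscousPotential Ψ₀ Ψ) {c : ℝ} (h0 : 0 ≤ c)
    (h1 : c ≤ 1) (v : X) : Ψ (c • v) ≤ c * Ψ v := by
  have := hΨ.convexOn.2 (mem_univ v) (mem_univ (0 : X)) h0 (sub_nonneg.2 h1) (by ring)
  simpa [hΨ.map_zero] using this

/-- This is the monotonicity of the slopes of a convex function vanishing at 0. It makes Ψ₀ a lower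
bound of all rescalings and not only their limit. -/
theorem IsViscousPotential.scaled_mono (hΨ : IsViscousPotential Ψ₀ Ψ) {ε δ : ℝ} (hε : 0 < ε)
    (h : ε ≤ δ) (v : X) : scaledPotential Ψ ε v ≤ scaledPotential Ψ δ v := by
  have hδ : 0 < δ := hε.trans_le h
  have := hΨ.smul_le (c := ε / δ) (by positivity) ((div_le_one hδ).2 h) (δ • v)
  rw [smul_smul, div_mul_cancel₀ _ hδ.ne'] at this
  unfold scaledPotential
  calc ε⁻¹ * Ψ (ε • v) ≤ ε⁻¹ * (ε / δ * Ψ (δ • v)) := by gcongr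
    _ = δ⁻¹ * Ψ (δ • v) := by field_simp

theorem IsViscousPotential.le_scaled (hΨ : IsViscousPotential Ψ₀ Ψ) {ε : ℝ} (hε : 0 < ε) (v : X) :
    Ψ₀ v ≤ scaledPotential Ψ ε v := by
  refine le_of_tendsto (hΨ.tendsto v) ?_
  filter_upwards [Ioc_mem_nhdsGT hε] with δ hδ
  exact hΨ.scaled_mono hδ.1 hδ.2 v

theorem IsViscousPotential.scaled_nonneg (hΨ : IsViscousPotential Ψ₀ Ψ) {ε : ℝ} (hε : 0 < ε)
    (v : X) : 0 ≤ scaledPotential Ψ ε v :=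
  mul_nonneg (inv_nonneg.2 hε.le) (hΨ.nonneg _)

theorem IsViscousPotential.bddBelow_contactAt (hΨ : IsViscousPotential Ψ₀ Ψ) {c : ℝ} (hc : 0 ≤ c)
    (v : X) : BddBelow (range fun ε : {ε : ℝ // 0 < ε} =>
      scaledPotential Ψ ε v + (ε : ℝ)⁻¹ * c) := by
  refine ⟨0, ?_⟩
  rintro _ ⟨ε, rfl⟩
  exact add_nonneg (hΨ.scaled_nonneg ε.2 v) (mul_nonneg (inv_nonneg.2 ε.2.le) hc)

theorem IsViscousPotential.contactAt_le (hΨ : IsViscousPotential Ψ₀ Ψ) {c : ℝ} (hc : 0 ≤ c)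
    (v : X) {ε : ℝ} (hε : 0 < ε) : contactAt Ψ c v ≤ scaledPotential Ψ ε v + ε⁻¹ * c :=
  ciInf_le (hΨ.bddBelow_contactAt hc v) ⟨ε, hε⟩

theorem le_contactAt {c a : ℝ} {v : X}
    (h : ∀ ε : ℝ, 0 < ε → a ≤ scaledPotential Ψ ε v + ε⁻¹ * c) : a ≤ contactAt Ψ c v :=
  le_ciInf fun ε => h ε ε.2

theorem IsViscousPotential.gauge_le_contactAt (hΨ : IsViscousPotential Ψ₀ Ψ) {c : ℝ} (hc : 0 ≤ c)
    (v : X) : Ψ₀ v ≤ contactAt Ψ c v :=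
  le_contactAt fun ε hε => by
    have := hΨ.le_scaled hε v
    have : 0 ≤ ε⁻¹ * c := by positivity
    linarith

theorem IsViscousPotential.contactAt_mono (hΨ : IsViscousPotential Ψ₀ Ψ) {c d : ℝ} (hc : 0 ≤ c)
    (h : c ≤ d) (v : X) : contactAt Ψ c v ≤ contactAt Ψ d v :=
  le_contactAt fun ε hε => (hΨ.contactAt_le hc v hε).trans (by gcongr)

/-- The term ε⁻¹ c scales exactly and the nonnegative Ψ_ε only helps. This is the left continuity in
c used by `contactPotential_le_one`. -/
theorem IsViscousPotential.mul_contactAt_le (hΨ : IsViscousPotential Ψ₀ Ψ) {r c : ℝ} (hc : 0 ≤ c)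
    (hr : 0 ≤ r) (hr1 : r ≤ 1) (v : X) : r * contactAt Ψ c v ≤ contactAt Ψ (r * c) v :=
  le_contactAt fun ε hε => by
    have h1 := mul_le_mul_of_nonneg_left (hΨ.contactAt_le hc v hε) hr
    have h2 := mul_le_mul_of_nonneg_right hr1 (hΨ.scaled_nonneg hε v)
    calc _ ≤ _ := h1
      _ ≤ _ := by linarith

theorem IsViscousPotential.contactAt_zero (hΨ : IsViscousPotential Ψ₀ Ψ) (v : X) :
    contactAt Ψ 0 v = Ψ₀ v := by
  refine le_antisymm (ge_of_tendsto (hΨ.tendsto v) ?_) (hΨ.gauge_le_contactAt le_rfl v)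
  filter_upwards [self_mem_nhdsWithin] with ε hε
  simpa using hΨ.contactAt_le le_rfl v hε

theorem IsViscousPotential.contactAt_add_le (hΨ : IsViscousPotential Ψ₀ Ψ) {c : ℝ} (hc : 0 ≤ c)
    (v₁ v₂ : X) : contactAt Ψ c (v₁ + v₂) ≤ contactAt Ψ c v₁ + contactAt Ψ c v₂ := by
  have key : ∀ ε₁ : ℝ, 0 < ε₁ → ∀ ε₂ : ℝ, 0 < ε₂ → contactAt Ψ c (v₁ + v₂) ≤
      (scaledPotential Ψ ε₁ v₁ + ε₁⁻¹ * c) + (scaledPotential Ψ ε₂ v₂ + ε₂⁻¹ * c) := by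
    intro ε₁ h₁ ε₂ h₂
    -- With this harmonic combination the terms ε⁻¹ c add up exactly, and ε/ε₁, ε/ε₂ are convex
    -- weights.
    set ε := (ε₁⁻¹ + ε₂⁻¹)⁻¹ with hεdef
    have hε : 0 < ε := by positivity
    have hinv : ε⁻¹ = ε₁⁻¹ + ε₂⁻¹ := inv_inv _
    have hc1 := hΨ.convexOn.2 (mem_univ (ε₁ • v₁)) (mem_univ (ε₂ • v₂))
      (show 0 ≤ ε * ε₁⁻¹ by positivity) (show 0 ≤ ε * ε₂⁻¹ by positivity)
      (by rw [← mul_add, ← hinv, mul_inv_cancel₀ hε.ne'])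
    have hvec : (ε * ε₁⁻¹) • (ε₁ • v₁) + (ε * ε₂⁻¹) • (ε₂ • v₂) = ε • (v₁ + v₂) := by
      rw [smul_smul, smul_smul, mul_assoc, mul_assoc, inv_mul_cancel₀ h₁.ne',
        inv_mul_cancel₀ h₂.ne', smul_add]
      simp
    rw [hvec] at hc1
    have h3 := hΨ.contactAt_le hc (v₁ + v₂) hε
    have h4 : scaledPotential Ψ ε (v₁ + v₂) ≤
        scaledPotential Ψ ε₁ v₁ + scaledPotential Ψ ε₂ v₂ := by
      unfold scaledPotential
      calc ε⁻¹ * Ψ (ε • (v₁ + v₂))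
          ≤ ε⁻¹ * ((ε * ε₁⁻¹) • Ψ (ε₁ • v₁) + (ε * ε₂⁻¹) • Ψ (ε₂ • v₂)) := by gcongr
        _ = _ := by simp only [smul_eq_mul]; field_simp
    rw [hinv] at h3
    linarith
  have h1 : ∀ ε₁ : ℝ, 0 < ε₁ → contactAt Ψ c (v₁ + v₂) -
      (scaledPotential Ψ ε₁ v₁ + ε₁⁻¹ * c) ≤ contactAt Ψ c v₂ := fun ε₁ h₁ =>
    le_contactAt fun ε₂ h₂ => by linarith [key ε₁ h₁ ε₂ h₂]
  have h2 : contactAt Ψ c (v₁ + v₂) - contactAt Ψ c v₂ ≤ contactAt Ψ c v₁ :=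
    le_contactAt fun ε₁ h₁ => by linarith [h1 ε₁ h₁]
  linarith

theorem IsViscousPotential.contactAt_smul_le (hΨ : IsViscousPotential Ψ₀ Ψ) {c : ℝ} (hc : 0 ≤ c)
    {r : ℝ} (hr : 0 < r) (v : X) : contactAt Ψ c (r • v) ≤ r * contactAt Ψ c v := by
  rw [← inv_mul_le_iff₀ hr]
  refine le_contactAt fun ε hε => ?_
  have h := hΨ.contactAt_le hc (r • v) (ε := ε / r) (by positivity)
  rw [inv_mul_le_iff₀ hr]
  refine h.trans_eq ?_
  unfold scaledPotential
  rw [smul_smul, div_mul_cancel₀ _ hr.ne']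
  field_simp

theorem IsViscousPotential.contactAt_apply_zero (hΨ : IsViscousPotential Ψ₀ Ψ) {c : ℝ}
    (hc : 0 ≤ c) : contactAt Ψ c (0 : X) = 0 := by
  refine le_antisymm ?_ ?_
  · have : Tendsto (fun ε : ℝ => ε⁻¹ * c) atTop (𝓝 (0 * c)) :=
      tendsto_inv_atTop_zero.mul_const c
    rw [zero_mul] at this
    refine ge_of_tendsto this ?_
    filter_upwards [eventually_gt_atTop 0] with ε hε
    simpa [scaledPotential, hΨ.map_zero] using hΨ.contactAt_le hc (0 : X) hε
  · exact le_contactAt fun ε hε => add_nonneg (hΨ.scaled_nonneg hε _) (by positivity)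

theorem IsViscousPotential.isGauge_contactAt (hΨ : IsViscousPotential Ψ₀ Ψ) (hΨ₀ : IsGauge Ψ₀)
    {c : ℝ} (hc : 0 ≤ c) : IsGauge (contactAt Ψ c) where
  nonneg v := (hΨ₀.nonneg v).trans (hΨ.gauge_le_contactAt hc v)
  pos v hv := (hΨ₀.pos v hv).trans_le (hΨ.gauge_le_contactAt hc v)
  add_le := hΨ.contactAt_add_le hc
  smul r v hr := by
    rcases hr.eq_or_lt with rfl | hr
    · simpa using hΨ.contactAt_apply_zero hc
    · refine le_antisymm (hΨ.contactAt_smul_le hc hr v) ?_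
      have := hΨ.contactAt_smul_le hc (inv_pos.2 hr) (r • v)
      rwa [inv_smul_smul₀ hr.ne', le_inv_mul_iff₀ hr] at this

/-! ### The conjugate -/

/-- Outside a large ball superlinearity wins, inside it Ψ ≥ 0 suffices. With R = ‖w‖ it guarantees
that the real supremum in `conjugate` is a genuine one and not the default value 0. -/
theorem IsViscousPotential.exists_linear_bound [FiniteDimensional ℝ X]
    (hΨ : IsViscousPotential Ψ₀ Ψ) (R : ℝ) : ∃ C : ℝ, ∀ v, R * ‖v‖ - Ψ v ≤ C := by
  have h := hΨ.superlinear.eventually_ge_atTop R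
  rw [(Metric.hasBasis_cobounded_compl_closedBall (0 : X)).eventually_iff] at h
  obtain ⟨ρ, -, hρ⟩ := h
  refine ⟨max 0 (|R| * ρ), fun v => ?_⟩
  by_cases hv : v ∈ Metric.closedBall (0 : X) ρ
  · rw [mem_closedBall_zero_iff] at hv
    refine le_trans ?_ (le_max_right _ _)
    have h1 : R * ‖v‖ ≤ |R| * ρ :=
      (mul_le_mul_of_nonneg_right (le_abs_self R) (norm_nonneg v)).trans (by gcongr)
    linarith [hΨ.nonneg v]
  · refine le_trans ?_ (le_max_left _ _)
    rcases eq_or_ne v 0 with rfl | hv0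
    · simp [hΨ.map_zero]
    · have h2 : R ≤ Ψ v / ‖v‖ := hρ hv
      rw [le_div_iff₀ (norm_pos_iff.2 hv0)] at h2
      linarith

theorem IsViscousPotential.bddAbove_conjugate [FiniteDimensional ℝ X]
    (hΨ : IsViscousPotential Ψ₀ Ψ) (w : X →L[ℝ] ℝ) : BddAbove (range fun v : X => w v - Ψ v) := by
  obtain ⟨C, hC⟩ := hΨ.exists_linear_bound ‖w‖
  refine ⟨C, ?_⟩
  rintro _ ⟨v, rfl⟩
  exact le_trans (sub_le_sub_right ((le_abs_self _).trans (w.le_opNorm v)) _) (hC v)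

theorem IsViscousPotential.le_conjugate [FiniteDimensional ℝ X] (hΨ : IsViscousPotential Ψ₀ Ψ)
    (w : X →L[ℝ] ℝ) (v : X) : w v - Ψ v ≤ conjugate Ψ w :=
  le_ciSup (hΨ.bddAbove_conjugate w) v

theorem IsViscousPotential.conjugate_nonneg [FiniteDimensional ℝ X]
    (hΨ : IsViscousPotential Ψ₀ Ψ) (w : X →L[ℝ] ℝ) : 0 ≤ conjugate Ψ w := by
  simpa [hΨ.map_zero] using hΨ.le_conjugate w 0

theorem IsViscousPotential.conjugate_eq_zero [FiniteDimensional ℝ X]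
    (hΨ : IsViscousPotential Ψ₀ Ψ) {w : X →L[ℝ] ℝ} (hw : w ∈ stableSet Ψ₀) :
    conjugate Ψ w = 0 := by
  refine le_antisymm (ciSup_le fun v => ?_) (hΨ.conjugate_nonneg w)
  have h1 := hΨ.le_scaled one_pos v
  simp only [scaledPotential, inv_one, one_smul, one_mul] at h1
  linarith [hw v]

theorem IsViscousPotential.contactPotential_eq_of_stable [FiniteDimensional ℝ X]
    (hΨ : IsViscousPotential Ψ₀ Ψ) {w : X →L[ℝ] ℝ} (hw : w ∈ stableSet Ψ₀) (v : X) :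
    contactPotential Ψ v w = Ψ₀ v := by
  rw [contactPotential_eq_contactAt, hΨ.conjugate_eq_zero hw, hΨ.contactAt_zero]

theorem IsViscousPotential.gauge_le_contactPotential [FiniteDimensional ℝ X]
    (hΨ : IsViscousPotential Ψ₀ Ψ) (v : X) (w : X →L[ℝ] ℝ) : Ψ₀ v ≤ contactPotential Ψ v w :=
  hΨ.gauge_le_contactAt (hΨ.conjugate_nonneg w) v

theorem IsViscousPotential.contactPotential_nonneg [FiniteDimensional ℝ X]
    (hΨ : IsViscousPotential Ψ₀ Ψ) (hΨ₀ : IsGauge Ψ₀) (v : X) (w : X →L[ℝ] ℝ) :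
    0 ≤ contactPotential Ψ v w :=
  (hΨ₀.nonneg v).trans (hΨ.gauge_le_contactPotential v w)

/-- The Fenchel-Young inequality for the contact potential. -/
theorem IsViscousPotential.apply_le_contactPotential [FiniteDimensional ℝ X]
    (hΨ : IsViscousPotential Ψ₀ Ψ) (v : X) (w : X →L[ℝ] ℝ) : w v ≤ contactPotential Ψ v w := by
  refine le_contactAt fun ε hε => ?_
  have h := hΨ.le_conjugate w (ε • v)
  unfold scaledPotential
  rw [← mul_add, le_inv_mul_iff₀ hε]
  simp only [map_smul, smul_eq_mul] at h
  linarith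

theorem IsViscousPotential.contactPotential_zero_left [FiniteDimensional ℝ X]
    (hΨ : IsViscousPotential Ψ₀ Ψ) (w : X →L[ℝ] ℝ) : contactPotential Ψ 0 w = 0 :=
  hΨ.contactAt_apply_zero (hΨ.conjugate_nonneg w)

theorem IsViscousPotential.convexOn_conjugate [FiniteDimensional ℝ X]
    (hΨ : IsViscousPotential Ψ₀ Ψ) : ConvexOn ℝ univ (conjugate Ψ) := by
  refine ⟨convex_univ, fun w _ w' _ a b ha hb hab => ciSup_le fun v => ?_⟩
  have h1 := mul_le_mul_of_nonneg_left (hΨ.le_conjugate w v) ha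
  have h2 := mul_le_mul_of_nonneg_left (hΨ.le_conjugate w' v) hb
  simp only [add_apply, smul_apply, smul_eq_mul]
  have h3 : Ψ v = a * Ψ v + b * Ψ v := by rw [← add_mul, hab, one_mul]
  linarith

theorem IsViscousPotential.continuous_conjugate [FiniteDimensional ℝ X]
    (hΨ : IsViscousPotential Ψ₀ Ψ) : Continuous (conjugate Ψ) :=
  hΨ.convexOn_conjugate.locallyLipschitz.continuous

theorem IsViscousPotential.continuous [FiniteDimensional ℝ X]
    (hΨ : IsViscousPotential Ψ₀ Ψ) : Continuous Ψ :=
  hΨ.convexOn.locallyLipschitz.continuous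

theorem IsGauge.continuous [FiniteDimensional ℝ X] (hΨ₀ : IsGauge Ψ₀) : Continuous Ψ₀ :=
  hΨ₀.convexOn.locallyLipschitz.continuous

theorem isClosed_stableSet (Ψ₀ : X → ℝ) : IsClosed (stableSet Ψ₀) := by
  simp only [stableSet, ofPred_forall]
  exact isClosed_iInter fun z => isClosed_le (by fun_prop) continuous_const

/-- An infimum of continuous functions is upper semicontinuous; this serves only to obtain Borel
measurability. -/
theorem IsViscousPotential.upperSemicontinuous_contactPotential [FiniteDimensional ℝ X]
    (hΨ : IsViscousPotential Ψ₀ Ψ) (a : ℝ) :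
    IsOpen {q : X × (X →L[ℝ] ℝ) | contactPotential Ψ q.1 q.2 < a} := by
  have : {q : X × (X →L[ℝ] ℝ) | contactPotential Ψ q.1 q.2 < a} =
      ⋃ ε : {ε : ℝ // 0 < ε}, {q | scaledPotential Ψ ε q.1 + (ε : ℝ)⁻¹ * conjugate Ψ q.2 < a} := by
    ext q
    simp only [mem_ofPred_eq, mem_iUnion]
    exact ciInf_lt_iff (hΨ.bddBelow_contactAt (hΨ.conjugate_nonneg q.2) q.1)
  rw [this]
  refine isOpen_iUnion fun ε => isOpen_lt ?_ continuous_const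
  have h1 := hΨ.continuous
  have h2 := hΨ.continuous_conjugate
  unfold scaledPotential
  fun_prop

theorem IsViscousPotential.measurable_contactPotential [FiniteDimensional ℝ X]
    [MeasurableSpace (X × (X →L[ℝ] ℝ))] [BorelSpace (X × (X →L[ℝ] ℝ))]
    (hΨ : IsViscousPotential Ψ₀ Ψ) :
    Measurable fun q : X × (X →L[ℝ] ℝ) => contactPotential Ψ q.1 q.2 :=
  measurable_of_Iio fun a => (hΨ.upperSemicontinuous_contactPotential a).measurableSet

theorem IsGauge.exists_norm_le [FiniteDimensional ℝ X] (hΨ₀ : IsGauge Ψ₀) :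
    ∃ C : ℝ, 0 < C ∧ ∀ v, ‖v‖ ≤ C * Ψ₀ v := by
  rcases (Metric.sphere (0 : X) 1).eq_empty_or_nonempty with he | hne
  · refine ⟨1, one_pos, fun v => ?_⟩
    rcases eq_or_ne v 0 with rfl | hv
    · simp [hΨ₀.map_zero]
    · have : ‖v‖⁻¹ • v ∈ Metric.sphere (0 : X) 1 := by
        rw [mem_sphere_zero_iff_norm, norm_smul, norm_inv, norm_norm,
          inv_mul_cancel₀ (norm_ne_zero_iff.2 hv)]
      simp [he] at this
  · obtain ⟨z, hz, hmin⟩ := (isCompact_sphere (0 : X) 1).exists_isMinOn hne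
      hΨ₀.continuous.continuousOn
    rw [mem_sphere_zero_iff_norm] at hz
    have hzp : 0 < Ψ₀ z := hΨ₀.pos z fun h => by simp [h] at hz
    refine ⟨(Ψ₀ z)⁻¹, inv_pos.2 hzp, fun v => ?_⟩
    rcases eq_or_ne v 0 with rfl | hv
    · simp [hΨ₀.map_zero]
    · have hv' : 0 < ‖v‖ := norm_pos_iff.2 hv
      have : ‖v‖⁻¹ • v ∈ Metric.sphere (0 : X) 1 := by
        rw [mem_sphere_zero_iff_norm, norm_smul, norm_inv, norm_norm, inv_mul_cancel₀ hv'.ne']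
      have h := hmin this
      rw [mem_ofPred_eq, hΨ₀.smul _ _ (inv_nonneg.2 hv'.le), le_inv_mul_iff₀ hv'] at h
      rw [le_inv_mul_iff₀ hzp]
      linarith

/-- Hahn-Banach: extend the functional a • y ↦ a Ψ₀(y) below the sublinear Ψ₀. Testing with the
supporting functional reduces Jensen's inequality for vectors to a scalar integral. -/
theorem IsGauge.exists_dual [FiniteDimensional ℝ X] (hΨ₀ : IsGauge Ψ₀) (y : X) :
    ∃ ξ : X →L[ℝ] ℝ, (∀ z, ξ z ≤ Ψ₀ z) ∧ ξ y = Ψ₀ y := by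
  rcases eq_or_ne y 0 with rfl | hy
  · exact ⟨0, fun z => by simpa using hΨ₀.nonneg z, by simp [hΨ₀.map_zero]⟩
  · obtain ⟨g, hg, hle⟩ := exists_extension_of_le_sublinear
      (LinearPMap.mkSpanSingleton (K := ℝ) y (Ψ₀ y) hy) Ψ₀ (fun c hc x => hΨ₀.smul c x hc.le)
      hΨ₀.add_le (by
        rintro ⟨x, hx⟩
        obtain ⟨a, rfl⟩ := Submodule.mem_span_singleton.1 hx
        erw [LinearPMap.mkSpanSingleton'_apply]
        simp only [smul_eq_mul]
        rcases le_total 0 a with ha | ha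
        · exact (hΨ₀.smul a y ha).ge
        · exact (mul_nonpos_of_nonpos_of_nonneg ha (hΨ₀.nonneg y)).trans (hΨ₀.nonneg _))
    refine ⟨LinearMap.toContinuousLinearMap g, hle, ?_⟩
    have h1 := hg ⟨y, Submodule.mem_span_singleton_self y⟩
    exact h1.trans (LinearPMap.mkSpanSingleton'_apply_self _ _ _ _)

end PotentialTheory

/-! ### Absolutely continuous curves and scalar integral bounds. -/

section Curves

theorem absolutelyContinuousOnInterval_comp {Y Z : Type*} [PseudoMetricSpace Y]
    [PseudoMetricSpace Z] {K : NNReal} {f : Y → Z} {s : Set Y} {g : ℝ → Y} {a b : ℝ}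
    (hf : LipschitzOnWith K f s) (hg : AbsolutelyContinuousOnInterval g a b)
    (hs : MapsTo g (uIcc a b) s) : AbsolutelyContinuousOnInterval (f ∘ g) a b := by
  rw [absolutelyContinuousOnInterval_iff] at hg ⊢
  intro ε hε
  obtain ⟨δ, hδ, h⟩ := hg (ε / (K + 1)) (by positivity)
  refine ⟨δ, hδ, fun I hI hlt => ?_⟩
  have h1 := h I hI hlt
  rw [lt_div_iff₀ (by positivity)] at h1
  refine lt_of_le_of_lt ?_ h1
  rw [Finset.sum_mul]
  refine Finset.sum_le_sum fun i hi => ?_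
  have hmem := hI.1 i hi
  calc dist ((f ∘ g) (I.2 i).1) ((f ∘ g) (I.2 i).2)
      ≤ K * dist (g (I.2 i).1) (g (I.2 i).2) := hf.dist_le_mul _ (hs hmem.1) _ (hs hmem.2)
    _ ≤ (K + 1) * dist (g (I.2 i).1) (g (I.2 i).2) := by gcongr; linarith
    _ = _ := mul_comm _ _

variable {X : Type*} [NormedAddCommGroup X] [NormedSpace ℝ X]

theorem ae_differentiableAt_of_absolutelyContinuousOnInterval [FiniteDimensional ℝ X]
    {ϑ : ℝ → X} {a b : ℝ} (hab : a ≤ b) (h : AbsolutelyContinuousOnInterval ϑ a b) :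
    ∀ᵐ s, s ∈ Ioo a b → DifferentiableAt ℝ ϑ s := by
  have h1 := h.boundedVariationOn.locallyBoundedVariationOn.ae_differentiableWithinAt
    measurableSet_uIcc
  rw [uIcc_of_le hab, ae_restrict_iff' measurableSet_Icc] at h1
  filter_upwards [h1] with s hs hsab
  exact (hs (Ioo_subset_Icc_self hsab)).differentiableAt (Icc_mem_nhds hsab.1 hsab.2)

theorem ae_differentiableAt_of_lipschitzOnWith [FiniteDimensional ℝ X]
    {ϑ : ℝ → X} {K : NNReal} {a b : ℝ} (h : LipschitzOnWith K ϑ (Icc a b)) :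
    ∀ᵐ s, s ∈ Ioo a b → DifferentiableAt ℝ ϑ s := by
  rcases le_total a b with hab | hab
  · rw [← uIcc_of_le hab] at h
    exact ae_differentiableAt_of_absolutelyContinuousOnInterval hab
      h.absolutelyContinuousOnInterval
  · simp [Ioo_eq_empty (not_lt.2 hab)]

theorem ae_Ioo_of_ae_Ioc {p : ℝ → Prop} {a b : ℝ} (h : ∀ᵐ s, s ∈ Ioo a b → p s) :
    ∀ᵐ s ∂volume.restrict (Ioc a b), p s := by
  rw [← restrict_Ioo_eq_restrict_Ioc, ae_restrict_iff' measurableSet_Ioo]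
  exact h

/-- No integrability is needed: the Bochner integral of a non-integrable function is 0. -/
theorem ofReal_integral_le_lintegral {α : Type*} [MeasurableSpace α] (μ : Measure α) (f : α → ℝ) :
    ENNReal.ofReal (∫ x, f x ∂μ) ≤ ∫⁻ x, ENNReal.ofReal (f x) ∂μ := by
  by_cases hf : Integrable f μ
  · rw [integral_eq_lintegral_pos_part_sub_lintegral_neg_part hf]
    exact (ENNReal.ofReal_le_ofReal (sub_le_self _ ENNReal.toReal_nonneg)).trans
      ENNReal.ofReal_toReal_le
  · simp [integral_undef hf]

theorem ofReal_sub_le_lintegral {φ g : ℝ → ℝ} {a b : ℝ} (hab : a ≤ b)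
    (hφ : AbsolutelyContinuousOnInterval φ a b) (hg : ∀ᵐ s, s ∈ Ioo a b → deriv φ s ≤ g s) :
    ENNReal.ofReal (φ b - φ a) ≤ ∫⁻ s in Ioc a b, ENNReal.ofReal (g s) := by
  rw [← hφ.integral_deriv_eq_sub, intervalIntegral.integral_of_le hab]
  refine (ofReal_integral_le_lintegral _ _).trans (lintegral_mono_ae ?_)
  filter_upwards [ae_Ioo_of_ae_Ioc hg] with s hs using ENNReal.ofReal_le_ofReal hs

end Curves

/-! ### Chain rule and regularity of the energy on the closed cylinder. -/

section Energy

variable {X : Type*} [NormedAddCommGroup X] [NormedSpace ℝ X] {T : ℝ} {E : ℝ → X → ℝ}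

/-- The space-time derivative of the energy on `[0, T] × X`. -/
def energyDeriv (T : ℝ) (E : ℝ → X → ℝ) (q : ℝ × X) : ℝ × X →L[ℝ] ℝ :=
  fderivWithin ℝ (fun q : ℝ × X => E q.1 q.2) (Icc 0 T ×ˢ univ) q

theorem uniqueDiffOn_cylinder (hT : 0 < T) : UniqueDiffOn ℝ (Icc (0 : ℝ) T ×ˢ (univ : Set X)) :=
  (uniqueDiffOn_Icc hT).prod uniqueDiffOn_univ

theorem IsAdmissibleEnergy.hasFDerivWithinAt (hE : IsAdmissibleEnergy T E) {t : ℝ}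
    (ht : t ∈ Icc 0 T) (x : X) :
    HasFDerivWithinAt (fun q : ℝ × X => E q.1 q.2) (energyDeriv T E (t, x))
      (Icc 0 T ×ˢ univ) (t, x) :=
  (hE.contDiffOn.differentiableOn one_ne_zero (t, x) ⟨ht, mem_univ x⟩).hasFDerivWithinAt

theorem IsAdmissibleEnergy.continuousOn_energyDeriv (hT : 0 < T) (hE : IsAdmissibleEnergy T E) :
    ContinuousOn (energyDeriv T E) (Icc 0 T ×ˢ univ) :=
  hE.contDiffOn.continuousOn_fderivWithin (uniqueDiffOn_cylinder hT) le_rfl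

theorem IsAdmissibleEnergy.hasFDerivAt_right (hE : IsAdmissibleEnergy T E) {t : ℝ}
    (ht : t ∈ Icc 0 T) (x : X) :
    HasFDerivAt (E t) (energyDeriv T E (t, x) ∘L ContinuousLinearMap.inr ℝ ℝ X) x := by
  have h1 : HasFDerivAt (fun y : X => (t, y)) (ContinuousLinearMap.inr ℝ ℝ X) x :=
    hasFDerivAt_prodMk_right t x
  have hm : MapsTo (fun y : X => (t, y)) univ (Icc 0 T ×ˢ univ) := fun y _ => ⟨ht, mem_univ y⟩
  have h2 := HasFDerivWithinAt.comp (s := univ) x (hE.hasFDerivWithinAt ht x)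
    h1.hasFDerivWithinAt hm
  exact hasFDerivWithinAt_univ.1 h2

theorem IsAdmissibleEnergy.force_eq (hE : IsAdmissibleEnergy T E) {t : ℝ}
    (ht : t ∈ Icc 0 T) (x : X) :
    force E t x = -(energyDeriv T E (t, x) ∘L ContinuousLinearMap.inr ℝ ℝ X) := by
  rw [force, (hE.hasFDerivAt_right ht x).fderiv]

theorem IsAdmissibleEnergy.timeDeriv_eq (hT : 0 < T) (hE : IsAdmissibleEnergy T E) {t : ℝ}
    (ht : t ∈ Icc 0 T) (x : X) : timeDeriv T E t x = energyDeriv T E (t, x) (1, 0) := by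
  have h1 : HasDerivWithinAt (fun r : ℝ => (r, x)) ((1 : ℝ), (0 : X)) (Icc 0 T) t :=
    (hasDerivWithinAt_id t _).prodMk (hasDerivWithinAt_const t _ x)
  have hm : MapsTo (fun r : ℝ => (r, x)) (Icc 0 T) (Icc 0 T ×ˢ univ) :=
    fun y hy => ⟨hy, mem_univ x⟩
  have h2 := (hE.hasFDerivWithinAt ht x).comp_hasDerivWithinAt t h1 hm
  exact h2.derivWithin (uniqueDiffOn_Icc hT t ht)

theorem IsAdmissibleEnergy.energyDeriv_apply (hT : 0 < T) (hE : IsAdmissibleEnergy T E) {t : ℝ}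
    (ht : t ∈ Icc 0 T) (x : X) (α : ℝ) (v : X) :
    energyDeriv T E (t, x) (α, v) = α * timeDeriv T E t x - force E t x v := by
  have h : ((α, v) : ℝ × X) = α • (1, 0) + (0, v) := by simp
  rw [hE.force_eq ht, hE.timeDeriv_eq hT ht, h, map_add, map_smul]
  simp

theorem IsAdmissibleEnergy.continuousOn_energy (hE : IsAdmissibleEnergy T E) :
    ContinuousOn (fun q : ℝ × X => E q.1 q.2) (Icc 0 T ×ˢ univ) :=
  hE.contDiffOn.continuousOn

theorem IsAdmissibleEnergy.continuousOn_timeDeriv (hT : 0 < T) (hE : IsAdmissibleEnergy T E) :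
    ContinuousOn (fun q : ℝ × X => timeDeriv T E q.1 q.2) (Icc 0 T ×ˢ univ) := by
  have h := hE.continuousOn_energyDeriv hT
  refine ContinuousOn.congr (f := fun q => energyDeriv T E q (1, 0)) (by fun_prop) ?_
  exact fun q hq => hE.timeDeriv_eq hT hq.1 q.2

theorem IsAdmissibleEnergy.continuousOn_force (hT : 0 < T) (hE : IsAdmissibleEnergy T E) :
    ContinuousOn (fun q : ℝ × X => force E q.1 q.2) (Icc 0 T ×ˢ univ) := by
  have h := hE.continuousOn_energyDeriv hT
  refine ContinuousOn.congr
    (f := fun q => -(energyDeriv T E q ∘L ContinuousLinearMap.inr ℝ ℝ X)) ?_ ?_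
  · exact (h.clm_comp continuousOn_const).neg
  · exact fun q hq => hE.force_eq hq.1 q.2

theorem IsAdmissibleEnergy.continuous_left (hE : IsAdmissibleEnergy T E) {t : ℝ}
    (ht : t ∈ Icc 0 T) : Continuous (E t) :=
  continuous_iff_continuousAt.2 fun x => (hE.hasFDerivAt_right ht x).continuousAt

theorem IsAdmissibleEnergy.continuous_force_left (hT : 0 < T) (hE : IsAdmissibleEnergy T E) {t : ℝ}
    (ht : t ∈ Icc 0 T) : Continuous (force E t) := by
  have h : Continuous fun x : X => (t, x) := by fun_prop
  exact (hE.continuousOn_force hT).comp_continuous h fun x => ⟨ht, mem_univ x⟩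

/-- The chain rule for the energy along a curve in `[0, T] × X`. -/
theorem IsAdmissibleEnergy.hasDerivAt_comp (hT : 0 < T) (hE : IsAdmissibleEnergy T E) {tt : ℝ → ℝ}
    {uu : ℝ → X} {s α : ℝ} {v : X} (htt : HasDerivAt tt α s) (huu : HasDerivAt uu v s)
    (hmem : ∀ᶠ r in 𝓝 s, tt r ∈ Icc 0 T) :
    HasDerivAt (fun r => E (tt r) (uu r))
      (α * timeDeriv T E (tt s) (uu s) - force E (tt s) (uu s) v) s := by
  have hs := hmem.self_of_nhds
  have hm : ∀ᶠ r in 𝓝 s, (tt r, uu r) ∈ Icc 0 T ×ˢ (univ : Set X) :=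
    hmem.mono fun r hr => ⟨hr, mem_univ _⟩
  have h := (hE.hasFDerivWithinAt hs (uu s)).comp_hasDerivAt s (htt.prodMk huu) hm
  rwa [hE.energyDeriv_apply hT hs] at h

theorem IsAdmissibleEnergy.hasDerivAt_comp_left (hE : IsAdmissibleEnergy T E) {ϑ : ℝ → X}
    {t s : ℝ} {v : X} (ht : t ∈ Icc 0 T) (hϑ : HasDerivAt ϑ v s) :
    HasDerivAt (fun r => E t (ϑ r)) (-force E t (ϑ s) v) s := by
  have h := (hE.hasFDerivAt_right ht (ϑ s)).comp_hasDerivAt s hϑ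
  rw [hE.force_eq ht, neg_apply, neg_neg]
  exact h

theorem IsAdmissibleEnergy.exists_lipschitzOnWith [FiniteDimensional ℝ X]
    (hE : IsAdmissibleEnergy T E) (R : ℝ) :
    ∃ K, LipschitzOnWith K (fun q : ℝ × X => E q.1 q.2) (Icc 0 T ×ˢ Metric.closedBall 0 R) :=
  (hE.contDiffOn.mono (prod_mono le_rfl (subset_univ _))).exists_lipschitzOnWith one_ne_zero
    ((convex_Icc 0 T).prod (convex_closedBall _ _)) (isCompact_Icc.prod (isCompact_closedBall _ _))

theorem IsAdmissibleEnergy.absolutelyContinuous_comp [FiniteDimensional ℝ X]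
    (hE : IsAdmissibleEnergy T E) {ϑ : ℝ → X} {t a b : ℝ} (ht : t ∈ Icc 0 T)
    (hϑ : AbsolutelyContinuousOnInterval ϑ a b) :
    AbsolutelyContinuousOnInterval (fun r => E t (ϑ r)) a b := by
  obtain ⟨R, hR⟩ := hϑ.exists_bound
  obtain ⟨K, hK⟩ := hE.exists_lipschitzOnWith R
  have h1 : LipschitzOnWith 1 (fun x : X => (t, x)) univ :=
    (LipschitzWith.prodMk_left t).lipschitzOnWith
  have h2 : LipschitzOnWith (K * 1) (fun x => E t x) (Metric.closedBall (0 : X) R) :=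
    hK.comp (h1.mono (subset_univ _)) fun x hx => ⟨ht, hx⟩
  exact absolutelyContinuousOnInterval_comp h2 hϑ fun r hr => by simpa using hR r hr

theorem IsAdmissibleEnergy.exists_lipschitzOnWith_comp [FiniteDimensional ℝ X]
    (hE : IsAdmissibleEnergy T E) {tt : ℝ → ℝ} {uu : ℝ → X} {a b : ℝ} {K L : NNReal}
    (hmem : MapsTo tt (Icc a b) (Icc 0 T))
    (htt : LipschitzOnWith K tt (Icc a b)) (huu : LipschitzOnWith L uu (Icc a b)) :
    ∃ M, LipschitzOnWith M (fun r => E (tt r) (uu r)) (Icc a b) := by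
  obtain ⟨R, hR⟩ := isCompact_Icc.exists_bound_of_continuousOn huu.continuousOn
  obtain ⟨M, hM⟩ := hE.exists_lipschitzOnWith R
  exact ⟨_, hM.comp (htt.prodMk huu) fun r hr => ⟨hmem hr, by simpa using hR r hr⟩⟩

end Energy

/-! ### Lower bounds for the Finsler cost. -/

section Finsler

variable {X : Type*} [NormedAddCommGroup X] [NormedSpace ℝ X] [FiniteDimensional ℝ X]
  {T : ℝ} {E : ℝ → X → ℝ} {Ψ₀ Ψ : X → ℝ}

/-- Integrate the Fenchel-Young inequality along the chain rule at frozen time. Optimality of a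
transition always means equality here. -/
theorem ofReal_energy_sub_le_cost (hΨ : IsViscousPotential Ψ₀ Ψ) (hE : IsAdmissibleEnergy T E)
    {t r₀ r₁ : ℝ} (ht : t ∈ Icc 0 T) {ϑ : ℝ → X} (hr : r₀ ≤ r₁)
    (hϑ : AbsolutelyContinuousOnInterval ϑ r₀ r₁) :
    ENNReal.ofReal (E t (ϑ r₀) - E t (ϑ r₁)) ≤
      ∫⁻ r in Ioc r₀ r₁, ENNReal.ofReal (contactPotential Ψ (deriv ϑ r) (force E t (ϑ r))) := by
  have h := ofReal_sub_le_lintegral (φ := fun r => -E t (ϑ r)) hr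
    (hE.absolutelyContinuous_comp ht hϑ).neg
    (g := fun r => contactPotential Ψ (deriv ϑ r) (force E t (ϑ r))) ?_
  · simpa [neg_add_eq_sub] using h
  · filter_upwards [ae_differentiableAt_of_absolutelyContinuousOnInterval hr hϑ] with s hs hsr
    have h1 := (hE.hasDerivAt_comp_left ht (hs hsr).hasDerivAt).neg.deriv
    have h2 := hΨ.apply_le_contactPotential (deriv ϑ s) (force E t (ϑ s))
    calc _ = _ := h1
      _ ≤ _ := by rwa [neg_neg]

theorem ofReal_gauge_sub_le_lintegral {N : X → ℝ} (hN : IsGauge N) {r₀ r₁ : ℝ} {ϑ : ℝ → X}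
    {g : ℝ → ℝ} (hr : r₀ ≤ r₁) (hϑ : AbsolutelyContinuousOnInterval ϑ r₀ r₁)
    (hg : ∀ r ∈ Ioo r₀ r₁, N (deriv ϑ r) ≤ g r) :
    ENNReal.ofReal (N (ϑ r₁ - ϑ r₀)) ≤ ∫⁻ r in Ioc r₀ r₁, ENNReal.ofReal (g r) := by
  -- Jensen by duality: the functional attaining N at the total increment is dominated by N on every
  -- velocity.
  obtain ⟨ξ, hξ, hξ'⟩ := hN.exists_dual (ϑ r₁ - ϑ r₀)
  rw [← hξ', map_sub]
  refine ofReal_sub_le_lintegral (φ := fun r => ξ (ϑ r)) hr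
    (absolutelyContinuousOnInterval_comp (ξ.lipschitz.lipschitzOnWith (s := univ)) hϑ
      (mapsTo_univ _ _)) ?_
  filter_upwards [ae_differentiableAt_of_absolutelyContinuousOnInterval hr hϑ] with s hs hsr
  have h1 := (ξ.hasFDerivAt.comp_hasDerivAt s (hs hsr).hasDerivAt).deriv
  calc _ = _ := h1
    _ ≤ _ := (hξ _).trans (hg s hsr)

theorem ofReal_contactAt_sub_le_cost (hΨ₀ : IsGauge Ψ₀) (hΨ : IsViscousPotential Ψ₀ Ψ)
    {t r₀ r₁ c : ℝ} {ϑ : ℝ → X} (hr : r₀ ≤ r₁)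
    (hϑ : AbsolutelyContinuousOnInterval ϑ r₀ r₁) (hc : 0 ≤ c)
    (h : ∀ r ∈ Icc r₀ r₁, c ≤ conjugate Ψ (force E t (ϑ r))) :
    ENNReal.ofReal (contactAt Ψ c (ϑ r₁ - ϑ r₀)) ≤
      ∫⁻ r in Ioc r₀ r₁, ENNReal.ofReal (contactPotential Ψ (deriv ϑ r) (force E t (ϑ r))) :=
  ofReal_gauge_sub_le_lintegral (hΨ.isGauge_contactAt hΨ₀ hc) hr hϑ fun r hrr =>
    hΨ.contactAt_mono hc (h r (Ioo_subset_Icc_self hrr)) _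

theorem ofReal_gauge_sub_le_cost (hΨ₀ : IsGauge Ψ₀) (hΨ : IsViscousPotential Ψ₀ Ψ)
    {t r₀ r₁ : ℝ} {ϑ : ℝ → X} (hr : r₀ ≤ r₁) (hϑ : AbsolutelyContinuousOnInterval ϑ r₀ r₁) :
    ENNReal.ofReal (Ψ₀ (ϑ r₁ - ϑ r₀)) ≤
      ∫⁻ r in Ioc r₀ r₁, ENNReal.ofReal (contactPotential Ψ (deriv ϑ r) (force E t (ϑ r))) :=
  ofReal_gauge_sub_le_lintegral hΨ₀ hr hϑ fun _ _ => hΨ.gauge_le_contactPotential _ _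

theorem ofReal_energy_sub_le_finslerCost (hΨ : IsViscousPotential Ψ₀ Ψ)
    (hE : IsAdmissibleEnergy T E) {t : ℝ} (ht : t ∈ Icc 0 T) (x y : X) :
    ENNReal.ofReal (E t x - E t y) ≤ finslerCost Ψ E t x y := by
  simp only [finslerCost, le_iInf_iff]
  rintro r₀ r₁ ϑ hr hϑ rfl rfl
  exact ofReal_energy_sub_le_cost hΨ hE ht hr.le hϑ

theorem ofReal_gauge_sub_le_finslerCost (hΨ₀ : IsGauge Ψ₀) (hΨ : IsViscousPotential Ψ₀ Ψ)
    (t : ℝ) (x y : X) : ENNReal.ofReal (Ψ₀ (y - x)) ≤ finslerCost Ψ E t x y := by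
  simp only [finslerCost, le_iInf_iff]
  rintro r₀ r₁ ϑ hr hϑ rfl rfl
  exact ofReal_gauge_sub_le_cost hΨ₀ hΨ hr.le hϑ

theorem finslerCost_le {t r₀ r₁ : ℝ} {ϑ : ℝ → X} (hr : r₀ < r₁)
    (hϑ : AbsolutelyContinuousOnInterval ϑ r₀ r₁) :
    finslerCost Ψ E t (ϑ r₀) (ϑ r₁) ≤
      ∫⁻ r in Ioc r₀ r₁, ENNReal.ofReal (contactPotential Ψ (deriv ϑ r) (force E t (ϑ r))) :=
  iInf_le_of_le r₀ <| iInf_le_of_le r₁ <| iInf_le_of_le ϑ <| iInf_le_of_le hr <|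
    iInf_le_of_le hϑ <| iInf_le_of_le rfl <| iInf_le_of_le rfl le_rfl

theorem finslerCost_self (hΨ : IsViscousPotential Ψ₀ Ψ) (t : ℝ) (x : X) :
    finslerCost Ψ E t x x = 0 := by
  have h := finslerCost_le (Ψ := Ψ) (E := E) (t := t) (ϑ := fun _ => x) zero_lt_one
    (LipschitzWith.const x).lipschitzOnWith.absolutelyContinuousOnInterval
  simpa [hΨ.contactPotential_zero_left] using h

end Finsler

/-! ### Extended-real integrals compared with the increment of a Lipschitz function. -/

section ERealIntegral

theorem toENNReal_coe_real (r : ℝ) : ((r : ℝ) : EReal).toENNReal = ENNReal.ofReal r := by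
  rw [EReal.toENNReal_of_ne_top (EReal.coe_ne_top r), EReal.toReal_coe]

theorem toENNReal_neg_coe_real (r : ℝ) : (-((r : ℝ) : EReal)).toENNReal = ENNReal.ofReal (-r) := by
  rw [← EReal.coe_neg, toENNReal_coe_real]

theorem eq_coe_of_toENNReal_eq {x : EReal} {r : ℝ} (hle : (r : EReal) ≤ x)
    (hpos : x.toENNReal = ENNReal.ofReal r) (hneg : (-x).toENNReal = ENNReal.ofReal (-r)) :
    x = r := by
  rcases le_or_gt 0 r with hr | hr
  · have hx : 0 ≤ x := le_trans (by exact_mod_cast hr) hle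
    rw [← EReal.coe_toENNReal hx, hpos, EReal.coe_ennreal_ofReal, max_eq_left hr]
  · have hx : 0 ≤ -x := by
      by_contra h
      rw [EReal.toENNReal_of_nonpos (not_le.1 h).le] at hneg
      have := ENNReal.ofReal_pos.2 (neg_pos.2 hr)
      rw [← hneg] at this
      exact lt_irrefl _ this
    have h1 : -x = ((-r : ℝ) : EReal) := by
      rw [← EReal.coe_toENNReal hx, hneg, EReal.coe_ennreal_ofReal,
        max_eq_left (neg_pos.2 hr).le]
    rw [← neg_neg x, h1, EReal.coe_neg, neg_neg]

variable {e : ℝ → ℝ} {K : NNReal} {a b : ℝ}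

theorem integrableOn_deriv_of_lipschitzOnWith (hab : a ≤ b) (he : LipschitzOnWith K e (Icc a b)) :
    IntegrableOn (deriv e) (Ioc a b) := by
  rw [← uIcc_of_le hab] at he
  have := he.absolutelyContinuousOnInterval.intervalIntegrable_deriv
  rwa [intervalIntegrable_iff_integrableOn_Ioc_of_le hab] at this

theorem integral_Ioc_deriv_of_lipschitzOnWith (hab : a ≤ b) (he : LipschitzOnWith K e (Icc a b)) :
    ∫ s in Ioc a b, deriv e s = e b - e a := by
  rw [← uIcc_of_le hab] at he
  rw [← he.absolutelyContinuousOnInterval.integral_deriv_eq_sub,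
    intervalIntegral.integral_of_le hab]

theorem sub_eq_toReal_lintegral (hab : a ≤ b) (he : LipschitzOnWith K e (Icc a b)) :
    e a - e b = (∫⁻ s in Ioc a b, ENNReal.ofReal (-deriv e s)).toReal -
      (∫⁻ s in Ioc a b, ENNReal.ofReal (- -deriv e s)).toReal := by
  have h := integral_eq_lintegral_pos_part_sub_lintegral_neg_part
    (f := fun s => -deriv e s) (integrableOn_deriv_of_lipschitzOnWith hab he).neg
  rw [← h, integral_neg, integral_Ioc_deriv_of_lipschitzOnWith hab he, neg_sub]

/-- An extended-real integrand dominated by `-e'` has integral at most `e a - e b`. -/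
theorem erealIntegral_add_le (hab : a ≤ b) (he : LipschitzOnWith K e (Icc a b)) {F : ℝ → EReal}
    (hF : ∀ᵐ s, s ∈ Ioo a b → F s ≤ ((-deriv e s : ℝ) : EReal)) :
    erealIntegral F a b + ((e b : ℝ) : EReal) ≤ ((e a : ℝ) : EReal) := by
  have hint := (integrableOn_deriv_of_lipschitzOnWith hab he).neg
  have hF' := ae_Ioo_of_ae_Ioc hF
  have hA : ∫⁻ s in Ioc a b, (F s).toENNReal ≤ ∫⁻ s in Ioc a b, ENNReal.ofReal (-deriv e s) := by
    refine lintegral_mono_ae ?_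
    filter_upwards [hF'] with s hs
    rw [← toENNReal_coe_real]
    exact EReal.toENNReal_le_toENNReal hs
  have hB : ∫⁻ s in Ioc a b, ENNReal.ofReal (- -deriv e s) ≤ ∫⁻ s in Ioc a b, (-F s).toENNReal := by
    refine lintegral_mono_ae ?_
    filter_upwards [hF'] with s hs
    rw [← toENNReal_neg_coe_real]
    exact EReal.toENNReal_le_toENNReal (EReal.neg_le_neg_iff.2 hs)
  have hAfin : ∫⁻ s in Ioc a b, ENNReal.ofReal (-deriv e s) ≠ ∞ :=
    (Integrable.lintegral_lt_top hint).ne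
  have hBfin : ∫⁻ s in Ioc a b, ENNReal.ofReal (- -deriv e s) ≠ ∞ :=
    (Integrable.lintegral_lt_top hint.neg).ne
  have hsub := sub_eq_toReal_lintegral hab he
  set A := ∫⁻ s in Ioc a b, ENNReal.ofReal (-deriv e s)
  set B := ∫⁻ s in Ioc a b, ENNReal.ofReal (- -deriv e s)
  have h1 : erealIntegral F a b ≤ ((e a - e b : ℝ) : EReal) := by
    rw [hsub, EReal.coe_sub, EReal.coe_ennreal_toReal hAfin, EReal.coe_ennreal_toReal hBfin]
    exact EReal.sub_le_sub (by exact_mod_cast hA) (by exact_mod_cast hB)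
  calc erealIntegral F a b + ((e b : ℝ) : EReal)
      ≤ ((e a - e b : ℝ) : EReal) + ((e b : ℝ) : EReal) := by gcongr
    _ = ((e a : ℝ) : EReal) := by rw [← EReal.coe_add, sub_add_cancel]

/-- If an extended-real integrand dominates `-e'` and its integral is at most `e a - e b`, then it
agrees with `-e'` almost everywhere. -/
theorem ae_eq_neg_deriv_of_erealIntegral_add_le (hab : a ≤ b) (he : LipschitzOnWith K e (Icc a b))
    {F : ℝ → EReal} (hFm : AEMeasurable F (volume.restrict (Ioc a b)))
    (hF : ∀ᵐ s, s ∈ Ioo a b → ((-deriv e s : ℝ) : EReal) ≤ F s)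
    (h : erealIntegral F a b + ((e b : ℝ) : EReal) ≤ ((e a : ℝ) : EReal)) :
    ∀ᵐ s ∂volume.restrict (Ioc a b), F s = ((-deriv e s : ℝ) : EReal) := by
  have hint := (integrableOn_deriv_of_lipschitzOnWith hab he).neg
  have hF' := ae_Ioo_of_ae_Ioc hF
  have hAae : (fun s => ENNReal.ofReal (-deriv e s)) ≤ᵐ[volume.restrict (Ioc a b)]
      fun s => (F s).toENNReal := by
    filter_upwards [hF'] with s hs
    rw [← toENNReal_coe_real]
    exact EReal.toENNReal_le_toENNReal hs
  have hBae : (fun s => (-F s).toENNReal) ≤ᵐ[volume.restrict (Ioc a b)]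
      fun s => ENNReal.ofReal (- -deriv e s) := by
    filter_upwards [hF'] with s hs
    rw [← toENNReal_neg_coe_real]
    exact EReal.toENNReal_le_toENNReal (EReal.neg_le_neg_iff.2 hs)
  have hAfin : ∫⁻ s in Ioc a b, ENNReal.ofReal (-deriv e s) ≠ ∞ :=
    (Integrable.lintegral_lt_top hint).ne
  have hBfin : ∫⁻ s in Ioc a b, ENNReal.ofReal (- -deriv e s) ≠ ∞ :=
    (Integrable.lintegral_lt_top hint.neg).ne
  have hA := lintegral_mono_ae hAae
  have hB := lintegral_mono_ae hBae
  have hNfin := ne_top_of_le_ne_top hBfin hB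
  have hsub := sub_eq_toReal_lintegral hab he
  have h1 : erealIntegral F a b ≤ ((e a - e b : ℝ) : EReal) := by
    rw [EReal.coe_sub]
    exact (EReal.le_sub_iff_add_le (Or.inl (EReal.coe_ne_bot _)) (Or.inl (EReal.coe_ne_top _))).2 h
  rw [erealIntegral, ← EReal.coe_ennreal_toReal hNfin] at h1
  -- The negative part has finite integral, so an infinite positive part would make the left side of
  -- `h1` equal to ⊤.
  have hPfin : ∫⁻ s in Ioc a b, (F s).toENNReal ≠ ∞ := by
    intro htop
    rw [htop] at h1
    simp only [EReal.coe_ennreal_top, EReal.top_sub_coe, top_le_iff] at h1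
    exact EReal.coe_ne_top _ h1
  rw [← EReal.coe_ennreal_toReal hPfin, ← EReal.coe_sub, EReal.coe_le_coe_iff, hsub] at h1
  have hAr := ENNReal.toReal_mono hPfin hA
  have hBr := ENNReal.toReal_mono hBfin hB
  -- Positive parts are ordered one way and negative parts the other, so the bound on the difference
  -- leaves no slack in either.
  have hPA : ∫⁻ s in Ioc a b, (F s).toENNReal ≤
      ∫⁻ s in Ioc a b, ENNReal.ofReal (-deriv e s) := by
    rw [← ENNReal.toReal_le_toReal hPfin hAfin]
    linarith
  have hBN : ∫⁻ s in Ioc a b, ENNReal.ofReal (- -deriv e s) ≤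
      ∫⁻ s in Ioc a b, (-F s).toENNReal := by
    rw [← ENNReal.toReal_le_toReal hBfin hNfin]
    linarith
  have e1 := ae_eq_of_ae_le_of_lintegral_le hAae hAfin hFm.ereal_toENNReal hPA
  have e2 := ae_eq_of_ae_le_of_lintegral_le hBae hNfin
    (by fun_prop) hBN
  filter_upwards [hF', e1, e2] with s h0 h1 h2
  exact eq_coe_of_toENNReal_eq h0 h1.symm (by rw [h2])

end ERealIntegral

section Augmented

variable {X : Type*} [NormedAddCommGroup X] [NormedSpace ℝ X] [FiniteDimensional ℝ X]
  {Ψ₀ Ψ : X → ℝ}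

/-- With p = -∂ₜE and w = -DE the left side is minus the derivative of the energy along a curve with
velocity (α, v). Hence the energy inequality can only be saturated. -/
theorem le_augmentedPotential (hΨ : IsViscousPotential Ψ₀ Ψ) {α : ℝ} (hα : 0 ≤ α) (v : X) (p : ℝ)
    (w : X →L[ℝ] ℝ) : ((w v + α * p : ℝ) : EReal) ≤ augmentedPotential Ψ₀ Ψ α v p w := by
  unfold augmentedPotential
  split_ifs with h1 h2
  · exact_mod_cast add_le_add_left (h2 v) _
  · exact le_top
  · have : α = 0 := le_antisymm (not_lt.1 h1) hα
    subst this
    rw [zero_mul, add_zero]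
    exact_mod_cast hΨ.apply_le_contactPotential v w

end Augmented

/-! ### Densities of vector measures and independence of the reference measure. -/

section VectorDensity

variable {X : Type*} [NormedAddCommGroup X] [NormedSpace ℝ X] [FiniteDimensional ℝ X]

/-- The `i`-th coordinate of an `X`-valued measure. -/
def coordMeasure (ν : VectorMeasure ℝ X) (i : Fin (Module.finrank ℝ X)) : SignedMeasure ℝ :=
  ν.mapRange ((Module.finBasis ℝ X).coord i).toAddMonoidHom
    ((Module.finBasis ℝ X).coord i).continuous_of_finiteDimensional

theorem coordMeasure_apply (ν : VectorMeasure ℝ X) (i : Fin (Module.finrank ℝ X)) (A : Set ℝ) :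
    coordMeasure ν i A = (Module.finBasis ℝ X).coord i (ν A) := rfl

theorem sum_coordMeasure (ν : VectorMeasure ℝ X) (A : Set ℝ) :
    ν A = ∑ i, coordMeasure ν i A • Module.finBasis ℝ X i := by
  simp only [coordMeasure_apply, Module.Basis.coord_apply]
  exact ((Module.finBasis ℝ X).sum_repr (ν A)).symm

/-- In a basis the variation is dominated by a finite combination of the total variations of signed
measures, which are finite. -/
theorem isFiniteMeasure_variation (ν : VectorMeasure ℝ X) : IsFiniteMeasure ν.variation := by
  have : ν.variation ≤ ∑ i, ‖Module.finBasis ℝ X i‖₊ • (coordMeasure ν i).totalVariation := by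
    refine VectorMeasure.variation_le_of_forall_enorm_le fun A _ => ?_
    rw [sum_coordMeasure ν A, Measure.finsetSum_apply]
    refine (enorm_sum_le _ _).trans (Finset.sum_le_sum fun i _ => ?_)
    rw [enorm_smul, mul_comm]
    exact mul_le_mul' le_rfl ((coordMeasure ν i).enorm_le_totalVariation A)
  exact isFiniteMeasure_of_le _ this

theorem vectorDensity_eq (ν : VectorMeasure ℝ X) (μ : Measure ℝ) (t : ℝ) :
    vectorDensity ν μ t =
      ∑ i, SignedMeasure.rnDeriv (coordMeasure ν i) μ t • Module.finBasis ℝ X i := rfl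

theorem integrable_vectorDensity (ν : VectorMeasure ℝ X) (μ : Measure ℝ) :
    Integrable (vectorDensity ν μ) μ :=
  integrable_finsetSum _ fun i _ =>
    (SignedMeasure.integrable_rnDeriv (coordMeasure ν i) μ).smul_const _

theorem stronglyMeasurable_vectorDensity (ν : VectorMeasure ℝ X) (μ : Measure ℝ) :
    StronglyMeasurable (vectorDensity ν μ) := by
  refine Finset.stronglyMeasurable_fun_sum _ fun i _ => ?_
  exact (SignedMeasure.measurable_rnDeriv (coordMeasure ν i) μ).stronglyMeasurable.smul_const _

theorem apply_eq_setIntegral_vectorDensity (ν : VectorMeasure ℝ X) {A : Set ℝ}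
    (hA : MeasurableSet A) :
    ν A = ∫ t in A, vectorDensity ν ν.variation t ∂ν.variation := by
  have := isFiniteMeasure_variation ν
  have h : ∀ i, coordMeasure ν i A =
      ∫ t in A, SignedMeasure.rnDeriv (coordMeasure ν i) ν.variation t ∂ν.variation := by
    intro i
    have hac : coordMeasure ν i ≪ᵥ ν.variation.toENNRealVectorMeasure := by
      refine VectorMeasure.AbsolutelyContinuous.mk fun s hs h0 => ?_
      rw [Measure.toENNRealVectorMeasure_apply_measurable hs] at h0
      have : ν s = 0 := by
        have := VectorMeasure.enorm_measure_le_variation ν s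
        rwa [h0, nonpos_iff_eq_zero, enorm_eq_zero] at this
      rw [coordMeasure_apply, this, map_zero]
    conv_lhs => rw [← SignedMeasure.withDensityᵥ_rnDeriv_eq (coordMeasure ν i) ν.variation hac]
    exact withDensityᵥ_apply (SignedMeasure.integrable_rnDeriv _ _) hA
  simp only [vectorDensity_eq]
  rw [integral_finsetSum _ fun i _ =>
    ((SignedMeasure.integrable_rnDeriv (coordMeasure ν i) _).smul_const _).integrableOn]
  rw [sum_coordMeasure ν A]
  exact Finset.sum_congr rfl fun i _ => by rw [integral_smul_const, h i]

/-- Jensen's inequality for a gauge and a vector measure. -/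
theorem ofReal_gauge_apply_le {N : X → ℝ} (hN : IsGauge N) (ν : VectorMeasure ℝ X) {A : Set ℝ}
    (hA : MeasurableSet A) :
    ENNReal.ofReal (N (ν A)) ≤
      ∫⁻ t in A, ENNReal.ofReal (N (vectorDensity ν ν.variation t)) ∂ν.variation := by
  have : CompleteSpace X := FiniteDimensional.complete ℝ X
  obtain ⟨ξ, hξ, hξ'⟩ := hN.exists_dual (ν A)
  rw [← hξ', apply_eq_setIntegral_vectorDensity ν hA,
    ← ξ.integral_comp_comm (integrable_vectorDensity ν _).integrableOn]
  exact (ofReal_integral_le_lintegral _ _).trans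
    (lintegral_mono fun t => ENNReal.ofReal_le_ofReal (hξ _))

/-- By homogeneity, the integral of a gauge of the density with respect to the variation can be
computed with any other reference measure. -/
theorem setLIntegral_vectorDensity_eq {N : X → ℝ} (hN : IsGauge N) {ν : VectorMeasure ℝ X}
    {m : Measure ℝ} [SFinite m] {g : ℝ → X} (hg : Integrable g m) (hν : ν = m.withDensityᵥ g) {B : Set ℝ}
    (hB : MeasurableSet B) :
    ∫⁻ t in B, ENNReal.ofReal (N (vectorDensity ν ν.variation t)) ∂ν.variation =
      ∫⁻ t in B, ENNReal.ofReal (N (g t)) ∂m := by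
  have : CompleteSpace X := FiniteDimensional.complete ℝ X
  have hvar : ν.variation = m.withDensity fun t => ‖g t‖ₑ := by
    rw [hν, Measure.variation_withDensityᵥ hg]
  set h := vectorDensity ν ν.variation with hh
  have hge : AEMeasurable (fun t => ‖g t‖ₑ) m := hg.aestronglyMeasurable.enorm
  have hgfin : ∀ᵐ t ∂m, ‖g t‖ₑ < ∞ := Eventually.of_forall fun t => enorm_lt_top
  have hint : Integrable (fun t => ‖g t‖ • h t) m := by
    have h1 := integrable_vectorDensity ν ν.variation
    rw [← hh, hvar, integrable_withDensity_iff_integrable_smul₀' hge hgfin] at h1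
    simpa using h1
  -- The variation of ν is ‖g‖ dm, so both sides have integral ν(A) over every measurable A.
  -- Homogeneity of N then absorbs the factor ‖g‖.
  have hae : (fun t => ‖g t‖ • h t) =ᵐ[m] g := by
    refine hint.ae_eq_of_forall_setIntegral_eq _ _ hg fun A hA _ => ?_
    have h1 := apply_eq_setIntegral_vectorDensity ν hA
    rw [← hh] at h1
    conv_lhs at h1 => rw [hν, withDensityᵥ_apply hg hA]
    rw [h1, hvar, setIntegral_withDensity_eq_setIntegral_toReal_smul₀ hge.restrict
      (ae_restrict_of_ae hgfin) _ hA]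
    simp
  have hNm : Measurable fun t => ENNReal.ofReal (N (h t)) :=
    (hN.continuous.comp_stronglyMeasurable
      (stronglyMeasurable_vectorDensity ν ν.variation)).measurable.ennreal_ofReal
  rw [hvar, restrict_withDensity hB, lintegral_withDensity_eq_lintegral_mul₀ hge.restrict
    hNm.aemeasurable]
  refine lintegral_congr_ae ?_
  filter_upwards [ae_restrict_of_ae hae] with t ht
  rw [Pi.mul_apply, ← ofReal_norm, ← ENNReal.ofReal_mul (norm_nonneg _),
    ← hN.smul _ _ (norm_nonneg _), ht]

end VectorDensity

/-! ### One-variable facts: monotone and Lipschitz maps, null images, bounded variation. -/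

section RealAnalysis

/-- A second preimage of the same value would force τ to be constant on a segment ending at s, where
the slopes would vanish. -/
theorem eq_of_deriv_pos_of_monotone {τ : ℝ → ℝ} (hτ : Monotone τ) {s s' d : ℝ}
    (hd : HasDerivAt τ d s) (hpos : 0 < d) (h : τ s' = τ s) : s' = s := by
  have hslope := hasDerivAt_iff_tendsto_slope.1 hd
  have hev : ∀ᶠ r in 𝓝[≠] s, 0 < slope τ s r := hslope.eventually (lt_mem_nhds hpos)
  rw [eventually_nhdsWithin_iff] at hev
  by_contra hne
  obtain ⟨δ, hδ, hball⟩ := Metric.eventually_nhds_iff.1 hev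
  rcases lt_or_gt_of_ne hne with hlt | hlt
  · set r := max s' (s - δ / 2) with hr
    have hrs : r < s := max_lt hlt (by linarith)
    have h1 := hball (y := r) (by
      rw [Real.dist_eq, abs_lt]; constructor <;> linarith [le_max_right s' (s - δ / 2)]) hrs.ne
    have h2 : τ r = τ s := le_antisymm (hτ hrs.le) (h ▸ hτ (le_max_left _ _))
    simp [slope_def_field, h2] at h1
  · set r := min s' (s + δ / 2) with hr
    have hrs : s < r := lt_min hlt (by linarith)
    have h1 := hball (y := r) (by
      rw [Real.dist_eq, abs_lt]; constructor <;> linarith [min_le_right s' (s + δ / 2)]) hrs.ne'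
    have h2 : τ r = τ s := le_antisymm (h ▸ hτ (min_le_left _ _)) (hτ hrs.le)
    simp [slope_def_field, h2] at h1

theorem hasDerivAt_lipschitz_comp_of_deriv_zero {h τ : ℝ → ℝ} {K : NNReal} (hh : LipschitzWith K h)
    {s : ℝ} (hτ : HasDerivAt τ 0 s) : HasDerivAt (fun r => h (τ r)) 0 s := by
  rw [hasDerivAt_iff_isLittleO] at hτ ⊢
  refine Asymptotics.IsBigO.trans_isLittleO (Asymptotics.IsBigO.of_bound K ?_) hτ
  refine Eventually.of_forall fun r => ?_
  simpa [Real.dist_eq] using hh.dist_le_mul (τ r) (τ s)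

theorem volume_image_null_of_lipschitz {τ : ℝ → ℝ} {K : NNReal} (hτ : LipschitzWith K τ)
    {N : Set ℝ} (hN : volume N = 0) : volume (τ '' N) = 0 := by
  have h := hτ.hausdorffMeasure_image_le (d := 1) zero_le_one N
  rw [← hausdorffMeasure_real] at hN ⊢
  rw [hN, mul_zero] at h
  exact nonpos_iff_eq_zero.1 h

theorem volume_image_deriv_zero (τ : ℝ → ℝ) : volume (τ '' {s | HasDerivAt τ 0 s}) = 0 := by
  refine addHaar_image_eq_zero_of_det_fderivWithin_eq_zero volume
    (f' := fun _ => ContinuousLinearMap.toSpanSingleton ℝ (0 : ℝ)) (fun s hs => ?_) (fun s _ => ?_)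
  · exact (HasDerivAt.hasFDerivAt hs).hasFDerivWithinAt
  · simp

theorem measurable_of_boundedVariationOn {f : ℝ → ℝ} (hf : BoundedVariationOn f univ) :
    Measurable f := by
  obtain ⟨p, q, hp, hq, rfl⟩ := hf.locallyBoundedVariationOn.exists_monotoneOn_sub_monotoneOn
  exact (monotoneOn_univ.1 hp).measurable.sub (monotoneOn_univ.1 hq).measurable

theorem stronglyMeasurable_of_boundedVariationOn {X : Type*} [NormedAddCommGroup X]
    [NormedSpace ℝ X] [FiniteDimensional ℝ X] {f : ℝ → X} (hf : BoundedVariationOn f univ) :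
    StronglyMeasurable f := by
  have h : f = fun t => ∑ i, (Module.finBasis ℝ X).coord i (f t) • Module.finBasis ℝ X i := by
    funext t
    exact ((Module.finBasis ℝ X).sum_repr (f t)).symm
  rw [h]
  refine Finset.stronglyMeasurable_fun_sum _ fun i _ => ?_
  refine StronglyMeasurable.smul_const (Measurable.stronglyMeasurable ?_) _
  refine measurable_of_boundedVariationOn (f := fun t => (Module.finBasis ℝ X).coord i (f t)) ?_
  exact (LinearMap.toContinuousLinearMap
    ((Module.finBasis ℝ X).coord i)).lipschitz.comp_boundedVariationOn hf

theorem isBounded_range_of_boundedVariationOn {X : Type*} [PseudoMetricSpace X] {f : ℝ → X}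
    (hf : BoundedVariationOn f univ) : Bornology.IsBounded (range f) := by
  rw [Metric.isBounded_iff]
  refine ⟨(eVariationOn f univ).toReal, ?_⟩
  rintro _ ⟨s, rfl⟩ _ ⟨t, rfl⟩
  exact hf.dist_le (mem_univ s) (mem_univ t)

end RealAnalysis

/-! ### Extension of curves to the whole line, the work functional and pointwise stability. -/

section Extension

theorem clamp_mem_Icc {T : ℝ} (hT : 0 ≤ T) (t : ℝ) : max 0 (min T t) ∈ Icc 0 T :=
  ⟨le_max_left _ _, max_le hT (min_le_left _ _)⟩

theorem clamp_of_mem_Icc {T t : ℝ} (ht : t ∈ Icc 0 T) : max 0 (min T t) = t := by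
  rw [min_eq_right ht.2, max_eq_right ht.1]

theorem monotone_clamp (T : ℝ) : Monotone fun t : ℝ => max 0 (min T t) :=
  fun _ _ h => max_le_max le_rfl (min_le_min le_rfl h)

theorem lipschitzWith_clamp (T : ℝ) : LipschitzWith 1 fun t : ℝ => max 0 (min T t) :=
  (LipschitzWith.id.const_min T).const_max 0

variable {X : Type*} [NormedAddCommGroup X] [NormedSpace ℝ X]

theorem extend_of_mem {T t : ℝ} (u : ℝ → X) (ht : t ∈ Icc 0 T) : extend T u t = u t := by
  rw [extend, clamp_of_mem_Icc ht]

theorem lipschitzWith_extend {S : ℝ} (hS : 0 ≤ S) {u : ℝ → X} {K : NNReal}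
    (hu : LipschitzOnWith K u (Icc 0 S)) : LipschitzWith K (extend S u) := by
  have h := hu.comp (lipschitzWith_clamp S).lipschitzOnWith (s := univ)
    fun t _ => clamp_mem_Icc hS t
  rwa [mul_one, lipschitzOnWith_univ] at h

theorem extend_eventuallyEq {S s : ℝ} (u : ℝ → X) (hs : s ∈ Ioo 0 S) :
    extend S u =ᶠ[𝓝 s] u := by
  filter_upwards [isOpen_Ioo.mem_nhds hs] with r hr
  exact extend_of_mem u (Ioo_subset_Icc_self hr)

/-- The power `∂_t E_t(u(t))` of the external loading along a curve, extended to `ℝ`. -/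
def power (T : ℝ) (E : ℝ → X → ℝ) (u : ℝ → X) (t : ℝ) : ℝ :=
  timeDeriv T E (max 0 (min T t)) (extend T u t)

/-- The work of the external loading along a curve. -/
def work (T : ℝ) (E : ℝ → X → ℝ) (u : ℝ → X) (t : ℝ) : ℝ :=
  ∫ r in (0 : ℝ)..t, power T E u r

variable {T : ℝ} {E : ℝ → X → ℝ} {u : ℝ → X}

theorem work_zero : work T E u 0 = 0 := intervalIntegral.integral_same

theorem work_eq {t : ℝ} (ht : t ∈ Icc 0 T) :
    work T E u t = ∫ r in (0 : ℝ)..t, timeDeriv T E r (u r) := by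
  refine intervalIntegral.integral_congr fun r hr => ?_
  rw [uIcc_of_le ht.1] at hr
  have hr' : r ∈ Icc 0 T := ⟨hr.1, hr.2.trans ht.2⟩
  simp only [power]
  rw [extend_of_mem u hr', clamp_of_mem_Icc hr']

theorem continuous_timeDeriv_clamp (hT : 0 < T) (hE : IsAdmissibleEnergy T E) :
    Continuous fun q : ℝ × X => timeDeriv T E (max 0 (min T q.1)) q.2 := by
  have h : Continuous fun q : ℝ × X => (max 0 (min T q.1), q.2) := by fun_prop
  exact (hE.continuousOn_timeDeriv hT).comp_continuous h
    fun q => ⟨clamp_mem_Icc hT.le _, mem_univ _⟩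

theorem continuousAt_power (hT : 0 < T) (hE : IsAdmissibleEnergy T E) {t : ℝ}
    (hu : ContinuousAt (extend T u) t) : ContinuousAt (power T E u) t :=
  ContinuousAt.comp (f := fun r => (r, extend T u r))
    (continuous_timeDeriv_clamp hT hE).continuousAt (continuousAt_id.prodMk hu)

variable [FiniteDimensional ℝ X]

theorem stronglyMeasurable_power (hT : 0 < T) (hE : IsAdmissibleEnergy T E)
    (hu : BoundedVariationOn u (Icc 0 T)) : StronglyMeasurable (power T E u) :=
  (continuous_timeDeriv_clamp hT hE).comp_stronglyMeasurable
    (stronglyMeasurable_id.prodMk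
      (stronglyMeasurable_of_boundedVariationOn (boundedVariationOn_extend hT.le hu)))

theorem exists_power_bound (hT : 0 < T) (hE : IsAdmissibleEnergy T E)
    (hu : BoundedVariationOn u (Icc 0 T)) : ∃ C : NNReal, ∀ t, ‖power T E u t‖ ≤ C := by
  obtain ⟨R, hR⟩ := (isBounded_range_of_boundedVariationOn
    (boundedVariationOn_extend hT.le hu)).exists_norm_le
  have hcomp : IsCompact (Icc 0 T ×ˢ Metric.closedBall (0 : X) R) :=
    isCompact_Icc.prod (isCompact_closedBall _ _)
  obtain ⟨C, hC⟩ := hcomp.exists_bound_of_continuousOn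
    ((hE.continuousOn_timeDeriv hT).mono (prod_mono le_rfl (subset_univ _)))
  refine ⟨C.toNNReal, fun t => ?_⟩
  refine (hC (max 0 (min T t), extend T u t) ⟨clamp_mem_Icc hT.le t, ?_⟩).trans
    (Real.le_coe_toNNReal C)
  exact mem_closedBall_zero_iff.2 (hR _ (mem_range_self t))

theorem intervalIntegrable_power (hT : 0 < T) (hE : IsAdmissibleEnergy T E)
    (hu : BoundedVariationOn u (Icc 0 T)) (a b : ℝ) :
    IntervalIntegrable (power T E u) volume a b := by
  obtain ⟨C, hC⟩ := exists_power_bound hT hE hu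
  refine (intervalIntegrable_const (c := (C : ℝ))).mono_fun
    (stronglyMeasurable_power hT hE hu).aestronglyMeasurable (Eventually.of_forall fun t => ?_)
  simpa using hC t

theorem exists_lipschitzWith_work (hT : 0 < T) (hE : IsAdmissibleEnergy T E)
    (hu : BoundedVariationOn u (Icc 0 T)) : ∃ C, LipschitzWith C (work T E u) := by
  obtain ⟨C, hC⟩ := exists_power_bound hT hE hu
  refine ⟨C, LipschitzWith.of_dist_le_mul fun s t => ?_⟩
  rw [Real.dist_eq, Real.dist_eq, work, work, intervalIntegral.integral_interval_sub_left
    (intervalIntegrable_power hT hE hu _ _) (intervalIntegrable_power hT hE hu _ _)]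
  exact intervalIntegral.norm_integral_le_of_norm_le_const fun r _ => hC r

theorem hasDerivAt_work (hT : 0 < T) (hE : IsAdmissibleEnergy T E)
    (hu : BoundedVariationOn u (Icc 0 T)) {t : ℝ} (ht : ContinuousAt (extend T u) t) :
    HasDerivAt (work T E u) (power T E u t) t :=
  intervalIntegral.integral_hasDerivAt_right (intervalIntegrable_power hT hE hu _ _)
    ((stronglyMeasurable_power hT hE hu).stronglyMeasurableAtFilter) (continuousAt_power hT hE ht)

/-- A set of full measure is dense and K* is closed, so stability passes to every continuity point.
Almost every t would not do: the diffuse derivative may charge Lebesgue-null sets. -/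
theorem force_mem_stableSet_of_ae {Ψ₀ : X → ℝ} (hT : 0 < T) (hE : IsAdmissibleEnergy T E)
    (hst : ∀ᵐ t, t ∈ Ioo 0 T → force E t (u t) ∈ stableSet Ψ₀) {t : ℝ} (ht : t ∈ Icc 0 T)
    (hu : ContinuousAt (extend T u) t) : force E t (u t) ∈ stableSet Ψ₀ := by
  have hd := (Measure.dense_of_ae hst).open_subset_closure_inter (isOpen_Ioo (a := 0) (b := T))
  have hcl : t ∈ closure (Ioo 0 T ∩ {t | t ∈ Ioo 0 T → force E t (u t) ∈ stableSet Ψ₀}) := by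
    have := closure_mono hd
    rw [closure_Ioo hT.ne, closure_closure] at this
    exact this ht
  have hc : ContinuousWithinAt (fun r => force E r (u r)) (Icc 0 T) t := by
    have h1 : ContinuousWithinAt u (Icc 0 T) t :=
      hu.continuousWithinAt.congr (fun r hr => (extend_of_mem u hr).symm) (extend_of_mem u ht).symm
    have hm : MapsTo (fun r => (r, u r)) (Icc 0 T) (Icc 0 T ×ˢ univ) := fun r hr => ⟨hr, mem_univ _⟩
    exact ContinuousWithinAt.comp (f := fun r => (r, u r))
      (hE.continuousOn_force hT (t, u t) ⟨ht, mem_univ _⟩)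
      (continuousWithinAt_id.prodMk h1) hm
  have h2 := (hc.mono (inter_subset_left.trans Ioo_subset_Icc_self)).mem_closure_image hcl
  refine (isClosed_stableSet Ψ₀).closure_subset_iff.2 ?_ h2
  rintro _ ⟨r, ⟨hr1, hr2⟩, rfl⟩
  exact hr2 hr1

end Extension

/-! ### From the energy inequality to the contact condition. -/

section BalancedCurve

variable {X : Type*} [NormedAddCommGroup X] [NormedSpace ℝ X]

/-- A nondegenerate surjective parametrized curve, defined on the whole line, which is stable where
time runs and satisfies the contact condition `𝔭(u̇, -DE) = ⟨-DE, u̇⟩` almost everywhere. -/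
structure IsBalancedCurve (T S : ℝ) (Ψ₀ Ψ : X → ℝ) (E : ℝ → X → ℝ) (τ : ℝ → ℝ) (υ : ℝ → X) :
    Prop where
  monotone : Monotone τ
  lipschitz_time : ∃ K, LipschitzWith K τ
  lipschitz_state : ∃ K, LipschitzWith K υ
  mem : ∀ s, τ s ∈ Icc 0 T
  zero : τ 0 = 0
  top : τ S = T
  stable : ∀ᵐ s, s ∈ Ioo 0 S → 0 < deriv τ s → force E (τ s) (υ s) ∈ stableSet Ψ₀
  contact : ∀ᵐ s, s ∈ Ioo 0 S → contactPotential Ψ (deriv υ s) (force E (τ s) (υ s)) =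
    force E (τ s) (υ s) (deriv υ s)
  nondegenerate : ∀ᵐ s, s ∈ Ioo 0 S → 0 < deriv τ s + Ψ₀ (deriv υ s)

variable [FiniteDimensional ℝ X] {T S : ℝ} {Ψ₀ Ψ : X → ℝ} {E : ℝ → X → ℝ}

theorem measurable_augmentedPotential_comp (hT : 0 < T) (hΨ₀ : IsGauge Ψ₀)
    (hΨ : IsViscousPotential Ψ₀ Ψ) (hE : IsAdmissibleEnergy T E) {τ : ℝ → ℝ} {υ : ℝ → X}
    (hτ : Continuous τ) (hυ : Continuous υ) (hmem : ∀ s, τ s ∈ Icc 0 T) :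
    Measurable fun s => augmentedPotential Ψ₀ Ψ (deriv τ s) (deriv υ s)
      (-timeDeriv T E (τ s) (υ s)) (force E (τ s) (υ s)) := by
  have : CompleteSpace X := FiniteDimensional.complete ℝ X
  have : ProperSpace X := FiniteDimensional.proper ℝ X
  have : ProperSpace (X →L[ℝ] ℝ) := FiniteDimensional.proper ℝ _
  borelize X
  borelize (X →L[ℝ] ℝ)
  have hpair : Continuous fun s => (τ s, υ s) := hτ.prodMk hυ
  have hw : Continuous fun s => force E (τ s) (υ s) :=
    (hE.continuousOn_force hT).comp_continuous hpair fun s => ⟨hmem s, mem_univ _⟩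
  have hp : Continuous fun s => timeDeriv T E (τ s) (υ s) :=
    (hE.continuousOn_timeDeriv hT).comp_continuous hpair fun s => ⟨hmem s, mem_univ _⟩
  have hdτ : Measurable (deriv τ) := measurable_deriv τ
  have hdυ : Measurable (deriv υ) := measurable_deriv υ
  unfold augmentedPotential
  refine Measurable.ite (measurableSet_lt measurable_const hdτ) ?_ ?_
  · refine Measurable.ite (hw.measurable (isClosed_stableSet Ψ₀).measurableSet) ?_ measurable_const
    exact ((hΨ₀.continuous.measurable.comp hdυ).add
      (hdτ.mul hp.measurable.neg)).coe_real_ereal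
  · exact (hΨ.measurable_contactPotential.comp (hdυ.prodMk hw.measurable)).coe_real_ereal

/-- The energy inequality on the whole of [0, S] meets the opposite pointwise bound
`le_augmentedPotential`, so 𝔓 equals minus the derivative of the energy a.e. In particular 𝔓 is
finite there, which is stability wherever time runs. -/
theorem IsParametrizedSolution.isBalancedCurve (hT : 0 < T) (hΨ₀ : IsGauge Ψ₀)
    (hΨ : IsViscousPotential Ψ₀ Ψ) (hE : IsAdmissibleEnergy T E) {tt : ℝ → ℝ} {uu : ℝ → X}
    (hS : 0 < S) (h : IsParametrizedSolution T Ψ₀ Ψ E 0 S tt uu)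
    (hnd : IsNondegenerate Ψ₀ 0 S tt uu) (hsurj : IsSurjective T 0 S tt) :
    IsBalancedCurve T S Ψ₀ Ψ E (extend S tt) (extend S uu) := by
  obtain ⟨K, hK⟩ := h.lipschitz_time
  obtain ⟨L, hL⟩ := h.lipschitz_state
  have hmem : ∀ s, extend S tt s ∈ Icc 0 T := fun s => h.mapsTo (clamp_mem_Icc hS.le s)
  have hmono : Monotone (extend S tt) := fun s s' hs =>
    h.monotone (clamp_mem_Icc hS.le s) (clamp_mem_Icc hS.le s') (monotone_clamp S hs)
  have hdt : ∀ s ∈ Ioo 0 S, deriv (extend S tt) s = deriv tt s := fun s hs =>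
    (extend_eventuallyEq tt hs).deriv_eq
  have hdu : ∀ s ∈ Ioo 0 S, deriv (extend S uu) s = deriv uu s := fun s hs =>
    (extend_eventuallyEq uu hs).deriv_eq
  have hvt : ∀ s ∈ Ioo 0 S, extend S tt s = tt s := fun s hs =>
    extend_of_mem tt (Ioo_subset_Icc_self hs)
  have hvu : ∀ s ∈ Ioo 0 S, extend S uu s = uu s := fun s hs =>
    extend_of_mem uu (Ioo_subset_Icc_self hs)
  have hKe := lipschitzWith_extend hS.le hK
  have hLe := lipschitzWith_extend hS.le hL
  obtain ⟨M, hM⟩ := hE.exists_lipschitzOnWith_comp h.mapsTo hK hL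
  have hchain : ∀ᵐ s, s ∈ Ioo 0 S → deriv (fun r => E (tt r) (uu r)) s =
      deriv tt s * timeDeriv T E (tt s) (uu s) - force E (tt s) (uu s) (deriv uu s) := by
    filter_upwards [ae_differentiableAt_of_lipschitzOnWith hK,
      ae_differentiableAt_of_lipschitzOnWith hL] with s h1 h2 hs
    refine (hE.hasDerivAt_comp hT (h1 hs).hasDerivAt (h2 hs).hasDerivAt ?_).deriv
    filter_upwards [isOpen_Ioo.mem_nhds hs] with r hr
    exact h.mapsTo (Ioo_subset_Icc_self hr)
  have hdt_nonneg : ∀ s ∈ Ioo 0 S, 0 ≤ deriv tt s := fun s hs => by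
    rw [← hdt s hs]
    exact hmono.deriv_nonneg
  have hlow : ∀ᵐ s, s ∈ Ioo 0 S → ((-deriv (fun r => E (tt r) (uu r)) s : ℝ) : EReal) ≤
      augmentedPotential Ψ₀ Ψ (deriv tt s) (deriv uu s)
        (-timeDeriv T E (tt s) (uu s)) (force E (tt s) (uu s)) := by
    filter_upwards [hchain] with s h1 hs
    rw [h1 hs]
    refine le_trans (le_of_eq ?_) (le_augmentedPotential hΨ (hdt_nonneg s hs) _ _ _)
    congr 1
    ring
  have hmeas : AEMeasurable (fun s => augmentedPotential Ψ₀ Ψ (deriv tt s) (deriv uu s)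
      (-timeDeriv T E (tt s) (uu s)) (force E (tt s) (uu s))) (volume.restrict (Ioc 0 S)) := by
    refine ⟨_, measurable_augmentedPotential_comp hT hΨ₀ hΨ hE hKe.continuous hLe.continuous hmem, ?_⟩
    refine ae_Ioo_of_ae_Ioc (Eventually.of_forall fun s hs => ?_)
    beta_reduce
    rw [hdt s hs, hdu s hs, hvt s hs, hvu s hs]
  have heq := ae_eq_neg_deriv_of_erealIntegral_add_le hS.le hM hmeas hlow
    (h.energy_le 0 S le_rfl hS.le le_rfl)
  rw [← restrict_Ioo_eq_restrict_Ioc, ae_restrict_iff' measurableSet_Ioo] at heq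
  have hstable : ∀ᵐ s, s ∈ Ioo 0 S → 0 < deriv tt s →
      force E (tt s) (uu s) ∈ stableSet Ψ₀ ∧
      Ψ₀ (deriv uu s) = force E (tt s) (uu s) (deriv uu s) := by
    filter_upwards [heq, hchain] with s h1 h2 hs hpos
    have h3 := h1 hs
    rw [h2 hs, augmentedPotential, if_pos hpos] at h3
    split_ifs at h3 with h4
    · rw [EReal.coe_eq_coe_iff] at h3
      exact ⟨h4, by linarith⟩
    · exact absurd h3.symm (EReal.coe_ne_top _)
  refine ⟨hmono, ⟨K, hKe⟩, ⟨L, hLe⟩, hmem, ?_, ?_, ?_, ?_, ?_⟩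
  · rw [extend_of_mem tt (left_mem_Icc.2 hS.le), hsurj.1]
  · rw [extend_of_mem tt (right_mem_Icc.2 hS.le), hsurj.2]
  · filter_upwards [hstable] with s h1 hs hpos
    rw [hdt s hs] at hpos
    rw [hvt s hs, hvu s hs]
    exact (h1 hs hpos).1
  · filter_upwards [hstable, heq, hchain] with s h1 h2 h3 hs
    rw [hvt s hs, hvu s hs, hdu s hs]
    rcases (hdt_nonneg s hs).eq_or_lt with h0 | hpos
    · have h4 := h2 hs
      rw [h3 hs, augmentedPotential, ← h0, if_neg (lt_irrefl _), EReal.coe_eq_coe_iff] at h4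
      linarith
    · obtain ⟨h4, h5⟩ := h1 hs hpos
      rw [hΨ.contactPotential_eq_of_stable h4, h5]
  · filter_upwards [hnd] with s h1 hs
    rw [hdt s hs, hdu s hs]
    exact h1 hs

end BalancedCurve

/-! ### Right inverses of the time rescaling and their one-sided limits. -/

section Selection

/-- A right inverse `σ` of the rescaling `τ`, extended to `ℝ` by its end values. -/
structure IsSelection (T S : ℝ) (τ σ : ℝ → ℝ) : Prop where
  mem : ∀ t, σ t ∈ Icc 0 S
  right_inv : ∀ t, τ (σ t) = max 0 (min T t)
  clamp : ∀ t, σ (max 0 (min T t)) = σ t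

variable {T S : ℝ} {τ σ : ℝ → ℝ}

theorem IsSelection.monotone (h : IsSelection T S τ σ) (hτ : Monotone τ) : Monotone σ := by
  intro t t' htt
  rcases (monotone_clamp T htt).eq_or_lt with heq | hlt
  · rw [← h.clamp t, ← h.clamp t']
    exact (congrArg σ heq).le
  · have h1 : τ (σ t) < τ (σ t') := by rw [h.right_inv, h.right_inv]; exact hlt
    exact (hτ.reflect_lt h1).le

theorem IsSelection.right_inv_leftLim (h : IsSelection T S τ σ) (hτ : Monotone τ)
    (hc : Continuous τ) (t : ℝ) : τ (Function.leftLim σ t) = max 0 (min T t) := by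
  refine tendsto_nhds_unique
    ((hc.tendsto _).comp ((h.monotone hτ).tendsto_leftLim t)) ?_
  refine Tendsto.congr (fun r => (h.right_inv r).symm) ?_
  exact ((lipschitzWith_clamp T).continuous.tendsto t).mono_left nhdsWithin_le_nhds

theorem IsSelection.right_inv_rightLim (h : IsSelection T S τ σ) (hτ : Monotone τ)
    (hc : Continuous τ) (t : ℝ) : τ (Function.rightLim σ t) = max 0 (min T t) := by
  refine tendsto_nhds_unique
    ((hc.tendsto _).comp ((h.monotone hτ).tendsto_rightLim t)) ?_
  refine Tendsto.congr (fun r => (h.right_inv r).symm) ?_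
  exact ((lipschitzWith_clamp T).continuous.tendsto t).mono_left nhdsWithin_le_nhds

theorem IsSelection.leftLim_mem (h : IsSelection T S τ σ) (hτ : Monotone τ) (t : ℝ) :
    Function.leftLim σ t ∈ Icc 0 S :=
  isClosed_Icc.mem_of_tendsto ((h.monotone hτ).tendsto_leftLim t) (Eventually.of_forall h.mem)

theorem IsSelection.rightLim_mem (h : IsSelection T S τ σ) (hτ : Monotone τ) (t : ℝ) :
    Function.rightLim σ t ∈ Icc 0 S :=
  isClosed_Icc.mem_of_tendsto ((h.monotone hτ).tendsto_rightLim t) (Eventually.of_forall h.mem)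

/-- Whatever σ is chosen, its one-sided limits are the two generalized inverses of τ. The bound by
σ(T) matters only at t = T, where σ is constant to the right. -/
theorem IsSelection.le_rightLim_iff (h : IsSelection T S τ σ) (hτ : Monotone τ)
    (hc : Continuous τ) {s t : ℝ} (ht : t ∈ Icc 0 T) (hs : s ≤ σ T) :
    s ≤ Function.rightLim σ t ↔ τ s ≤ t := by
  constructor
  · intro hle
    have h1 := hτ hle
    rwa [h.right_inv_rightLim hτ hc, clamp_of_mem_Icc ht] at h1
  · intro hle
    rcases ht.2.eq_or_lt with rfl | hlt
    · exact hs.trans ((h.monotone hτ).le_rightLim le_rfl)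
    · refine ge_of_tendsto ((h.monotone hτ).tendsto_rightLim t) ?_
      filter_upwards [Ioo_mem_nhdsGT hlt] with r hr
      have h1 : τ s < τ (σ r) := by
        rw [h.right_inv, clamp_of_mem_Icc ⟨ht.1.trans hr.1.le, hr.2.le⟩]
        exact hle.trans_lt hr.1
      exact (hτ.reflect_lt h1).le

theorem IsSelection.leftLim_le_iff (h : IsSelection T S τ σ) (hτ : Monotone τ)
    (hc : Continuous τ) {s t : ℝ} (ht : t ∈ Icc 0 T) (hs : σ 0 ≤ s) :
    Function.leftLim σ t ≤ s ↔ t ≤ τ s := by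
  constructor
  · intro hle
    have h1 := hτ hle
    rwa [h.right_inv_leftLim hτ hc, clamp_of_mem_Icc ht] at h1
  · intro hle
    rcases ht.1.eq_or_lt with rfl | hlt
    · exact ((h.monotone hτ).leftLim_le le_rfl).trans hs
    · refine le_of_tendsto ((h.monotone hτ).tendsto_leftLim t) ?_
      filter_upwards [Ioo_mem_nhdsLT hlt] with r hr
      have h1 : τ (σ r) < τ s := by
        rw [h.right_inv, clamp_of_mem_Icc ⟨hr.1.le, hr.2.le.trans ht.2⟩]
        exact hr.2.trans_le hle
      exact (hτ.reflect_lt h1).le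

variable {X : Type*} [NormedAddCommGroup X] [NormedSpace ℝ X] {υ u : ℝ → X}

theorem IsSelection.leftValue_eq (h : IsSelection T S τ σ) (hτ : Monotone τ)
    (hυ : Continuous υ) (hu : ∀ t, extend T u t = υ (σ t)) (t : ℝ) :
    leftValue T u t = υ (Function.leftLim σ t) :=
  leftLim_eq_of_tendsto
    (((hυ.tendsto _).comp ((h.monotone hτ).tendsto_leftLim t)).congr fun r => (hu r).symm)

theorem IsSelection.rightValue_eq (h : IsSelection T S τ σ) (hτ : Monotone τ)
    (hυ : Continuous υ) (hu : ∀ t, extend T u t = υ (σ t)) (t : ℝ) :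
    rightValue T u t = υ (Function.rightLim σ t) :=
  rightLim_eq_of_tendsto
    (((hυ.tendsto _).comp ((h.monotone hτ).tendsto_rightLim t)).congr fun r => (hu r).symm)

theorem IsSelection.boundedVariationOn (h : IsSelection T S τ σ) (hτ : Monotone τ) {K : NNReal}
    (hυ : LipschitzWith K υ) (hT : 0 ≤ T) (hu : ∀ t, extend T u t = υ (σ t)) :
    BoundedVariationOn u (Icc 0 T) := by
  have h1 : BoundedVariationOn σ (Icc 0 T) := by
    have h2 := ((h.monotone hτ).monotoneOn (Icc 0 T)).eVariationOn_eq (left_mem_Icc.2 hT)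
      (right_mem_Icc.2 hT)
    rw [inter_self] at h2
    exact h2.trans_ne ENNReal.ofReal_ne_top
  have h2 := hυ.comp_boundedVariationOn h1
  have h3 : EqOn (υ ∘ σ) u (Icc 0 T) := fun t ht => by
    rw [Function.comp_apply, ← hu, extend_of_mem u ht]
  unfold BoundedVariationOn at h2 ⊢
  rwa [← eVariationOn.congr h3]

theorem IsSelection.continuousAt_extend (h : IsSelection T S τ σ) (hτ : Monotone τ)
    (hυ : Continuous υ) (hu : ∀ t, extend T u t = υ (σ t)) {t : ℝ}
    (ht : Function.leftLim σ t = Function.rightLim σ t) : ContinuousAt (extend T u) t := by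
  have h1 : ContinuousAt σ t := (h.monotone hτ).continuousAt_iff_leftLim_eq_rightLim.2 ht
  have h2 : extend T u = υ ∘ σ := funext hu
  rw [h2]
  exact hυ.continuousAt.comp h1

end Selection

/-! ### Dissipation along a balanced curve, jump times and almost everywhere stability. -/

section BalancedCurve

variable {X : Type*} [NormedAddCommGroup X] [NormedSpace ℝ X] [FiniteDimensional ℝ X]
  {T S : ℝ} {Ψ₀ Ψ : X → ℝ} {E : ℝ → X → ℝ} {τ σ : ℝ → ℝ} {υ u : ℝ → X}

theorem IsSelection.lims_eq_of_deriv_pos (h : IsSelection T S τ σ)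
    (hb : IsBalancedCurve T S Ψ₀ Ψ E τ υ) {s : ℝ} (hd : DifferentiableAt ℝ τ s)
    (hpos : 0 < deriv τ s) :
    Function.leftLim σ (τ s) = s ∧ Function.rightLim σ (τ s) = s ∧ σ (τ s) = s := by
  obtain ⟨K, hK⟩ := hb.lipschitz_time
  have hcl := clamp_of_mem_Icc (hb.mem s)
  refine ⟨?_, ?_, ?_⟩
  · exact eq_of_deriv_pos_of_monotone hb.monotone hd.hasDerivAt hpos
      ((h.right_inv_leftLim hb.monotone hK.continuous _).trans hcl)
  · exact eq_of_deriv_pos_of_monotone hb.monotone hd.hasDerivAt hpos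
      ((h.right_inv_rightLim hb.monotone hK.continuous _).trans hcl)
  · exact eq_of_deriv_pos_of_monotone hb.monotone hd.hasDerivAt hpos ((h.right_inv _).trans hcl)

/-- Work minus energy along a balanced curve. -/
def dissipated (T : ℝ) (E : ℝ → X → ℝ) (u : ℝ → X) (τ : ℝ → ℝ) (υ : ℝ → X) (s : ℝ) : ℝ :=
  work T E u (τ s) - E (τ s) (υ s)

theorem IsSelection.exists_lipschitzOnWith_dissipated (h : IsSelection T S τ σ) (hT : 0 < T)
    (hE : IsAdmissibleEnergy T E) (hb : IsBalancedCurve T S Ψ₀ Ψ E τ υ)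
    (hu : ∀ t, extend T u t = υ (σ t)) :
    ∃ K, LipschitzOnWith K (dissipated T E u τ υ) (Icc 0 S) := by
  obtain ⟨K, hK⟩ := hb.lipschitz_time
  obtain ⟨L, hL⟩ := hb.lipschitz_state
  obtain ⟨C, hC⟩ := exists_lipschitzWith_work hT hE (h.boundedVariationOn hb.monotone hL hT.le hu)
  obtain ⟨M, hM⟩ := hE.exists_lipschitzOnWith_comp (a := 0) (b := S) (fun s _ => hb.mem s)
    hK.lipschitzOnWith hL.lipschitzOnWith
  exact ⟨_, (hC.comp hK).lipschitzOnWith.sub hM⟩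

/-- The work is computed along u, the energy along υ. Where τ' > 0 the point s is the only preimage
of τ(s), so u is continuous there with value υ(s), and the powers cancel. Where τ' = 0 the Lipschitz
work contributes nothing. What remains is ⟨w, υ̇⟩, which is 𝔭 by the contact condition. -/
theorem IsSelection.deriv_dissipated (h : IsSelection T S τ σ) (hT : 0 < T)
    (hE : IsAdmissibleEnergy T E) (hb : IsBalancedCurve T S Ψ₀ Ψ E τ υ)
    (hu : ∀ t, extend T u t = υ (σ t)) :
    ∀ᵐ s, s ∈ Ioo 0 S → deriv (dissipated T E u τ υ) s =
      contactPotential Ψ (deriv υ s) (force E (τ s) (υ s)) := by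
  obtain ⟨K, hK⟩ := hb.lipschitz_time
  obtain ⟨L, hL⟩ := hb.lipschitz_state
  have hBV := h.boundedVariationOn hb.monotone hL hT.le hu
  obtain ⟨C, hC⟩ := exists_lipschitzWith_work hT hE hBV
  filter_upwards [hb.contact,
    ae_differentiableAt_of_lipschitzOnWith (hK.lipschitzOnWith (s := Icc 0 S)),
    ae_differentiableAt_of_lipschitzOnWith (hL.lipschitzOnWith (s := Icc 0 S))] with s h1 h2 h3 hs
  have hwork : HasDerivAt (fun r => work T E u (τ r))
      (deriv τ s * timeDeriv T E (τ s) (υ s)) s := by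
    rcases hb.monotone.deriv_nonneg.eq_or_lt with h0 | hpos
    · rw [← h0, zero_mul]
      refine hasDerivAt_lipschitz_comp_of_deriv_zero hC ?_
      rw [h0]
      exact (h2 hs).hasDerivAt
    · obtain ⟨e1, e2, e3⟩ := h.lims_eq_of_deriv_pos hb (h2 hs) hpos
      have hcont := h.continuousAt_extend hb.monotone hL.continuous hu (e1.trans e2.symm)
      have h4 := (hasDerivAt_work hT hE hBV hcont).comp s (h2 hs).hasDerivAt
      have h5 : power T E u (τ s) = timeDeriv T E (τ s) (υ s) := by
        rw [power, clamp_of_mem_Icc (hb.mem s), hu, e3]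
      rw [h5, mul_comm] at h4
      exact h4
  have hen := hE.hasDerivAt_comp hT (h2 hs).hasDerivAt (h3 hs).hasDerivAt
    (Eventually.of_forall hb.mem)
  rw [h1 hs]
  have := (hwork.sub hen).deriv
  refine Eq.trans this ?_
  ring

theorem IsSelection.dissipation_Ioc (h : IsSelection T S τ σ) (hT : 0 < T) (hΨ₀ : IsGauge Ψ₀)
    (hΨ : IsViscousPotential Ψ₀ Ψ) (hE : IsAdmissibleEnergy T E)
    (hb : IsBalancedCurve T S Ψ₀ Ψ E τ υ) (hu : ∀ t, extend T u t = υ (σ t)) {s₁ s₂ : ℝ}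
    (h0 : 0 ≤ s₁) (h12 : s₁ ≤ s₂) (h2S : s₂ ≤ S) :
    dissipated T E u τ υ s₁ ≤ dissipated T E u τ υ s₂ ∧
      ∫⁻ s in Ioc s₁ s₂, ENNReal.ofReal (contactPotential Ψ (deriv υ s) (force E (τ s) (υ s))) =
        ENNReal.ofReal (dissipated T E u τ υ s₂ - dissipated T E u τ υ s₁) := by
  obtain ⟨K, hK⟩ := h.exists_lipschitzOnWith_dissipated hT hE hb hu
  have hK' := hK.mono (Icc_subset_Icc h0 h2S)
  have hae := ae_Ioo_of_ae_Ioc (a := s₁) (b := s₂)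
    ((h.deriv_dissipated hT hE hb hu).mono fun s hs hs12 => hs (Ioo_subset_Ioo h0 h2S hs12))
  have hnn : 0 ≤ᵐ[volume.restrict (Ioc s₁ s₂)] deriv (dissipated T E u τ υ) := by
    filter_upwards [hae] with s hs
    rw [hs]
    exact hΨ.contactPotential_nonneg hΨ₀ _ _
  have hint := integrableOn_deriv_of_lipschitzOnWith h12 hK'
  have hval := integral_Ioc_deriv_of_lipschitzOnWith h12 hK'
  refine ⟨?_, ?_⟩
  · have := integral_nonneg_of_ae hnn
    linarith
  · rw [← hval, ofReal_integral_eq_lintegral_ofReal hint hnn]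
    refine lintegral_congr_ae ?_
    filter_upwards [hae] with s hs
    rw [hs]

/-- On a time slice the Finsler cost is realized by the curve itself. -/
theorem IsSelection.finslerCost_eq (h : IsSelection T S τ σ) (hT : 0 < T) (hΨ₀ : IsGauge Ψ₀)
    (hΨ : IsViscousPotential Ψ₀ Ψ) (hE : IsAdmissibleEnergy T E)
    (hb : IsBalancedCurve T S Ψ₀ Ψ E τ υ) (hu : ∀ t, extend T u t = υ (σ t)) {s₁ s₂ t : ℝ}
    (h0 : 0 ≤ s₁) (h12 : s₁ ≤ s₂) (h2S : s₂ ≤ S) (h1 : τ s₁ = t) (h2 : τ s₂ = t) :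
    finslerCost Ψ E t (υ s₁) (υ s₂) =
      ∫⁻ s in Ioc s₁ s₂, ENNReal.ofReal (contactPotential Ψ (deriv υ s) (force E (τ s) (υ s))) := by
  obtain ⟨L, hL⟩ := hb.lipschitz_state
  rcases h12.eq_or_lt with rfl | hlt
  · simp [finslerCost_self hΨ]
  refine le_antisymm ?_ ?_
  · refine (finslerCost_le hlt hL.lipschitzOnWith.absolutelyContinuousOnInterval).trans_eq ?_
    refine setLIntegral_congr_fun measurableSet_Ioc fun s hs => ?_
    have : τ s = t := le_antisymm (h2 ▸ hb.monotone hs.2) (h1 ▸ hb.monotone hs.1.le)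
    rw [this]
  -- At frozen time the work cancels, so the cost of υ is the energy drop, a lower bound for every
  -- competitor.
  · rw [(h.dissipation_Ioc hT hΨ₀ hΨ hE hb hu h0 h12 h2S).2]
    have ht : t ∈ Icc 0 T := h1 ▸ hb.mem s₁
    refine le_trans (le_of_eq ?_) (ofReal_energy_sub_le_finslerCost hΨ hE ht _ _)
    rw [dissipated, dissipated, h1, h2]
    congr 1
    ring

theorem lintegral_Ioc_add_Ioc (f : ℝ → ℝ≥0∞) {a b c : ℝ} (hab : a ≤ b) (hbc : b ≤ c) :
    (∫⁻ s in Ioc a b, f s) + ∫⁻ s in Ioc b c, f s = ∫⁻ s in Ioc a c, f s := by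
  rw [← Ioc_union_Ioc_eq_Ioc hab hbc, lintegral_union measurableSet_Ioc
    (Ioc_disjoint_Ioc_of_le le_rfl)]

/-- The curve cannot loop back inside a time slice. On a nontrivial slice τ' = 0, so nondegeneracy
makes Ψ₀(υ̇), hence 𝔭, positive a.e.; the energy drops strictly and the two ends of the slice
differ. -/
theorem IsSelection.jumpSet_eq (h : IsSelection T S τ σ) (hT : 0 < T) (hΨ₀ : IsGauge Ψ₀)
    (hΨ : IsViscousPotential Ψ₀ Ψ) (hE : IsAdmissibleEnergy T E)
    (hb : IsBalancedCurve T S Ψ₀ Ψ E τ υ) (hu : ∀ t, extend T u t = υ (σ t)) :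
    jumpSet T u = {t | t ∈ Icc 0 T ∧ Function.leftLim σ t < Function.rightLim σ t} := by
  obtain ⟨K, hK⟩ := hb.lipschitz_time
  obtain ⟨L, hL⟩ := hb.lipschitz_state
  have hmono := h.monotone hb.monotone
  ext t
  refine and_congr_right fun ht => ?_
  rw [h.leftValue_eq hb.monotone hL.continuous hu, h.rightValue_eq hb.monotone hL.continuous hu,
    ← extend_of_mem u ht, hu]
  have hl := hmono.leftLim_le (le_refl t)
  have hr := hmono.le_rightLim (le_refl t)
  constructor
  · intro hne
    refine lt_of_le_of_ne (hl.trans hr) fun heq => ?_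
    have e1 : Function.leftLim σ t = σ t := le_antisymm hl (heq ▸ hr)
    have e2 : σ t = Function.rightLim σ t := le_antisymm hr (heq ▸ hl)
    rw [e1, ← e2] at hne
    simp at hne
  · intro hlt
    by_contra hcon
    push Not at hcon
    set α := Function.leftLim σ t
    set β := Function.rightLim σ t
    have hα : τ α = t := (h.right_inv_leftLim hb.monotone hK.continuous t).trans
      (clamp_of_mem_Icc ht)
    have hβ : τ β = t := (h.right_inv_rightLim hb.monotone hK.continuous t).trans
      (clamp_of_mem_Icc ht)
    have hα0 := (h.leftLim_mem hb.monotone t).1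
    have hβS := (h.rightLim_mem hb.monotone t).2
    have hint := (h.dissipation_Ioc hT hΨ₀ hΨ hE hb hu hα0 hlt.le hβS).2
    have hzero : dissipated T E u τ υ β - dissipated T E u τ υ α = 0 := by
      rw [dissipated, dissipated, hα, hβ, hcon.1.trans hcon.2]
      ring
    rw [hzero, ENNReal.ofReal_zero] at hint
    have hcont : ∀ s ∈ Ioo α β, deriv τ s = 0 := fun s hs => by
      have : τ =ᶠ[𝓝 s] fun _ => t := by
        filter_upwards [isOpen_Ioo.mem_nhds hs] with r hr
        exact le_antisymm (hβ ▸ hb.monotone hr.2.le) (hα ▸ hb.monotone hr.1.le)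
      rw [this.deriv_eq, deriv_const]
    have hpos : ∀ᵐ s ∂volume.restrict (Ioc α β), 0 < deriv (dissipated T E u τ υ) s := by
      refine ae_Ioo_of_ae_Ioc ?_
      filter_upwards [hb.nondegenerate, h.deriv_dissipated hT hE hb hu] with s h1 h2 hs
      have hs' : s ∈ Ioo 0 S := Ioo_subset_Ioo hα0 hβS hs
      have h3 := h1 hs'
      rw [hcont s hs, zero_add] at h3
      rw [h2 hs']
      exact h3.trans_le (hΨ.gauge_le_contactPotential _ _)
    have hD : ∫⁻ s in Ioc α β, ENNReal.ofReal (deriv (dissipated T E u τ υ) s) = 0 := by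
      rw [← hint]
      refine lintegral_congr_ae ?_
      have := ae_Ioo_of_ae_Ioc (a := α) (b := β) ((h.deriv_dissipated hT hE hb hu).mono
        fun s hs hs12 => hs (Ioo_subset_Ioo hα0 hβS hs12))
      filter_upwards [this] with s hs
      rw [hs]
    rw [lintegral_eq_zero_iff (measurable_deriv _).ennreal_ofReal] at hD
    have hfalse : ∀ᵐ s ∂volume.restrict (Ioc α β), False := by
      filter_upwards [hD, hpos] with s h1 h2
      exact absurd h1 (by simpa using h2)
    rw [ae_iff] at hfalse
    simp only [not_false_eq_true] at hfalse
    have : volume (Ioc α β) = 0 := by simpa [-Real.volume_Ioc] using hfalse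
    rw [Real.volume_Ioc, ENNReal.ofReal_eq_zero] at this
    linarith

theorem IsSelection.countable_jumpSet (h : IsSelection T S τ σ) (hT : 0 < T) (hΨ₀ : IsGauge Ψ₀)
    (hΨ : IsViscousPotential Ψ₀ Ψ) (hE : IsAdmissibleEnergy T E)
    (hb : IsBalancedCurve T S Ψ₀ Ψ E τ υ) (hu : ∀ t, extend T u t = υ (σ t)) :
    (jumpSet T u).Countable := by
  rw [h.jumpSet_eq hT hΨ₀ hΨ hE hb hu]
  refine (h.monotone hb.monotone).countable_not_continuousAt.mono ?_
  rintro t ⟨-, hlt⟩ hc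
  rw [(h.monotone hb.monotone).continuousAt_iff_leftLim_eq_rightLim] at hc
  exact hlt.ne hc

/-- The map τ sends null sets to null sets because it is Lipschitz, and sends its critical points to
a null set by Sard. So for a.e. t the point σ(t) has τ' > 0 and avoids the exceptional parameters.
-/
theorem IsSelection.ae_stable (h : IsSelection T S τ σ)
    (hb : IsBalancedCurve T S Ψ₀ Ψ E τ υ) (hu : ∀ t, extend T u t = υ (σ t)) :
    ∀ᵐ t, t ∈ Ioo 0 T → force E t (u t) ∈ stableSet Ψ₀ := by
  obtain ⟨K, hK⟩ := hb.lipschitz_time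
  set N : Set ℝ := {s | ¬ (s ∈ Ioo 0 S → DifferentiableAt ℝ τ s ∧
    (0 < deriv τ s → force E (τ s) (υ s) ∈ stableSet Ψ₀))} with hN
  have hN0 : volume N = 0 := by
    rw [hN, ← ae_iff]
    filter_upwards [hb.stable,
      ae_differentiableAt_of_lipschitzOnWith (hK.lipschitzOnWith (s := Icc 0 S))] with s h1 h2 hs
    exact ⟨h2 hs, h1 hs⟩
  have h1 := volume_image_null_of_lipschitz hK hN0
  have h2 := volume_image_deriv_zero τ
  filter_upwards [measure_eq_zero_iff_ae_notMem.1 h1, measure_eq_zero_iff_ae_notMem.1 h2]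
    with t ht1 ht2 ht
  have hτσ : τ (σ t) = t := (h.right_inv t).trans (clamp_of_mem_Icc (Ioo_subset_Icc_self ht))
  have hσmem : σ t ∈ Ioo 0 S := by
    refine ⟨lt_of_le_of_ne (h.mem t).1 fun h0 => ?_, lt_of_le_of_ne (h.mem t).2 fun h0 => ?_⟩
    · rw [← h0, hb.zero] at hτσ
      exact ht.1.ne hτσ
    · rw [h0, hb.top] at hτσ
      exact ht.2.ne' hτσ
  have hnN : σ t ∉ N := fun hmem => ht1 ⟨σ t, hmem, hτσ⟩
  simp only [hN, mem_ofPred_eq, not_not] at hnN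
  obtain ⟨hd, hst⟩ := hnN hσmem
  have hpos : 0 < deriv τ (σ t) := by
    refine lt_of_le_of_ne hb.monotone.deriv_nonneg fun h0 => ht2 ⟨σ t, ?_, hτσ⟩
    have := hd.hasDerivAt
    rwa [← h0] at this
  have := hst hpos
  rwa [hτσ, ← hu, extend_of_mem u (Ioo_subset_Icc_self ht)] at this

end BalancedCurve

/-! ### The pseudo-variation of u as an integral over the parameter interval; part (i). -/

section Representation

variable {X : Type*} [NormedAddCommGroup X] [NormedSpace ℝ X] [FiniteDimensional ℝ X]
  {T S : ℝ} {Ψ₀ Ψ : X → ℝ} {E : ℝ → X → ℝ} {τ σ : ℝ → ℝ} {υ u : ℝ → X}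

theorem stronglyMeasurable_deriv_curve (υ : ℝ → X) : StronglyMeasurable (deriv υ) := by
  have : CompleteSpace X := FiniteDimensional.complete ℝ X
  have : ProperSpace X := FiniteDimensional.proper ℝ X
  borelize X
  exact (measurable_deriv υ).stronglyMeasurable

theorem integrableOn_deriv_of_lipschitzWith {K : NNReal} (hυ : LipschitzWith K υ) {A : Set ℝ}
    (hA : volume A ≠ ∞) : IntegrableOn (deriv υ) A := by
  refine Measure.integrableOn_of_bounded (M := K) hA
    (stronglyMeasurable_deriv_curve υ).aestronglyMeasurable (Eventually.of_forall fun s => ?_)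
  exact norm_deriv_le_of_lipschitz hυ

theorem setIntegral_deriv_of_lipschitzWith {K : NNReal} (hυ : LipschitzWith K υ) {a b : ℝ}
    (hab : a ≤ b) : ∫ s in Ioc a b, deriv υ s = υ b - υ a := by
  have : CompleteSpace X := FiniteDimensional.complete ℝ X
  refine (Module.finBasis ℝ X).ext_elem fun i => ?_
  set ξ := LinearMap.toContinuousLinearMap ((Module.finBasis ℝ X).coord i)
  change ξ _ = ξ _
  have hint := integrableOn_deriv_of_lipschitzWith hυ (A := Ioc a b) (by simp)
  rw [← ξ.integral_comp_comm hint, map_sub]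
  have hξ : LipschitzOnWith (‖ξ‖₊ * K) (fun s => ξ (υ s)) (Icc a b) :=
    (ξ.lipschitz.comp hυ).lipschitzOnWith
  rw [← integral_Ioc_deriv_of_lipschitzOnWith hab hξ]
  refine integral_congr_ae (ae_Ioo_of_ae_Ioc ?_)
  filter_upwards [ae_differentiableAt_of_lipschitzOnWith (hυ.lipschitzOnWith (s := Icc a b))]
    with s hs hsab
  exact (ξ.hasFDerivAt.comp_hasDerivAt s (hs hsab).hasDerivAt).deriv.symm

theorem IsSelection.zero_le (h : IsSelection T S τ σ) (hτ : Monotone τ) (t : ℝ) : σ 0 ≤ σ t := by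
  rw [← h.clamp t]
  exact h.monotone hτ (le_max_left _ _)

theorem IsSelection.le_top (h : IsSelection T S τ σ) (hτ : Monotone τ) (hT : 0 ≤ T) (t : ℝ) :
    σ t ≤ σ T := by
  rw [← h.clamp t]
  exact h.monotone hτ (clamp_mem_Icc hT t).2

theorem IsSelection.eq_zero_of_nonpos (h : IsSelection T S τ σ) {t : ℝ} (ht : t ≤ 0) :
    σ t = σ 0 := by
  rw [← h.clamp t, max_eq_left ((min_le_right _ _).trans ht)]

theorem IsSelection.eq_top_of_ge (h : IsSelection T S τ σ) (hT : 0 ≤ T) {t : ℝ} (ht : T ≤ t) :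
    σ t = σ T := by
  rw [← h.clamp t, min_eq_left ht, max_eq_right hT]

theorem IsSelection.rightLim_le_top (h : IsSelection T S τ σ) (hτ : Monotone τ) (hT : 0 ≤ T)
    (t : ℝ) : Function.rightLim σ t ≤ σ T :=
  le_of_tendsto ((h.monotone hτ).tendsto_rightLim t) (Eventually.of_forall (h.le_top hτ hT))

theorem IsSelection.zero_le_leftLim (h : IsSelection T S τ σ) (hτ : Monotone τ)
    (t : ℝ) : σ 0 ≤ Function.leftLim σ t :=
  ge_of_tendsto ((h.monotone hτ).tendsto_leftLim t) (Eventually.of_forall (h.zero_le hτ))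

theorem IsSelection.inter_preimage_Ioc (h : IsSelection T S τ σ) (hT : 0 < T)
    (hb : IsBalancedCurve T S Ψ₀ Ψ E τ υ) (a b : ℝ) :
    Ioc (σ 0) (σ T) ∩ τ ⁻¹' Ioc a b = Ioc (Function.rightLim σ a) (Function.rightLim σ b) := by
  obtain ⟨K, hK⟩ := hb.lipschitz_time
  have hmono := h.monotone hb.monotone
  have key : ∀ s ∈ Ioc (σ 0) (σ T), ∀ t, s ≤ Function.rightLim σ t ↔ τ s ≤ t := by
    intro s hs t
    rcases lt_or_ge t 0 with h0 | h0
    · have h1 : Function.rightLim σ t = σ 0 := by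
        refine le_antisymm ?_ ((h.zero_le hb.monotone t).trans (hmono.le_rightLim le_rfl))
        exact hmono.rightLim_le h0
      rw [h1]
      exact iff_of_false (not_le.2 hs.1) (not_le.2 (h0.trans_le (hb.mem s).1))
    · rcases le_or_gt t T with h1 | h1
      · exact h.le_rightLim_iff hb.monotone hK.continuous ⟨h0, h1⟩ hs.2
      · refine iff_of_true (hs.2.trans ?_) ((hb.mem s).2.trans h1.le)
        exact hmono.le_rightLim h1.le
  ext s
  constructor
  · rintro ⟨hs, h1, h2⟩
    exact ⟨not_le.1 fun hle => not_le.2 h1 ((key s hs a).1 hle), (key s hs b).2 h2⟩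
  · rintro ⟨h1, h2⟩
    have hs : s ∈ Ioc (σ 0) (σ T) :=
      ⟨((h.zero_le hb.monotone a).trans (hmono.le_rightLim le_rfl)).trans_lt h1,
        h2.trans (h.rightLim_le_top hb.monotone hT.le b)⟩
    exact ⟨hs, not_le.1 fun hle => not_le.2 h1 ((key s hs a).2 hle), (key s hs b).1 h2⟩

/-- The derivative of `u = υ ∘ σ` is the image under `τ` of the derivative of `υ`. -/
theorem IsSelection.vectorMeasure_apply [CompleteSpace X] (h : IsSelection T S τ σ) (hT : 0 < T)
    (hb : IsBalancedCurve T S Ψ₀ Ψ E τ υ) (hu : ∀ t, extend T u t = υ (σ t))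
    (hBV : BoundedVariationOn (extend T u) univ) {A : Set ℝ} (hA : MeasurableSet A) :
    hBV.vectorMeasure A = ∫ s in Ioc (σ 0) (σ T) ∩ τ ⁻¹' A, deriv υ s := by
  obtain ⟨K, hK⟩ := hb.lipschitz_time
  obtain ⟨L, hL⟩ := hb.lipschitz_state
  have hτm : Measurable τ := hK.continuous.measurable
  have hint : Integrable (deriv υ) (volume.restrict (Ioc (σ 0) (σ T))) :=
    integrableOn_deriv_of_lipschitzWith hL (by simp)
  have happ : ∀ B : Set ℝ, MeasurableSet B →
      (((volume.restrict (Ioc (σ 0) (σ T))).withDensityᵥ (deriv υ)).map τ) B =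
        ∫ s in Ioc (σ 0) (σ T) ∩ τ ⁻¹' B, deriv υ s := by
    intro B hB
    rw [VectorMeasure.map_apply _ hτm hB, withDensityᵥ_apply hint (hτm hB),
      Measure.restrict_restrict (hτm hB), inter_comm]
  rw [← happ A hA]
  congr 1
  -- Half-open intervals are a generating π-system, and on them both measures equal υ(σ(b₊)) -
  -- υ(σ(a₊)). The total mass is compared separately through the limits at ±∞.
  refine VectorMeasure.ext_of_generateFrom {s | ∃ a b, a ≤ b ∧ Ioc a b = s} ?_ ?_ ?_ ?_
  · rintro _ ⟨a, b, hab, rfl⟩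
    rw [hBV.vectorMeasure_Ioc hab, happ _ measurableSet_Ioc, h.inter_preimage_Ioc hT hb,
      setIntegral_deriv_of_lipschitzWith hL ((h.monotone hb.monotone).rightLim hab)]
    exact congrArg₂ _ (h.rightValue_eq hb.monotone hL.continuous hu b)
      (h.rightValue_eq hb.monotone hL.continuous hu a)
  · exact (BorelSpace.measurable_eq (α := ℝ)).trans (borel_eq_generateFrom_Ioc_le ℝ)
  · rintro _ ⟨a, b, -, rfl⟩ _ ⟨c, d, -, rfl⟩ hne
    rw [Ioc_inter_Ioc] at hne ⊢
    exact ⟨_, _, (nonempty_Ioc.1 hne).le, rfl⟩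
  · rw [hBV.vectorMeasure_univ, happ _ MeasurableSet.univ, preimage_univ, inter_univ,
      setIntegral_deriv_of_lipschitzWith hL (h.le_top hb.monotone hT.le 0)]
    have h1 : Tendsto (extend T u) atTop (𝓝 (υ (σ T))) := by
      refine tendsto_const_nhds.congr' ?_
      filter_upwards [eventually_ge_atTop T] with t ht
      rw [hu, h.eq_top_of_ge hT.le ht]
    have h2 : Tendsto (extend T u) atBot (𝓝 (υ (σ 0))) := by
      refine tendsto_const_nhds.congr' ?_
      filter_upwards [eventually_le_atBot 0] with t ht
      rw [hu, h.eq_zero_of_nonpos ht]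
    rw [h1.limUnder_eq, h2.limUnder_eq]

theorem IsSelection.eq_of_notMem_jumpSet (h : IsSelection T S τ σ) (hT : 0 < T)
    (hΨ₀ : IsGauge Ψ₀) (hΨ : IsViscousPotential Ψ₀ Ψ) (hE : IsAdmissibleEnergy T E)
    (hb : IsBalancedCurve T S Ψ₀ Ψ E τ υ) (hu : ∀ t, extend T u t = υ (σ t)) {s : ℝ}
    (hs : s ∈ Icc (σ 0) (σ T)) (hJ : τ s ∉ jumpSet T u) :
    σ (τ s) = s ∧ Function.leftLim σ (τ s) = Function.rightLim σ (τ s) := by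
  obtain ⟨K, hK⟩ := hb.lipschitz_time
  have hmono := h.monotone hb.monotone
  rw [h.jumpSet_eq hT hΨ₀ hΨ hE hb hu] at hJ
  have hlr := hmono.leftLim_le_rightLim (le_refl (τ s))
  have heq : Function.leftLim σ (τ s) = Function.rightLim σ (τ s) :=
    hlr.antisymm (not_lt.1 fun hlt => hJ ⟨hb.mem s, hlt⟩)
  have h1 := (h.leftLim_le_iff hb.monotone hK.continuous (hb.mem s) hs.1).2 le_rfl
  have h2 := (h.le_rightLim_iff hb.monotone hK.continuous (hb.mem s) hs.2).2 le_rfl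
  have h3 := hmono.leftLim_le (le_refl (τ s))
  have h4 := hmono.le_rightLim (le_refl (τ s))
  exact ⟨le_antisymm (by linarith) (by linarith), heq⟩

/-- On the parameters D lying over non-jump times σ ∘ τ is the identity. Hence the diffuse
derivative has density υ̇ ∘ σ with respect to the image under τ of Lebesgue measure on D, and this
image may replace the variation by homogeneity. -/
theorem IsSelection.diffuseVar_eq (h : IsSelection T S τ σ) (hT : 0 < T)
    (hΨ₀ : IsGauge Ψ₀) (hΨ : IsViscousPotential Ψ₀ Ψ) (hE : IsAdmissibleEnergy T E)
    (hb : IsBalancedCurve T S Ψ₀ Ψ E τ υ) (hu : ∀ t, extend T u t = υ (σ t))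
    (hBV : BoundedVariationOn u (Icc 0 T)) (t : ℝ) :
    diffuseVar Ψ₀ hT.le hBV 0 t =
      ∫⁻ s in Ioc (σ 0) (σ T) ∩ τ ⁻¹' (Ioo 0 t \ jumpSet T u),
        ENNReal.ofReal (contactPotential Ψ (deriv υ s) (force E (τ s) (υ s))) := by
  have : CompleteSpace X := FiniteDimensional.complete ℝ X
  obtain ⟨K, hK⟩ := hb.lipschitz_time
  obtain ⟨L, hL⟩ := hb.lipschitz_state
  have hτm : Measurable τ := hK.continuous.measurable
  have hσm : Measurable σ := (h.monotone hb.monotone).measurable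
  have hJm : MeasurableSet (jumpSet T u) :=
    (h.countable_jumpSet hT hΨ₀ hΨ hE hb hu).measurableSet
  set J := jumpSet T u with hJ
  set D := Ioc (σ 0) (σ T) ∩ τ ⁻¹' Jᶜ with hD
  have hDm : MeasurableSet D := measurableSet_Ioc.inter (hτm hJm.compl)
  have hDfin : volume D ≠ ∞ :=
    ne_top_of_le_ne_top (by simp) (measure_mono (inter_subset_left : D ⊆ Ioc (σ 0) (σ T)))
  have hDσ : ∀ s ∈ D, σ (τ s) = s ∧ Function.leftLim σ (τ s) = Function.rightLim σ (τ s) :=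
    fun s hs => h.eq_of_notMem_jumpSet hT hΨ₀ hΨ hE hb hu ⟨hs.1.1.le, hs.1.2⟩ hs.2
  set m := Measure.map τ (volume.restrict D) with hm
  have : IsFiniteMeasure (volume.restrict D) := ⟨by simpa using hDfin.lt_top⟩
  have : IsFiniteMeasure m := Measure.isFiniteMeasure_map _ _
  set g : ℝ → X := fun r => deriv υ (σ r) with hg
  have hgm : StronglyMeasurable g := (stronglyMeasurable_deriv_curve υ).comp_measurable hσm
  have hgint : Integrable g m :=
    Integrable.of_bound hgm.aestronglyMeasurable L
      (Eventually.of_forall fun r => norm_deriv_le_of_lipschitz hL)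
  have hν : diffuseDerivative hT.le hBV = m.withDensityᵥ g := by
    ext A hA
    rw [withDensityᵥ_apply hgint hA, hm, setIntegral_map hA hgm.aestronglyMeasurable hτm.aemeasurable,
      Measure.restrict_restrict (hτm hA), diffuseDerivative,
      VectorMeasure.restrict_apply _ hJm.compl hA,
      h.vectorMeasure_apply hT hb hu _ (hA.inter hJm.compl)]
    have hset : Ioc (σ 0) (σ T) ∩ τ ⁻¹' (A ∩ Jᶜ) = τ ⁻¹' A ∩ D := by
      rw [hD, preimage_inter]
      ext s
      simp only [mem_inter_iff]
      tauto
    rw [hset]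
    refine setIntegral_congr_fun ((hτm hA).inter hDm) fun s hs => ?_
    simp only [hg]
    rw [(hDσ s hs.2).1]
  have hst := h.ae_stable hb hu
  have hNm : Measurable fun r => ENNReal.ofReal (Ψ₀ (g r)) :=
    (hΨ₀.continuous.comp_stronglyMeasurable hgm).measurable.ennreal_ofReal
  rw [diffuseVar, setLIntegral_vectorDensity_eq hΨ₀ hgint hν measurableSet_Ioo, hm,
    setLIntegral_map measurableSet_Ioo hNm hτm, Measure.restrict_restrict (hτm measurableSet_Ioo)]
  have hset : τ ⁻¹' Ioo 0 t ∩ D = Ioc (σ 0) (σ T) ∩ τ ⁻¹' (Ioo 0 t \ J) := by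
    rw [hD, sdiff_eq, preimage_inter]
    ext s
    simp only [mem_inter_iff]
    tauto
  rw [← hset]
  refine setLIntegral_congr_fun ((hτm measurableSet_Ioo).inter hDm) fun s hs => ?_
  obtain ⟨h1, h2⟩ := hDσ s hs.2
  have hτs : τ s ∈ Icc 0 T := hb.mem s
  have huτ : u (τ s) = υ s := by rw [← extend_of_mem u hτs, hu, h1]
  -- The stability holds at this very point, which reduces 𝔭 to Ψ₀.
  have hstab := force_mem_stableSet_of_ae hT hE hst hτs
    (h.continuousAt_extend hb.monotone hL.continuous hu h2)
  rw [huτ] at hstab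
  simp only [hg]
  rw [h1, hΨ.contactPotential_eq_of_stable hstab]

/-- The preimage of the jump times is a countable disjoint union of slices [σ(r₋), σ(r₊)]. On each,
the two Finsler costs are the integrals of 𝔭 before and after σ(r). -/
theorem IsSelection.jumpSum_eq (h : IsSelection T S τ σ) (hT : 0 < T)
    (hΨ₀ : IsGauge Ψ₀) (hΨ : IsViscousPotential Ψ₀ Ψ) (hE : IsAdmissibleEnergy T E)
    (hb : IsBalancedCurve T S Ψ₀ Ψ E τ υ) (hu : ∀ t, extend T u t = υ (σ t)) {t : ℝ} (ht : t ≤ T) :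
    ∑' r : ↥(jumpSet T u ∩ Ioo 0 t),
        (finslerCost Ψ E r (leftValue T u r) (u r) + finslerCost Ψ E r (u r) (rightValue T u r)) =
      ∫⁻ s in Ioc (σ 0) (σ T) ∩ τ ⁻¹' (jumpSet T u ∩ Ioo 0 t),
        ENNReal.ofReal (contactPotential Ψ (deriv υ s) (force E (τ s) (υ s))) := by
  obtain ⟨K, hK⟩ := hb.lipschitz_time
  obtain ⟨L, hL⟩ := hb.lipschitz_state
  have hmono := h.monotone hb.monotone
  have hcount := (h.countable_jumpSet hT hΨ₀ hΨ hE hb hu).mono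
    (inter_subset_left : jumpSet T u ∩ Ioo 0 t ⊆ jumpSet T u)
  have := hcount.to_subtype
  have hset : Ioc (σ 0) (σ T) ∩ τ ⁻¹' (jumpSet T u ∩ Ioo 0 t) =
      ⋃ r : ↥(jumpSet T u ∩ Ioo 0 t), Icc (Function.leftLim σ r) (Function.rightLim σ r) := by
    ext s
    simp only [mem_inter_iff, mem_preimage, mem_iUnion]
    constructor
    · rintro ⟨hs, hsJ⟩
      exact ⟨⟨τ s, hsJ⟩, (h.leftLim_le_iff hb.monotone hK.continuous (hb.mem s) hs.1.le).2 le_rfl,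
        (h.le_rightLim_iff hb.monotone hK.continuous (hb.mem s) hs.2).2 le_rfl⟩
    · rintro ⟨⟨r, hrJ, hr⟩, hsl, hsr⟩
      have hr' : r ∈ Icc 0 T := ⟨hr.1.le, hr.2.le.trans ht⟩
      have hs0 : σ 0 ≤ s := (h.zero_le_leftLim hb.monotone r).trans hsl
      have hsT : s ≤ σ T := hsr.trans (h.rightLim_le_top hb.monotone hT.le r)
      have hτs : τ s = r :=
        le_antisymm ((h.le_rightLim_iff hb.monotone hK.continuous hr' hsT).1 hsr)
          ((h.leftLim_le_iff hb.monotone hK.continuous hr' hs0).1 hsl)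
      refine ⟨⟨lt_of_le_of_ne hs0 fun heq => ?_, hsT⟩, hτs ▸ hrJ, hτs ▸ hr⟩
      have : τ s = 0 := by
        rw [← heq, h.right_inv, clamp_of_mem_Icc (left_mem_Icc.2 hT.le)]
      exact hr.1.ne (this.symm.trans hτs)
  rw [hset, lintegral_iUnion (fun r => measurableSet_Icc)]
  · refine tsum_congr fun r => ?_
    have hr' : (r : ℝ) ∈ Icc 0 T := ⟨r.2.2.1.le, r.2.2.2.le.trans ht⟩
    have hl := (h.right_inv_leftLim hb.monotone hK.continuous r).trans (clamp_of_mem_Icc hr')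
    have hm := (h.right_inv r).trans (clamp_of_mem_Icc hr')
    have hr := (h.right_inv_rightLim hb.monotone hK.continuous r).trans (clamp_of_mem_Icc hr')
    rw [h.leftValue_eq hb.monotone hL.continuous hu, h.rightValue_eq hb.monotone hL.continuous hu,
      ← extend_of_mem u hr', hu,
      h.finslerCost_eq hT hΨ₀ hΨ hE hb hu (h.leftLim_mem hb.monotone r).1
        (hmono.leftLim_le le_rfl) (h.mem r).2 hl hm,
      h.finslerCost_eq hT hΨ₀ hΨ hE hb hu (h.mem r).1
        (hmono.le_rightLim le_rfl) (h.rightLim_mem hb.monotone r).2 hm hr,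
      lintegral_Ioc_add_Ioc _ (hmono.leftLim_le le_rfl) (hmono.le_rightLim le_rfl),
      restrict_Ioc_eq_restrict_Icc]
  · intro r r' hne
    rw [Function.onFun, disjoint_left]
    intro s hs hs'
    have hval : ∀ q : ↥(jumpSet T u ∩ Ioo 0 t),
        s ∈ Icc (Function.leftLim σ q) (Function.rightLim σ q) → τ s = q := by
      intro q hq
      have hq' : (q : ℝ) ∈ Icc 0 T := ⟨q.2.2.1.le, q.2.2.2.le.trans ht⟩
      exact le_antisymm ((h.le_rightLim_iff hb.monotone hK.continuous hq'
          (hq.2.trans (h.rightLim_le_top hb.monotone hT.le q))).1 hq.2)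
        ((h.leftLim_le_iff hb.monotone hK.continuous hq'
          ((h.zero_le_leftLim hb.monotone q).trans hq.1)).1 hq.1)
    exact hne (Subtype.ext ((hval r hs).symm.trans (hval r' hs')))

/-- The interval from σ(0) to σ(t) is cut at σ(0₊) and σ(t₋). The outer pieces are the boundary
costs; the inner one is split by τ into jump slices and the diffuse part. -/
theorem IsSelection.pseudoVar_eq (h : IsSelection T S τ σ) (hT : 0 < T)
    (hΨ₀ : IsGauge Ψ₀) (hΨ : IsViscousPotential Ψ₀ Ψ) (hE : IsAdmissibleEnergy T E)
    (hb : IsBalancedCurve T S Ψ₀ Ψ E τ υ) (hu : ∀ t, extend T u t = υ (σ t))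
    (hBV : BoundedVariationOn u (Icc 0 T)) {t : ℝ} (ht : t ∈ Icc 0 T) :
    pseudoVar Ψ₀ Ψ E hT.le hBV 0 t =
      ENNReal.ofReal (dissipated T E u τ υ (σ t) - dissipated T E u τ υ (σ 0)) := by
  obtain ⟨K, hK⟩ := hb.lipschitz_time
  obtain ⟨L, hL⟩ := hb.lipschitz_state
  have hτm : Measurable τ := hK.continuous.measurable
  have hmono := h.monotone hb.monotone
  have h0 : (0 : ℝ) ∈ Icc 0 T := left_mem_Icc.2 hT.le
  rcases ht.1.eq_or_lt with rfl | hpos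
  · simp [pseudoVar]
  have hJm : MeasurableSet (jumpSet T u) :=
    (h.countable_jumpSet hT hΨ₀ hΨ hE hb hu).measurableSet
  set R : ℝ → ℝ≥0∞ := fun s =>
    ENNReal.ofReal (contactPotential Ψ (deriv υ s) (force E (τ s) (υ s))) with hR
  have hm0 : τ (σ 0) = 0 := (h.right_inv 0).trans (clamp_of_mem_Icc h0)
  have hr0 := (h.right_inv_rightLim hb.monotone hK.continuous 0).trans (clamp_of_mem_Icc h0)
  have hmt := (h.right_inv t).trans (clamp_of_mem_Icc ht)
  have hlt := (h.right_inv_leftLim hb.monotone hK.continuous t).trans (clamp_of_mem_Icc ht)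
  have hi0 : finslerCost Ψ E 0 (u 0) (rightValue T u 0) =
      ∫⁻ s in Ioc (σ 0) (Function.rightLim σ 0), R s := by
    rw [h.rightValue_eq hb.monotone hL.continuous hu, ← extend_of_mem u h0, hu]
    exact h.finslerCost_eq hT hΨ₀ hΨ hE hb hu (h.mem 0).1
      (hmono.le_rightLim le_rfl) (h.rightLim_mem hb.monotone 0).2 hm0 hr0
  have hit : finslerCost Ψ E t (leftValue T u t) (u t) =
      ∫⁻ s in Ioc (Function.leftLim σ t) (σ t), R s := by
    rw [h.leftValue_eq hb.monotone hL.continuous hu, ← extend_of_mem u ht, hu]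
    exact h.finslerCost_eq hT hΨ₀ hΨ hE hb hu (h.leftLim_mem hb.monotone t).1
      (hmono.leftLim_le le_rfl) (h.mem t).2 hlt hmt
  have hmid : (∫⁻ s in Ioc (σ 0) (σ T) ∩ τ ⁻¹' (Ioo 0 t \ jumpSet T u), R s) +
      ∫⁻ s in Ioc (σ 0) (σ T) ∩ τ ⁻¹' (jumpSet T u ∩ Ioo 0 t), R s =
      ∫⁻ s in Ioc (Function.rightLim σ 0) (Function.leftLim σ t), R s := by
    rw [← lintegral_union (measurableSet_Ioc.inter (hτm (hJm.inter measurableSet_Ioo))),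
      ← inter_union_distrib_left, ← preimage_union, inter_comm (jumpSet T u), sdiff_union_inter,
      ← restrict_Ioo_eq_restrict_Ioc]
    · congr 2
      ext s
      simp only [mem_inter_iff, mem_preimage, mem_Ioo, mem_Ioc]
      constructor
      · rintro ⟨hs, hs1, hs2⟩
        refine ⟨not_le.1 fun hle => ?_, not_le.1 fun hle => ?_⟩
        · exact not_le.2 hs1 ((h.le_rightLim_iff hb.monotone hK.continuous h0 hs.2).1 hle)
        · exact not_le.2 hs2 ((h.leftLim_le_iff hb.monotone hK.continuous ht hs.1.le).1 hle)
      · rintro ⟨hs1, hs2⟩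
        have hs0 : σ 0 < s := (hmono.le_rightLim (le_refl 0)).trans_lt hs1
        have hsT : s ≤ σ T := hs2.le.trans
          ((hmono.leftLim_le (le_refl t)).trans (h.le_top hb.monotone hT.le t))
        refine ⟨⟨hs0, hsT⟩, not_le.1 fun hle => ?_, not_le.1 fun hle => ?_⟩
        · exact not_le.2 hs1 ((h.le_rightLim_iff hb.monotone hK.continuous h0 hsT).2 hle)
        · exact not_le.2 hs2 ((h.leftLim_le_iff hb.monotone hK.continuous ht hs0.le).2 hle)
    · rw [disjoint_left]
      rintro s ⟨-, hs1⟩ ⟨-, hs2⟩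
      exact hs1.2 hs2.1
  have hα : Function.rightLim σ 0 ≤ Function.leftLim σ t := hmono.rightLim_le_leftLim hpos
  have hβ : Function.leftLim σ t ≤ σ t := hmono.leftLim_le le_rfl
  have hγ : σ 0 ≤ Function.rightLim σ 0 := hmono.le_rightLim le_rfl
  rw [← (h.dissipation_Ioc hT hΨ₀ hΨ hE hb hu (h.mem 0).1 (hmono hpos.le) (h.mem t).2).2,
    pseudoVar, if_pos hpos, jumpVar, h.diffuseVar_eq hT hΨ₀ hΨ hE hb hu hBV t,
    h.jumpSum_eq hT hΨ₀ hΨ hE hb hu ht.2, hi0, hit]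
  rw [← lintegral_Ioc_add_Ioc R (hγ.trans hα) hβ, ← lintegral_Ioc_add_Ioc R hγ hα, ← hmid]
  ring

theorem IsSelection.isBVSolution (h : IsSelection T S τ σ) (hT : 0 < T)
    (hΨ₀ : IsGauge Ψ₀) (hΨ : IsViscousPotential Ψ₀ Ψ) (hE : IsAdmissibleEnergy T E)
    (hb : IsBalancedCurve T S Ψ₀ Ψ E τ υ) (hu : ∀ t, extend T u t = υ (σ t)) :
    IsBVSolution hT.le Ψ₀ Ψ E u := by
  obtain ⟨L, hL⟩ := hb.lipschitz_state
  have hBV := h.boundedVariationOn hb.monotone hL hT.le hu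
  have h0 : (0 : ℝ) ∈ Icc 0 T := left_mem_Icc.2 hT.le
  refine ⟨hBV, ?_, fun t ht => ?_⟩
  · have hne : ∀ a : ℝ, ∀ᵐ t : ℝ, t ≠ a := fun a => by simp [ae_iff]
    filter_upwards [h.ae_stable hb hu, hne 0, hne T] with t h1 h2 h3 ht
    exact h1 ⟨lt_of_le_of_ne ht.1.1 h2.symm, lt_of_le_of_ne ht.1.2 h3⟩
  · have hle := (h.dissipation_Ioc hT hΨ₀ hΨ hE hb hu (h.mem 0).1
      (h.monotone hb.monotone ht.1) (h.mem t).2).1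
    rw [h.pseudoVar_eq hT hΨ₀ hΨ hE hb hu hBV ht, EReal.coe_ennreal_ofReal,
      max_eq_left (sub_nonneg.2 hle), ← EReal.coe_add, EReal.coe_eq_coe_iff, ← work_eq ht,
      dissipated, dissipated, h.right_inv, h.right_inv, clamp_of_mem_Icc ht, clamp_of_mem_Icc h0,
      ← hu, ← hu, extend_of_mem u ht, extend_of_mem u h0, work_zero]
    ring

/-- Every curve selected from a nondegenerate surjective parametrized solution is a BV solution. -/
theorem isBVSolution_of_isParametrizedSolution (hT : 0 < T) (hΨ₀ : IsGauge Ψ₀)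
    (hΨ : IsViscousPotential Ψ₀ Ψ) (hE : IsAdmissibleEnergy T E) {tt : ℝ → ℝ} {uu : ℝ → X}
    (hS : 0 < S) (hp : IsParametrizedSolution T Ψ₀ Ψ E 0 S tt uu)
    (hnd : IsNondegenerate Ψ₀ 0 S tt uu) (hsurj : IsSurjective T 0 S tt)
    (hu : ∀ t ∈ Icc 0 T, u t ∈ uu '' timeSection S tt t) : IsBVSolution hT.le Ψ₀ Ψ E u := by
  have hb := hp.isBalancedCurve hT hΨ₀ hΨ hE hS hnd hsurj
  -- Any choice of parameters realizing (∗) will do: monotonicity of σ, and with it measurability,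
  -- is automatic.
  choose! σ₀ hσ₀ using hu
  have hcl := clamp_mem_Icc hT.le
  refine IsSelection.isBVSolution (σ := fun t => σ₀ (max 0 (min T t)))
    ⟨fun t => (hσ₀ _ (hcl t)).1.1, fun t => ?_, fun t => ?_⟩ hT hΨ₀ hΨ hE hb fun t => ?_
  · rw [extend_of_mem tt (hσ₀ _ (hcl t)).1.1]
    exact (hσ₀ _ (hcl t)).1.2
  · rw [clamp_of_mem_Icc (hcl t)]
  · rw [extend_of_mem uu (hσ₀ _ (hcl t)).1.1]
    exact (hσ₀ _ (hcl t)).2.symm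

end Representation

/-! ### Existence of optimal transitions at frozen time. -/

section Transition

variable {X : Type*} [NormedAddCommGroup X] [NormedSpace ℝ X] [FiniteDimensional ℝ X]
  {T : ℝ} {Ψ₀ Ψ : X → ℝ} {E : ℝ → X → ℝ}

/-- The accumulated cost, in a form which is additive and continuous on `[r₀, r₁]`. -/
theorem exists_continuousOn_primitive_lintegral {G : ℝ → ℝ≥0∞} {r₀ r₁ : ℝ}
    (hfin : ∫⁻ r in Ioc r₀ r₁, G r ≠ ∞) (a : ℝ) :
    ∃ ℓ : ℝ → ℝ, ℓ r₀ = a ∧ ℓ r₁ = a + (∫⁻ r in Ioc r₀ r₁, G r).toReal ∧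
      ContinuousOn ℓ (Icc r₀ r₁) ∧
      ∀ r r', r₀ ≤ r → r ≤ r' → r' ≤ r₁ →
        ℓ r ≤ ℓ r' ∧ ∫⁻ s in Ioc r r', G s = ENNReal.ofReal (ℓ r' - ℓ r) := by
  have hf : ∀ r r', r₀ ≤ r → r' ≤ r₁ → ∫⁻ s in Ioc r r', G s ≠ ∞ := fun r r' h h' =>
    ne_top_of_le_ne_top hfin (lintegral_mono_set (Ioc_subset_Ioc h h'))
  have hsub : ∀ r r', r₀ ≤ r → r ≤ r' → r' ≤ r₁ → (∫⁻ s in Ioc r₀ r', G s).toReal =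
      (∫⁻ s in Ioc r₀ r, G s).toReal + (∫⁻ s in Ioc r r', G s).toReal := fun r r' h h' h'' => by
    rw [← lintegral_Ioc_add_Ioc G h h', ENNReal.toReal_add
      (hf _ _ le_rfl (h'.trans h'')) (hf _ _ h h'')]
  refine ⟨fun r => a + (∫⁻ s in Ioc r₀ r, G s).toReal, by simp, rfl, ?_, fun r r' h h' h'' => ?_⟩
  · rw [Metric.continuousOn_iff]
    intro y hy ε hε
    obtain ⟨δ, hδ, hG⟩ := exists_pos_setLIntegral_lt_of_measure_lt hfin
      (ENNReal.ofReal_pos.2 hε).ne'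
    have key : ∀ r r', r₀ ≤ r → r ≤ r' → r' ≤ r₁ → ENNReal.ofReal (r' - r) < δ →
        (∫⁻ s in Ioc r r', G s).toReal < ε := fun r r' h h' h'' hlt => by
      have := hG (Ioc r r') ((Measure.restrict_apply_le _ _).trans_lt (by simpa using hlt))
      rw [Measure.restrict_restrict measurableSet_Ioc,
        inter_eq_left.2 (Ioc_subset_Ioc h h'')] at this
      exact (ENNReal.lt_ofReal_iff_toReal_lt this.ne_top).1 this
    obtain ⟨η, hη, hηδ⟩ : ∃ η : ℝ, 0 < η ∧ ENNReal.ofReal η < δ := by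
      obtain ⟨η, hη, hηδ⟩ := ENNReal.lt_iff_exists_nnreal_btwn.1 hδ
      exact ⟨η, by exact_mod_cast hη, by simpa using hηδ⟩
    refine ⟨η, hη, fun x hx hxy => ?_⟩
    rw [Real.dist_eq] at hxy ⊢
    rcases le_total x y with h | h
    · rw [abs_sub_comm] at hxy ⊢
      rw [abs_of_nonneg (sub_nonneg.2 h)] at hxy
      have h1 := key x y hx.1 h hy.2 ((ENNReal.ofReal_le_ofReal hxy.le).trans_lt hηδ)
      rw [hsub x y hx.1 h hy.2, add_sub_add_left_eq_sub, add_sub_cancel_left,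
        abs_of_nonneg ENNReal.toReal_nonneg]
      exact h1
    · rw [abs_of_nonneg (sub_nonneg.2 h)] at hxy
      have h1 := key y x hy.1 h hx.2 ((ENNReal.ofReal_le_ofReal hxy.le).trans_lt hηδ)
      rw [hsub y x hy.1 h hx.2, add_sub_add_left_eq_sub, add_sub_cancel_left,
        abs_of_nonneg ENNReal.toReal_nonneg]
      exact h1
  · have h1 := hsub r r' h h' h''
    refine ⟨by linarith [(ENNReal.toReal_nonneg : 0 ≤ (∫⁻ s in Ioc r r', G s).toReal)], ?_⟩
    beta_reduce
    rw [h1, add_sub_add_left_eq_sub, add_sub_cancel_left, ENNReal.ofReal_toReal (hf _ _ h h'')]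

/-- A curve of finite cost, reparametrized by the accumulated cost. -/
theorem exists_cost_reparametrization (hΨ₀ : IsGauge Ψ₀) (hΨ : IsViscousPotential Ψ₀ Ψ)
    (hE : IsAdmissibleEnergy T E) {t r₀ r₁ : ℝ} (ht : t ∈ Icc 0 T) {ϑ : ℝ → X} (hr : r₀ ≤ r₁)
    (hϑ : AbsolutelyContinuousOnInterval ϑ r₀ r₁)
    (hfin : ∫⁻ r in Ioc r₀ r₁,
      ENNReal.ofReal (contactPotential Ψ (deriv ϑ r) (force E t (ϑ r))) ≠ ∞)
    {a b : ℝ} (hb : b = a + (∫⁻ r in Ioc r₀ r₁,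
      ENNReal.ofReal (contactPotential Ψ (deriv ϑ r) (force E t (ϑ r)))).toReal) :
    ∃ θ : ℝ → X, θ a = ϑ r₀ ∧ θ b = ϑ r₁ ∧
      (∀ q q' c, a ≤ q → q ≤ q' → q' ≤ b → 0 ≤ c →
        (∀ p ∈ Icc q q', c ≤ conjugate Ψ (force E t (θ p))) →
        contactAt Ψ c (θ q' - θ q) ≤ q' - q) ∧
      ∀ q q', a ≤ q → q ≤ q' → q' ≤ b → E t (θ q) - E t (θ q') ≤ q' - q := by
  obtain ⟨ℓ, hℓ0, hℓ1, hℓc, hℓ⟩ := exists_continuousOn_primitive_lintegral hfin a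
  rw [← hb] at hℓ1
  have hAC : ∀ {r r'}, r₀ ≤ r → r ≤ r' → r' ≤ r₁ → AbsolutelyContinuousOnInterval ϑ r r' :=
    fun h h' h'' => hϑ.mono (by rw [uIcc_of_le h', uIcc_of_le hr]; exact Icc_subset_Icc h h'')
  have hsurj : ∀ q ∈ Icc a b, ∃ r ∈ Icc r₀ r₁, ℓ r = q := by
    have := intermediate_value_Icc hr hℓc
    rwa [hℓ0, hℓ1] at this
  choose! ρ hρ hρℓ using hsurj
  -- The accumulated cost ℓ need not be injective, but it dominates Ψ₀-increments, so ϑ is constant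
  -- on its level sets and ϑ ∘ ρ does not depend on the choice of ρ.
  have hgauge : ∀ r r', r₀ ≤ r → r ≤ r' → r' ≤ r₁ → ℓ r = ℓ r' → ϑ r' = ϑ r :=
    fun r r' h h' h'' heq => by
      have h1 := ofReal_gauge_sub_le_cost (E := E) (t := t) hΨ₀ hΨ h' (hAC h h' h'')
      rw [(hℓ r r' h h' h'').2, heq, sub_self, ENNReal.ofReal_zero, nonpos_iff_eq_zero,
        ENNReal.ofReal_eq_zero] at h1
      exact hΨ₀.eq_of_sub_le_zero h1
  have hmem : ∀ r ∈ Icc r₀ r₁, ℓ r ∈ Icc a b := fun r hr' =>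
    ⟨hℓ0 ▸ (hℓ r₀ r le_rfl hr'.1 hr'.2).1, hℓ1 ▸ (hℓ r r₁ hr'.1 hr'.2 le_rfl).1⟩
  have hθ : ∀ r ∈ Icc r₀ r₁, ϑ (ρ (ℓ r)) = ϑ r := fun r hr' => by
    have h1 := hρ _ (hmem r hr')
    have h2 := hρℓ _ (hmem r hr')
    rcases le_total (ρ (ℓ r)) r with h | h
    · exact (hgauge _ _ h1.1 h hr'.2 h2).symm
    · exact hgauge _ _ hr'.1 h h1.2 h2.symm
  have hρmono : ∀ q q', a ≤ q → q ≤ q' → q' ≤ b → ρ q ≤ ρ q' := fun q q' h h' h'' => by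
    rcases h'.eq_or_lt with rfl | hlt
    · exact le_rfl
    · by_contra! hcon
      have hq : q ∈ Icc a b := ⟨h, h'.trans h''⟩
      have hq' : q' ∈ Icc a b := ⟨h.trans h', h''⟩
      have := (hℓ _ _ (hρ q' hq').1 hcon.le (hρ q hq).2).1
      rw [hρℓ q hq, hρℓ q' hq'] at this
      exact not_lt.2 this hlt
  refine ⟨fun q => ϑ (ρ q), ?_, ?_, fun q q' c h h' h'' hc hle => ?_, fun q q' h h' h'' => ?_⟩
  · rw [← hℓ0]
    exact hθ r₀ (left_mem_Icc.2 hr)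
  · rw [← hℓ1]
    exact hθ r₁ (right_mem_Icc.2 hr)
  all_goals
    have hq : q ∈ Icc a b := ⟨h, h'.trans h''⟩
    have hq' : q' ∈ Icc a b := ⟨h.trans h', h''⟩
    have h0 := hℓ _ _ (hρ q hq).1 (hρmono q q' h h' h'') (hρ q' hq').2
    have h3 := hAC (hρ q hq).1 (hρmono q q' h h' h'') (hρ q' hq').2
  · have h1 := ofReal_contactAt_sub_le_cost (E := E) (t := t) hΨ₀ hΨ (hρmono q q' h h' h'') h3 hc
      fun r hr' => by
        have hrm : r ∈ Icc r₀ r₁ := ⟨(hρ q hq).1.trans hr'.1, hr'.2.trans (hρ q' hq').2⟩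
        have h4 := (hℓ _ _ (hρ q hq).1 hr'.1 hrm.2).1
        have h5 := (hℓ _ _ hrm.1 hr'.2 (hρ q' hq').2).1
        rw [hρℓ q hq] at h4
        rw [hρℓ q' hq'] at h5
        have := hle (ℓ r) ⟨h4, h5⟩
        simp only at this
        rwa [hθ r hrm] at this
    rw [h0.2, hρℓ q hq, hρℓ q' hq'] at h1
    exact (ENNReal.ofReal_le_ofReal_iff (sub_nonneg.2 h')).1 h1
  · have h1 := ofReal_energy_sub_le_cost hΨ hE ht (hρmono q q' h h' h'') h3
    rw [h0.2, hρℓ q hq, hρℓ q' hq'] at h1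
    exact (ENNReal.ofReal_le_ofReal_iff (sub_nonneg.2 h')).1 h1

/-- A limit of near-minimizers of the Finsler cost: a transition at frozen time, along which energy
is dissipated at unit rate. -/
structure IsTransition (Ψ₀ Ψ : X → ℝ) (E : ℝ → X → ℝ) (t a b : ℝ) (θ : ℝ → X) : Prop where
  gauge_le : ∀ ⦃r r'⦄, a ≤ r → r ≤ r' → r' ≤ b → Ψ₀ (θ r' - θ r) ≤ r' - r
  energy : ∀ ⦃r⦄, r ∈ Icc a b → E t (θ r) = E t (θ a) - (r - a)
  contact : ∀ᵐ r, r ∈ Ioo a b → contactPotential Ψ (deriv θ r) (force E t (θ r)) ≤ 1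

theorem IsGauge.apply_deriv_le {N : X → ℝ} (hN : IsGauge N) {θ : ℝ → X} {g : ℝ → ℝ} {v : X}
    {q g' : ℝ} (hθ : HasDerivAt θ v q) (hg : HasDerivAt g g' q)
    (h : ∀ᶠ r in 𝓝[>] q, N (θ r - θ q) ≤ g r - g q) : N v ≤ g' := by
  have hle : 𝓝[>] q ≤ 𝓝[≠] q :=
    nhdsWithin_mono q (fun r hr => ne_of_gt hr : Ioi q ⊆ {q}ᶜ)
  have h1 := (hasDerivAt_iff_tendsto_slope.1 hθ).mono_left hle
  have h2 := (hasDerivAt_iff_tendsto_slope.1 hg).mono_left hle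
  refine le_of_tendsto_of_tendsto ((hN.continuous.tendsto v).comp h1) h2 ?_
  filter_upwards [h, self_mem_nhdsWithin] with r hr hqr
  have hpos : 0 < r - q := sub_pos.2 hqr
  rw [Function.comp_apply, slope_def_module, slope_def_module, hN.smul _ _ (inv_nonneg.2 hpos.le),
    smul_eq_mul]
  gcongr

/-- Take c = r Ψ*(w) and let r ↑ 1. Only c strictly below Ψ*(w) is required (or c = 0) because a
strict inequality survives small changes of the force. -/
theorem IsViscousPotential.contactPotential_le_one (hΨ : IsViscousPotential Ψ₀ Ψ) {v : X}
    {w : X →L[ℝ] ℝ} (h : ∀ c, 0 ≤ c → (c = 0 ∨ c < conjugate Ψ w) → contactAt Ψ c v ≤ 1) :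
    contactPotential Ψ v w ≤ 1 := by
  rw [contactPotential_eq_contactAt]
  have hc := hΨ.conjugate_nonneg w
  set c := conjugate Ψ w
  have h1 : Tendsto (fun r : ℝ => r * contactAt Ψ c v) (𝓝[<] 1) (𝓝 (1 * contactAt Ψ c v)) :=
    (tendsto_id.mul_const _).mono_left nhdsWithin_le_nhds
  rw [one_mul] at h1
  refine le_of_tendsto h1 ?_
  filter_upwards [Ioo_mem_nhdsLT zero_lt_one] with r hr
  refine (hΨ.mul_contactAt_le hc hr.1.le hr.2.le v).trans (h _ (by have := hr.1; positivity) ?_)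
  rcases hc.eq_or_lt with h0 | h0
  · left; rw [← h0, mul_zero]
  · right; exact mul_lt_of_lt_one_left h0 hr.2

/-- Near-minimizers, parametrized by accumulated cost, are equi-Lipschitz and converge pointwise.
Since the cost does not exceed the energy drop, the limit loses energy at exactly unit rate. Its
contact bound is obtained with frozen c, where the integrand is a gauge, and then by raising c. -/
theorem exists_isTransition (hΨ₀ : IsGauge Ψ₀) (hΨ : IsViscousPotential Ψ₀ Ψ)
    (hE : IsAdmissibleEnergy T E) (hT : 0 < T) {t a b : ℝ} (ht : t ∈ Icc 0 T) (hab : a ≤ b)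
    {x y : X} (hxy : E t x - E t y = b - a)
    (h : finslerCost Ψ E t x y ≤ ENNReal.ofReal (b - a)) :
    ∃ θ : ℝ → X, θ a = x ∧ θ b = y ∧ IsTransition Ψ₀ Ψ E t a b θ := by
  have : ProperSpace X := FiniteDimensional.proper ℝ X
  have happrox : ∀ n : ℕ, ∃ (θ : ℝ → X) (d : ℝ), b ≤ d ∧ d ≤ b + 1 / ((n : ℝ) + 1) ∧
      θ a = x ∧ θ d = y ∧
      (∀ q q' c, a ≤ q → q ≤ q' → q' ≤ d → 0 ≤ c →
        (∀ p ∈ Icc q q', c ≤ conjugate Ψ (force E t (θ p))) →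
        contactAt Ψ c (θ q' - θ q) ≤ q' - q) ∧
      ∀ q q', a ≤ q → q ≤ q' → q' ≤ d → E t (θ q) - E t (θ q') ≤ q' - q := by
    intro n
    have hn : (0 : ℝ) < 1 / ((n : ℝ) + 1) := by positivity
    have hlt : finslerCost Ψ E t x y < ENNReal.ofReal (b - a + 1 / ((n : ℝ) + 1)) :=
      h.trans_lt ((ENNReal.ofReal_lt_ofReal_iff (by linarith)).2 (by linarith))
    simp only [finslerCost, iInf_lt_iff] at hlt
    obtain ⟨r₀, r₁, ϑ, hr, hϑ, rfl, rfl, hcost⟩ := hlt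
    obtain ⟨θ, h1, h2, h3, h4⟩ := exists_cost_reparametrization hΨ₀ hΨ hE ht hr.le hϑ
      hcost.ne_top (a := a) rfl
    refine ⟨θ, _, ?_, ?_, h1, h2, h3, h4⟩
    · have h5 := ofReal_energy_sub_le_cost hΨ hE ht hr.le hϑ
      rw [hxy] at h5
      have := (ENNReal.ofReal_le_iff_le_toReal hcost.ne_top).1 h5
      linarith
    · have := (ENNReal.lt_ofReal_iff_toReal_lt hcost.ne_top).1 hcost
      linarith
  choose θ d hbd hd hθa hθd hθc hθE using happrox
  have hgauge : ∀ n q q', a ≤ q → q ≤ q' → q' ≤ d n → Ψ₀ (θ n q' - θ n q) ≤ q' - q := by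
    intro n q q' h1 h2 h3
    have := hθc n q q' 0 h1 h2 h3 le_rfl fun p _ => hΨ.conjugate_nonneg _
    rwa [hΨ.contactAt_zero] at this
  obtain ⟨C, hC, hCn⟩ := hΨ₀.exists_norm_le
  have hlip : ∀ n q q', q ∈ Icc a b → q' ∈ Icc a b → ‖θ n q' - θ n q‖ ≤ C * |q' - q| := by
    intro n q q' hq hq'
    rcases le_total q q' with h1 | h1
    · rw [abs_of_nonneg (sub_nonneg.2 h1)]
      exact (hCn _).trans (by gcongr; exact hgauge n q q' hq.1 h1 (hq'.2.trans (hbd n)))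
    · rw [abs_sub_comm, norm_sub_rev, abs_of_nonneg (sub_nonneg.2 h1)]
      exact (hCn _).trans (by gcongr; exact hgauge n q' q hq'.1 h1 (hq.2.trans (hbd n)))
  -- A fixed ultrafilter gives limits at all q simultaneously, so no subsequence has to be
  -- extracted.
  have hlim : ∀ q ∈ Icc a b, ∃ z, Tendsto (fun n => θ n q) (hyperfilter ℕ) (𝓝 z) := by
    intro q hq
    obtain ⟨z, -, hz⟩ := (isCompact_closedBall x (C * |q - a|)).ultrafilter_le_nhds
      ((hyperfilter ℕ).map fun n => θ n q) (by
        rw [le_principal_iff]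
        refine Eventually.of_forall (f := (hyperfilter ℕ : Filter ℕ)) fun n => ?_
        rw [Metric.mem_closedBall, dist_eq_norm, ← hθa n]
        exact hlip n a q (left_mem_Icc.2 hab) hq)
    exact ⟨z, hz⟩
  choose! ϑ hϑ using hlim
  have hinv : Tendsto (fun n : ℕ => 1 / ((n : ℝ) + 1)) (hyperfilter ℕ) (𝓝 0) :=
    tendsto_one_div_add_atTop_nhds_zero_nat.mono_left Nat.hyperfilter_le_atTop
  have ha := left_mem_Icc.2 hab
  have hb := right_mem_Icc.2 hab
  have hϑa : ϑ a = x := tendsto_nhds_unique (hϑ a ha) (by simp only [hθa, tendsto_const_nhds])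
  have hϑb : ϑ b = y := by
    refine (hΨ₀.eq_of_sub_le_zero ?_).symm
    refine le_of_tendsto_of_tendsto ((hΨ₀.continuous.tendsto _).comp
      (tendsto_const_nhds.sub (hϑ b hb))) hinv (Eventually.of_forall fun n => ?_)
    have := hgauge n b (d n) hab (hbd n) le_rfl
    rw [hθd] at this
    exact this.trans (by linarith [hd n])
  have hϑlip : ∀ r r', a ≤ r → r ≤ r' → r' ≤ b → Ψ₀ (ϑ r' - ϑ r) ≤ r' - r := by
    intro r r' h1 h2 h3
    refine le_of_tendsto ((hΨ₀.continuous.tendsto _).comp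
      ((hϑ r' ⟨h1.trans h2, h3⟩).sub (hϑ r ⟨h1, h2.trans h3⟩))) (Eventually.of_forall fun n => ?_)
    exact hgauge n r r' h1 h2 (h3.trans (hbd n))
  have hϑnorm : LipschitzOnWith C.toNNReal ϑ (Icc a b) := by
    refine LipschitzOnWith.of_dist_le_mul fun q hq q' hq' => ?_
    rw [dist_eq_norm, Real.dist_eq, Real.coe_toNNReal _ hC.le]
    exact le_of_tendsto ((hϑ q hq).sub (hϑ q' hq')).norm
      (Eventually.of_forall fun n => hlip n q' q hq' hq)
  refine ⟨ϑ, hϑa, hϑb, hϑlip, fun r hr => ?_, ?_⟩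
  · rw [hϑa]
    -- Bounding the drop on [r, d n] gives the upper estimate, bounding it on [a, r] the lower one.
    -- They meet because the total drop is b - a and d n tends to b.
    have hEc := ((hE.continuous_left ht).tendsto (ϑ r)).comp (hϑ r hr)
    refine le_antisymm ?_ ?_
    · have hup : Tendsto (fun n : ℕ => E t x - (r - a) + 1 / ((n : ℝ) + 1)) (hyperfilter ℕ)
          (𝓝 (E t x - (r - a))) := by
        simpa only [add_zero] using tendsto_const_nhds.add hinv
      refine le_of_tendsto_of_tendsto' hEc hup fun n => ?_
      have h1 := hθE n r (d n) hr.1 (hr.2.trans (hbd n)) le_rfl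
      rw [hθd] at h1
      have := hd n
      simp only [Function.comp_apply]
      linarith
    · refine ge_of_tendsto' hEc fun n => ?_
      have h1 := hθE n a r le_rfl hr.1 (hr.2.trans (hbd n))
      rw [hθa] at h1
      simp only [Function.comp_apply]
      linarith
  · filter_upwards [ae_differentiableAt_of_lipschitzOnWith hϑnorm] with q hq hqab
    refine hΨ.contactPotential_le_one fun c hc hcw => ?_
    refine (hΨ.isGauge_contactAt hΨ₀ hc).apply_deriv_le (hq hqab).hasDerivAt
      (hasDerivAt_id q) ?_
    have hqm := Ioo_subset_Icc_self hqab
    -- By equi-Lipschitz continuity the approximating curves stay in this neighbourhood for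
    -- parameters close to q and most n, so the frozen-c cost bound applies to them.
    have hconj : ∀ᶠ z in 𝓝 (ϑ q), c ≤ conjugate Ψ (force E t z) := by
      rcases hcw with rfl | hcw
      · exact Eventually.of_forall fun z => hΨ.conjugate_nonneg _
      · have := (hΨ.continuous_conjugate.comp (hE.continuous_force_left hT ht)).tendsto (ϑ q)
        exact (this.eventually_const_lt hcw).mono fun z hz => hz.le
    obtain ⟨η, hη, hball⟩ := Metric.eventually_nhds_iff.1 hconj
    have hnear : ∀ᶠ r in 𝓝[>] q, r ≤ b ∧ C * (r - q) < η / 2 := by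
      have h1 : Tendsto (fun r => C * (r - q)) (𝓝 q) (𝓝 (C * (q - q))) :=
        (continuous_const.mul (continuous_id.sub continuous_const)).tendsto q
      rw [sub_self, mul_zero] at h1
      filter_upwards [(h1.mono_left nhdsWithin_le_nhds).eventually_lt_const (half_pos hη),
        Ioo_mem_nhdsGT hqab.2] with r hr hr'
      exact ⟨hr'.2.le, hr⟩
    filter_upwards [hnear, self_mem_nhdsWithin] with r hr hqr
    have hqr' : q ≤ r := le_of_lt hqr
    refine le_of_tendsto (((hΨ.isGauge_contactAt hΨ₀ hc).continuous.tendsto _).comp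
      ((hϑ r ⟨hqm.1.trans hqr', hr.1⟩).sub (hϑ q hqm))) ?_
    filter_upwards [Metric.tendsto_nhds.1 (hϑ q hqm) (η / 2) (half_pos hη)] with n hn
    refine hθc n q r c hqm.1 hqr' (hr.1.trans (hbd n)) hc fun p hp => hball ?_
    have h1 := hlip n q p hqm ⟨hqm.1.trans hp.1, hp.2.trans hr.1⟩
    rw [abs_of_nonneg (sub_nonneg.2 hp.1)] at h1
    have h2 : C * (p - q) ≤ C * (r - q) := by gcongr; exact hp.2
    calc dist (θ n p) (ϑ q) ≤ dist (θ n p) (θ n q) + dist (θ n q) (ϑ q) := dist_triangle _ _ _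
      _ < η / 2 + η / 2 := by rw [dist_eq_norm (θ n p)]; linarith [hr.2]
      _ = η := add_halves η

end Transition

/-! ### Continuity points of functions of bounded variation. -/

section BoundedVariation

theorem exists_monotone_edist_le {Y : Type*} [PseudoEMetricSpace Y] {f : ℝ → Y}
    (hf : BoundedVariationOn f univ) :
    ∃ V : ℝ → ℝ, Monotone V ∧ ∀ x y, x ≤ y → edist (f x) (f y) ≤ ENNReal.ofReal (V y - V x) := by
  have hfin : ∀ s, eVariationOn f s ≠ ∞ := fun s => hf.mono (subset_univ s)
  have hadd : ∀ x y, x ≤ y → eVariationOn f (Iic x) + eVariationOn f (Icc x y) =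
      eVariationOn f (Iic y) := fun x y h => by
    rw [← eVariationOn.union f isGreatest_Iic (isLeast_Icc h), Iic_union_Icc_eq_Iic h]
  have hreal : ∀ x y, x ≤ y → (eVariationOn f (Iic y)).toReal - (eVariationOn f (Iic x)).toReal =
      (eVariationOn f (Icc x y)).toReal := fun x y h => by
    rw [← hadd x y h, ENNReal.toReal_add (hfin _) (hfin _), add_sub_cancel_left]
  refine ⟨fun x => (eVariationOn f (Iic x)).toReal, fun x y h => ?_, fun x y h => ?_⟩
  · exact ENNReal.toReal_mono (hfin _) (eVariationOn.mono f (Iic_subset_Iic.2 h))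
  · rw [hreal x y h, ENNReal.ofReal_toReal (hfin _)]
    exact eVariationOn.edist_le f (left_mem_Icc.2 h) (right_mem_Icc.2 h)

theorem continuousAt_of_edist_le {Y : Type*} [PseudoEMetricSpace Y] {f : ℝ → Y} {V : ℝ → ℝ}
    (h : ∀ x y, x ≤ y → edist (f x) (f y) ≤ ENNReal.ofReal (V y - V x)) {t : ℝ}
    (hV : ContinuousAt V t) : ContinuousAt f t := by
  have h1 : Tendsto (fun r => ENNReal.ofReal |V r - V t|) (𝓝 t) (𝓝 0) := by
    have h2 : Tendsto (fun r => |V r - V t|) (𝓝 t) (𝓝 0) := by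
      simpa using (hV.tendsto.sub_const (V t)).abs
    simpa using ENNReal.tendsto_ofReal h2
  refine tendsto_iff_edist_tendsto_0.2 (tendsto_of_tendsto_of_tendsto_of_le_of_le
    tendsto_const_nhds h1 (fun _ => zero_le) fun r => ?_)
  rcases le_total r t with hr | hr
  · refine (h r t hr).trans (ENNReal.ofReal_le_ofReal ?_)
    rw [abs_sub_comm]
    exact le_abs_self _
  · rw [edist_comm]
    exact (h t r hr).trans (ENNReal.ofReal_le_ofReal (le_abs_self _))

theorem countable_not_continuousAt_of_boundedVariationOn {Y : Type*} [PseudoEMetricSpace Y]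
    {f : ℝ → Y} (hf : BoundedVariationOn f univ) : {t | ¬ ContinuousAt f t}.Countable := by
  obtain ⟨V, hV, h⟩ := exists_monotone_edist_le hf
  exact hV.countable_not_continuousAt.mono fun t ht hc => ht (continuousAt_of_edist_le h hc)

end BoundedVariation

/-! ### Lower bounds and superadditivity of the pseudo-variation. -/

section PseudoVariation

variable {X : Type*} [NormedAddCommGroup X] [NormedSpace ℝ X]
  {T : ℝ} {Ψ₀ Ψ : X → ℝ} {E : ℝ → X → ℝ} {u : ℝ → X}

theorem leftValue_eq_of_continuousAt {t : ℝ} (h : ContinuousAt (extend T u) t) :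
    leftValue T u t = extend T u t :=
  leftLim_eq_of_tendsto (h.tendsto.mono_left nhdsWithin_le_nhds)

theorem rightValue_eq_of_continuousAt {t : ℝ} (h : ContinuousAt (extend T u) t) :
    rightValue T u t = extend T u t :=
  rightLim_eq_of_tendsto (h.tendsto.mono_left nhdsWithin_le_nhds)

theorem countable_jumpSet (hT : 0 ≤ T) (hu : BoundedVariationOn u (Icc 0 T)) :
    (jumpSet T u).Countable := by
  refine (countable_not_continuousAt_of_boundedVariationOn
    (boundedVariationOn_extend hT hu)).mono ?_
  intro t ht hc
  rcases ht.2 with h | h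
  · exact h (by rw [leftValue_eq_of_continuousAt hc, extend_of_mem u ht.1])
  · exact h (by rw [rightValue_eq_of_continuousAt hc, extend_of_mem u ht.1])

theorem IsGauge.ofReal_le_tsum {N : X → ℝ} [FiniteDimensional ℝ X] (hN : IsGauge N) {ι : Type*}
    {f : ι → X} {x : X} (h : HasSum f x) :
    ENNReal.ofReal (N x) ≤ ∑' i, ENNReal.ofReal (N (f i)) := by
  refine le_of_tendsto ((ENNReal.continuous_ofReal.comp hN.continuous).tendsto x |>.comp h)
    (Eventually.of_forall fun s => ?_)
  refine le_trans ?_ (ENNReal.sum_le_tsum s)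
  rw [← ENNReal.ofReal_sum_of_nonneg fun i _ => hN.nonneg _]
  refine ENNReal.ofReal_le_ofReal ?_
  exact Finset.le_sum_of_subadditive N hN.map_zero.le hN.add_le s f

variable [FiniteDimensional ℝ X]

theorem ofReal_gauge_sub_le_add {N : X → ℝ} (hN : IsGauge N) (x y z : X) :
    ENNReal.ofReal (N (z - x)) ≤ ENNReal.ofReal (N (y - x)) + ENNReal.ofReal (N (z - y)) := by
  rw [← ENNReal.ofReal_add (hN.nonneg _) (hN.nonneg _), add_comm]
  exact ENNReal.ofReal_le_ofReal (hN.sub_le x y z)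

/-- The pseudo-total variation controls the `Ψ₀`-distance of the end points. -/
theorem ofReal_gauge_sub_le_pseudoVar (hT : 0 ≤ T) (hΨ₀ : IsGauge Ψ₀)
    (hΨ : IsViscousPotential Ψ₀ Ψ) (hu : BoundedVariationOn u (Icc 0 T)) {p q : ℝ} (hpq : p < q) :
    ENNReal.ofReal (Ψ₀ (u q - u p)) ≤ pseudoVar Ψ₀ Ψ E hT hu p q := by
  have : CompleteSpace X := FiniteDimensional.complete ℝ X
  set hBV := boundedVariationOn_extend hT hu
  set J := jumpSet T u with hJ
  have hJc : J.Countable := countable_jumpSet hT hu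
  have hJm : MeasurableSet J := hJc.measurableSet
  have hmid : ENNReal.ofReal (Ψ₀ (leftValue T u q - rightValue T u p)) ≤
      diffuseVar Ψ₀ hT hu p q + ∑' t : ↥(J ∩ Ioo p q),
        (finslerCost Ψ E t (leftValue T u t) (u t) +
          finslerCost Ψ E t (u t) (rightValue T u t)) := by
    -- The mass of u' on the open interval splits into a diffuse part, bounded by Jensen's
    -- inequality, and atoms u(t₊) - u(t₋), each bounded by passing through u(t).
    have h1 : leftValue T u q - rightValue T u p =
        diffuseDerivative hT hu (Ioo p q) + hBV.vectorMeasure (J ∩ Ioo p q) := by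
      rw [diffuseDerivative, VectorMeasure.restrict_apply _ hJm.compl measurableSet_Ioo,
        ← VectorMeasure.of_union (disjoint_compl_left.mono inter_subset_right inter_subset_left)
          (measurableSet_Ioo.inter hJm.compl) (hJm.inter measurableSet_Ioo),
        inter_comm J, ← inter_union_distrib_left, compl_union_self, inter_univ,
        hBV.vectorMeasure_Ioo hpq]
      rfl
    have h2 : ENNReal.ofReal (Ψ₀ (hBV.vectorMeasure (J ∩ Ioo p q))) ≤
        ∑' t : ↥(J ∩ Ioo p q), ENNReal.ofReal (Ψ₀ (rightValue T u t - leftValue T u t)) := by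
      have := (hJc.mono (inter_subset_left (t := Ioo p q))).to_subtype
      have hsum := VectorMeasure.hasSum_of_disjoint_iUnion (v := hBV.vectorMeasure)
        (f := fun t : ↥(J ∩ Ioo p q) => {(t : ℝ)}) (fun t => measurableSet_singleton _)
        fun s t hst => disjoint_singleton.2 fun h => hst (Subtype.ext h)
      rw [iUnion_of_singleton_coe] at hsum
      simp only [hBV.vectorMeasure_singleton] at hsum
      exact hΨ₀.ofReal_le_tsum hsum
    rw [h1]
    refine (ENNReal.ofReal_le_ofReal (hΨ₀.add_le _ _)).trans ?_
    rw [ENNReal.ofReal_add (hΨ₀.nonneg _) (hΨ₀.nonneg _)]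
    refine add_le_add (ofReal_gauge_apply_le hΨ₀ _ measurableSet_Ioo)
      (h2.trans (ENNReal.tsum_le_tsum fun t => ?_))
    exact (ofReal_gauge_sub_le_add hΨ₀ _ (u t) _).trans
      (add_le_add (ofReal_gauge_sub_le_finslerCost hΨ₀ hΨ _ _ _)
        (ofReal_gauge_sub_le_finslerCost hΨ₀ hΨ _ _ _))
  rw [pseudoVar, if_pos hpq, jumpVar]
  calc ENNReal.ofReal (Ψ₀ (u q - u p))
      ≤ ENNReal.ofReal (Ψ₀ (rightValue T u p - u p)) +
        (ENNReal.ofReal (Ψ₀ (leftValue T u q - rightValue T u p)) +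
          ENNReal.ofReal (Ψ₀ (u q - leftValue T u q))) :=
        (ofReal_gauge_sub_le_add hΨ₀ _ (rightValue T u p) _).trans
          (add_le_add le_rfl (ofReal_gauge_sub_le_add hΨ₀ _ _ _))
    _ ≤ finslerCost Ψ E p (u p) (rightValue T u p) +
        ((diffuseVar Ψ₀ hT hu p q + ∑' t : ↥(J ∩ Ioo p q),
        (finslerCost Ψ E t (leftValue T u t) (u t) +
          finslerCost Ψ E t (u t) (rightValue T u t))) +
          finslerCost Ψ E q (leftValue T u q) (u q)) :=
        add_le_add (ofReal_gauge_sub_le_finslerCost hΨ₀ hΨ _ _ _)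
          (add_le_add hmid (ofReal_gauge_sub_le_finslerCost hΨ₀ hΨ _ _ _))
    _ = _ := by ring

theorem finslerCost_right_le_pseudoVar (hT : 0 ≤ T) (hu : BoundedVariationOn u (Icc 0 T)) {p q : ℝ}
    (hpq : p < q) :
    finslerCost Ψ E p (u p) (rightValue T u p) ≤ pseudoVar Ψ₀ Ψ E hT hu p q := by
  rw [pseudoVar, if_pos hpq, jumpVar, add_assoc, ← add_assoc, add_comm (diffuseVar _ _ _ _ _),
    add_assoc]
  exact le_self_add

theorem finslerCost_left_le_pseudoVar (hT : 0 ≤ T) (hu : BoundedVariationOn u (Icc 0 T)) {p q : ℝ}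
    (hpq : p < q) :
    finslerCost Ψ E q (leftValue T u q) (u q) ≤ pseudoVar Ψ₀ Ψ E hT hu p q := by
  rw [pseudoVar, if_pos hpq, jumpVar]
  exact (le_add_self.trans le_self_add).trans le_add_self

/-- This inequality suffices: the balance is an identity on intervals starting at 0, and
superadditivity turns it into an upper bound on every [a, b]. -/
theorem pseudoVar_add_le (hT : 0 ≤ T) (hΨ : IsViscousPotential Ψ₀ Ψ)
    (hu : BoundedVariationOn u (Icc 0 T)) {p q r : ℝ} (hq : q ∈ Icc 0 T) (hpq : p ≤ q)
    (hqr : q ≤ r) :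
    pseudoVar Ψ₀ Ψ E hT hu p q + pseudoVar Ψ₀ Ψ E hT hu q r ≤ pseudoVar Ψ₀ Ψ E hT hu p r := by
  rcases hpq.eq_or_lt with rfl | hpq
  · simp [pseudoVar]
  rcases hqr.eq_or_lt with rfl | hqr
  · simp [pseudoVar]
  have hdiff : diffuseVar Ψ₀ hT hu p q + diffuseVar Ψ₀ hT hu q r ≤ diffuseVar Ψ₀ hT hu p r := by
    rw [diffuseVar, diffuseVar, ← lintegral_union measurableSet_Ioo
      (disjoint_left.2 fun t h h' => h.2.not_gt h'.1)]
    exact lintegral_mono_set (union_subset (Ioo_subset_Ioo_right hqr.le)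
      (Ioo_subset_Ioo_left hpq.le))
  set g : ℝ → ℝ≥0∞ := (jumpSet T u).indicator fun t =>
    finslerCost Ψ E t (leftValue T u t) (u t) + finslerCost Ψ E t (u t) (rightValue T u t) with hg
  have hsum : ∀ a b, ∑' t : ↥(jumpSet T u ∩ Ioo a b),
      (finslerCost Ψ E t (leftValue T u t) (u t) + finslerCost Ψ E t (u t) (rightValue T u t)) =
      ∑' t, (Ioo a b).indicator g t := fun a b => by
    rw [hg, indicator_indicator, inter_comm,
      tsum_subtype (Ioo a b ∩ jumpSet T u) fun t =>
        finslerCost Ψ E t (leftValue T u t) (u t) + finslerCost Ψ E t (u t) (rightValue T u t)]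
  -- The end-point costs of the two intervals at q make up the interior jump term at q; both vanish
  -- if q is not a jump time.
  have hgq : finslerCost Ψ E q (leftValue T u q) (u q) +
      finslerCost Ψ E q (u q) (rightValue T u q) = ∑' t, ({q} : Set ℝ).indicator g t := by
    rw [tsum_eq_single q fun t ht => indicator_of_notMem (by simpa using ht) _,
      indicator_of_mem (mem_singleton q), hg]
    by_cases hJ : q ∈ jumpSet T u
    · rw [indicator_of_mem hJ]
    · rw [indicator_of_notMem hJ]
      have : leftValue T u q = u q ∧ u q = rightValue T u q := by
        by_contra hcon
        exact hJ ⟨hq, by tauto⟩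
      rw [this.1, ← this.2, finslerCost_self hΨ, add_zero]
  have hjump : (∑' t, (Ioo p q).indicator g t) + (∑' t, ({q} : Set ℝ).indicator g t) +
      ∑' t, (Ioo q r).indicator g t ≤ ∑' t, (Ioo p r).indicator g t := by
    rw [← ENNReal.tsum_add, ← ENNReal.tsum_add]
    refine ENNReal.tsum_le_tsum fun t => ?_
    rcases lt_trichotomy t q with h | rfl | h
    · have h1 : t ∉ Ioo q r := fun h' => h'.1.not_gt h
      have h2 : t ∈ Ioo p q ↔ t ∈ Ioo p r := by simp [h, h.trans hqr]
      simp [indicator_of_notMem h1, h.ne, indicator_apply, h2]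
    · simp [hpq, hqr]
    · have h1 : t ∉ Ioo p q := fun h' => h'.2.not_gt h
      have h2 : t ∈ Ioo q r ↔ t ∈ Ioo p r := by simp [h, hpq.trans h]
      simp [indicator_of_notMem h1, h.ne', indicator_apply, h2]
  rw [pseudoVar, pseudoVar, pseudoVar, if_pos hpq, if_pos hqr, if_pos (hpq.trans hqr), jumpVar,
    jumpVar, jumpVar, hsum, hsum, hsum]
  calc _ = (diffuseVar Ψ₀ hT hu p q + diffuseVar Ψ₀ hT hu q r) +
        (finslerCost Ψ E p (u p) (rightValue T u p) + finslerCost Ψ E r (leftValue T u r) (u r) +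
        ((∑' t, (Ioo p q).indicator g t) + (finslerCost Ψ E q (leftValue T u q) (u q) +
      finslerCost Ψ E q (u q) (rightValue T u q)) + ∑' t, (Ioo q r).indicator g t)) := by ring
    _ ≤ _ := by
      rw [hgq]
      gcongr

end PseudoVariation

/-! ### The dissipated energy of a BV solution. -/

section Dissipation

variable {X : Type*} [NormedAddCommGroup X] [NormedSpace ℝ X]
  {T : ℝ} {Ψ₀ Ψ : X → ℝ} {E : ℝ → X → ℝ} {u : ℝ → X}

/-- The energy dissipated by a curve on `[0, t]`, extended to `ℝ` by its end values. -/
def dissipation (T : ℝ) (E : ℝ → X → ℝ) (u : ℝ → X) (t : ℝ) : ℝ :=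
  E 0 (u 0) + work T E u (max 0 (min T t)) - E (max 0 (min T t)) (extend T u t)

theorem dissipation_zero (hT : 0 ≤ T) : dissipation T E u 0 = 0 := by
  have h0 : (0 : ℝ) ∈ Icc 0 T := left_mem_Icc.2 hT
  rw [dissipation, clamp_of_mem_Icc h0, extend_of_mem u h0, work_zero]
  ring

theorem dissipation_clamp (hT : 0 ≤ T) (t : ℝ) :
    dissipation T E u (max 0 (min T t)) = dissipation T E u t := by
  rw [dissipation, dissipation, clamp_of_mem_Icc (clamp_mem_Icc hT t),
    extend_of_mem u (clamp_mem_Icc hT t)]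
  rfl

variable [FiniteDimensional ℝ X]

theorem IsBVSolution.pseudoVar_le {hT : 0 ≤ T} (hΨ : IsViscousPotential Ψ₀ Ψ)
    (h : IsBVSolution hT Ψ₀ Ψ E u) : ∃ hu : BoundedVariationOn u (Icc 0 T),
      ∀ a b, 0 ≤ a → a ≤ b → b ≤ T → dissipation T E u a ≤ dissipation T E u b ∧
        pseudoVar Ψ₀ Ψ E hT hu a b ≤
          ENNReal.ofReal (dissipation T E u b - dissipation T E u a) := by
  obtain ⟨hu, -, hbal⟩ := h
  have hV : ∀ t ∈ Icc 0 T, 0 ≤ dissipation T E u t ∧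
      pseudoVar Ψ₀ Ψ E hT hu 0 t = ENNReal.ofReal (dissipation T E u t) := by
    intro t ht
    have h1 := hbal t ht
    rw [← work_eq ht] at h1
    have hne : pseudoVar Ψ₀ Ψ E hT hu 0 t ≠ ∞ := by
      intro htop
      rw [htop, EReal.coe_ennreal_top, EReal.top_add_coe] at h1
      exact EReal.coe_ne_top _ h1.symm
    lift pseudoVar Ψ₀ Ψ E hT hu 0 t to NNReal using hne with m hm
    have h2 : (m : ℝ) + E t (u t) = E 0 (u 0) + work T E u t :=
      EReal.coe_eq_coe_iff.1 (by rw [EReal.coe_add]; exact h1)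
    have h3 : dissipation T E u t = m := by
      rw [dissipation, clamp_of_mem_Icc ht, extend_of_mem u ht]
      linarith
    rw [h3]
    exact ⟨m.2, (ENNReal.ofReal_coe_nnreal).symm⟩
  refine ⟨hu, fun a b ha hab hb => ?_⟩
  have ha' : a ∈ Icc 0 T := ⟨ha, hab.trans hb⟩
  obtain ⟨ha0, ha1⟩ := hV a ha'
  obtain ⟨hb0, hb1⟩ := hV b ⟨ha.trans hab, hb⟩
  have h1 := pseudoVar_add_le (E := E) hT hΨ hu ha' ha hab
  rw [ha1, hb1] at h1
  refine ⟨(ENNReal.ofReal_le_ofReal_iff hb0).1 (le_self_add.trans h1), ?_⟩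
  rw [ENNReal.ofReal_sub _ ha0]
  exact ENNReal.le_sub_of_add_le_left ENNReal.ofReal_ne_top h1

/-- The dissipated energy thus plays the role of an arclength of u: u is continuous wherever it is.
-/
theorem IsBVSolution.dissipation_gauge {hT : 0 ≤ T} (hΨ₀ : IsGauge Ψ₀)
    (hΨ : IsViscousPotential Ψ₀ Ψ) (h : IsBVSolution hT Ψ₀ Ψ E u) {a b : ℝ} (hab : a ≤ b) :
    Ψ₀ (extend T u b - extend T u a) ≤ dissipation T E u b - dissipation T E u a := by
  obtain ⟨hu, hV⟩ := h.pseudoVar_le hΨ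
  have ha := clamp_mem_Icc hT a
  have hb := clamp_mem_Icc hT b
  rw [← dissipation_clamp hT a, ← dissipation_clamp hT b]
  rcases (monotone_clamp T hab).eq_or_lt with heq | hlt
  · simp only at heq
    simp only [extend, heq, sub_self, hΨ₀.map_zero, le_refl]
  · obtain ⟨h1, h2⟩ := hV _ _ ha.1 hlt.le hb.2
    have h3 := (ofReal_gauge_sub_le_pseudoVar (E := E) hT hΨ₀ hΨ hu hlt).trans h2
    exact (ENNReal.ofReal_le_ofReal_iff (sub_nonneg.2 h1)).1 h3

theorem IsBVSolution.monotone_dissipation {hT : 0 ≤ T} (hΨ₀ : IsGauge Ψ₀)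
    (hΨ : IsViscousPotential Ψ₀ Ψ) (h : IsBVSolution hT Ψ₀ Ψ E u) :
    Monotone (dissipation T E u) := fun _ _ hab =>
  sub_nonneg.1 ((hΨ₀.nonneg _).trans (h.dissipation_gauge hΨ₀ hΨ hab))

theorem tendsto_energy_clamp (hE : IsAdmissibleEnergy T E) (hT : 0 ≤ T) {t : ℝ}
    (ht : t ∈ Icc 0 T) {l : Filter ℝ} (hl : l ≤ 𝓝 t) {x : X} (hx : Tendsto (extend T u) l (𝓝 x)) :
    Tendsto (fun r => E (max 0 (min T r)) (extend T u r)) l (𝓝 (E t x)) := by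
  have h1 : Tendsto (fun r : ℝ => max 0 (min T r)) l (𝓝 t) := by
    have := (lipschitzWith_clamp T).continuous.tendsto t
    rw [clamp_of_mem_Icc ht] at this
    exact this.mono_left hl
  have h2 : Tendsto (fun r => (max 0 (min T r), extend T u r)) l
      (𝓝[Icc 0 T ×ˢ univ] (t, x)) :=
    tendsto_nhdsWithin_iff.2 ⟨h1.prodMk_nhds hx,
      Eventually.of_forall fun r => ⟨clamp_mem_Icc hT r, mem_univ _⟩⟩
  exact (hE.continuousOn_energy (t, x) ⟨ht, mem_univ _⟩).tendsto.comp h2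

theorem tendsto_dissipation (hE : IsAdmissibleEnergy T E) (hT : 0 < T)
    (hu : BoundedVariationOn u (Icc 0 T)) {t : ℝ}
    (ht : t ∈ Icc 0 T) {l : Filter ℝ} (hl : l ≤ 𝓝 t) {x : X} (hx : Tendsto (extend T u) l (𝓝 x)) :
    Tendsto (dissipation T E u) l (𝓝 (E 0 (u 0) + work T E u t - E t x)) := by
  obtain ⟨K, hK⟩ := exists_lipschitzWith_work hT hE hu
  have h1 : Tendsto (fun r : ℝ => work T E u (max 0 (min T r))) l (𝓝 (work T E u t)) := by
    have := (hK.continuous.comp (lipschitzWith_clamp T).continuous).tendsto t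
    rw [Function.comp_apply, clamp_of_mem_Icc ht] at this
    exact this.mono_left hl
  exact (tendsto_const_nhds.add h1).sub (tendsto_energy_clamp hE hT.le ht hl hx)

/-- The work is continuous in time, so the jumps of the dissipation are pure energy drops at frozen
time. -/
theorem leftLim_dissipation (hE : IsAdmissibleEnergy T E) (hT : 0 < T)
    (hu : BoundedVariationOn u (Icc 0 T)) {t : ℝ} (ht : t ∈ Icc 0 T) :
    Function.leftLim (dissipation T E u) t =
      E 0 (u 0) + work T E u t - E t (leftValue T u t) := by
  have : CompleteSpace X := FiniteDimensional.complete ℝ X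
  exact leftLim_eq_of_tendsto (tendsto_dissipation hE hT hu ht nhdsWithin_le_nhds
    ((boundedVariationOn_extend hT.le hu).tendsto_leftLim t))

theorem rightLim_dissipation (hE : IsAdmissibleEnergy T E) (hT : 0 < T)
    (hu : BoundedVariationOn u (Icc 0 T)) {t : ℝ} (ht : t ∈ Icc 0 T) :
    Function.rightLim (dissipation T E u) t =
      E 0 (u 0) + work T E u t - E t (rightValue T u t) := by
  have : CompleteSpace X := FiniteDimensional.complete ℝ X
  exact rightLim_eq_of_tendsto (tendsto_dissipation hE hT hu ht nhdsWithin_le_nhds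
    ((boundedVariationOn_extend hT.le hu).tendsto_rightLim t))

theorem dissipation_of_mem {t : ℝ} (ht : t ∈ Icc 0 T) :
    dissipation T E u t = E 0 (u 0) + work T E u t - E t (u t) := by
  rw [dissipation, clamp_of_mem_Icc ht, extend_of_mem u ht]

/-- This cost is a term of the variation over every [a, t]; let a ↑ t. The right side being an
energy drop, it is exactly the optimality hypothesis of `exists_isTransition`. -/
theorem IsBVSolution.finslerCost_left_le {hT : 0 ≤ T} (hΨ₀ : IsGauge Ψ₀)
    (hΨ : IsViscousPotential Ψ₀ Ψ) (h : IsBVSolution hT Ψ₀ Ψ E u) {t : ℝ} (ht : t ∈ Icc 0 T) :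
    finslerCost Ψ E t (leftValue T u t) (u t) ≤
      ENNReal.ofReal (dissipation T E u t - Function.leftLim (dissipation T E u) t) := by
  obtain ⟨hu, hV⟩ := h.pseudoVar_le hΨ
  rcases ht.1.eq_or_lt with rfl | hpos
  · have hconst : Tendsto (extend T u) (𝓝[<] 0) (𝓝 (u 0)) := by
      refine tendsto_const_nhds.congr' ?_
      filter_upwards [self_mem_nhdsWithin] with r hr
      rw [extend, max_eq_left ((min_le_right _ _).trans (le_of_lt hr))]
    rw [leftValue, leftLim_eq_of_tendsto hconst, finslerCost_self hΨ]
    exact zero_le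
  · refine ge_of_tendsto (ENNReal.tendsto_ofReal
      (((h.monotone_dissipation hΨ₀ hΨ).tendsto_leftLim t).const_sub _)) ?_
    filter_upwards [Ioo_mem_nhdsLT hpos] with a ha
    exact (finslerCost_left_le_pseudoVar hT hu ha.2).trans (hV a t ha.1.le ha.2.le ht.2).2

theorem IsBVSolution.finslerCost_right_le {hT : 0 ≤ T} (hΨ₀ : IsGauge Ψ₀)
    (hΨ : IsViscousPotential Ψ₀ Ψ) (h : IsBVSolution hT Ψ₀ Ψ E u) {t : ℝ} (ht : t ∈ Icc 0 T) :
    finslerCost Ψ E t (u t) (rightValue T u t) ≤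
      ENNReal.ofReal (Function.rightLim (dissipation T E u) t - dissipation T E u t) := by
  obtain ⟨hu, hV⟩ := h.pseudoVar_le hΨ
  rcases ht.2.eq_or_lt with rfl | hlt
  · have hconst : Tendsto (extend t u) (𝓝[>] t) (𝓝 (u t)) := by
      refine tendsto_const_nhds.congr' ?_
      filter_upwards [self_mem_nhdsWithin] with r hr
      rw [extend, min_eq_left (le_of_lt hr), max_eq_right hT]
    rw [rightValue, rightLim_eq_of_tendsto hconst, finslerCost_self hΨ]
    exact zero_le
  · refine ge_of_tendsto (ENNReal.tendsto_ofReal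
      (((h.monotone_dissipation hΨ₀ hΨ).tendsto_rightLim t).sub_const _)) ?_
    filter_upwards [Ioo_mem_nhdsGT hlt] with b hb
    exact (finslerCost_right_le_pseudoVar hT hu hb.1).trans (hV t b ht.1 hb.1.le hb.2.le).2

end Dissipation

/-! ### Transitions filling a whole jump, through the value u(t). -/

section Glue

variable {X : Type*} [NormedAddCommGroup X] [NormedSpace ℝ X]
  {Ψ₀ Ψ : X → ℝ} {E : ℝ → X → ℝ}

theorem IsTransition.glue (hΨ₀ : IsGauge Ψ₀) {t a m b : ℝ} {θ₁ θ₂ : ℝ → X}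
    (h₁ : IsTransition Ψ₀ Ψ E t a m θ₁) (h₂ : IsTransition Ψ₀ Ψ E t m b θ₂)
    (ham : a ≤ m) (heq : θ₁ m = θ₂ m) :
    IsTransition Ψ₀ Ψ E t a b fun r => if r ≤ m then θ₁ r else θ₂ r := by
  refine ⟨fun r r' hr hrr hr' => ?_, fun r hr => ?_, ?_⟩
  · rcases le_or_gt r' m with h | h
    · rw [if_pos h, if_pos (hrr.trans h)]
      exact h₁.gauge_le hr hrr h
    · rw [if_neg h.not_ge]
      rcases le_or_gt r m with h' | h'
      · rw [if_pos h']
        have h3 := h₁.gauge_le hr h' le_rfl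
        have h4 := h₂.gauge_le le_rfl h.le hr'
        rw [heq] at h3
        linarith [hΨ₀.sub_le (θ₁ r) (θ₂ m) (θ₂ r')]
      · rw [if_neg h'.not_ge]
        exact h₂.gauge_le h'.le hrr hr'
  · rw [if_pos ham]
    rcases le_or_gt r m with h | h
    · rw [if_pos h]
      exact h₁.energy ⟨hr.1, h⟩
    · rw [if_neg h.not_ge, h₂.energy ⟨h.le, hr.2⟩, ← heq, h₁.energy (right_mem_Icc.2 ham)]
      ring
  · have hne : ∀ᵐ r : ℝ, r ≠ m := by simp [ae_iff]
    filter_upwards [h₁.contact, h₂.contact, hne] with r hr₁ hr₂ hrm hr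
    rcases lt_or_gt_of_ne hrm with h | h
    · have : (fun r => if r ≤ m then θ₁ r else θ₂ r) =ᶠ[𝓝 r] θ₁ := by
        filter_upwards [Iio_mem_nhds h] with q hq
        exact if_pos (le_of_lt hq)
      rw [this.deriv_eq, if_pos h.le]
      exact hr₁ ⟨hr.1, h⟩
    · have : (fun r => if r ≤ m then θ₁ r else θ₂ r) =ᶠ[𝓝 r] θ₂ := by
        filter_upwards [Ioi_mem_nhds h] with q hq
        exact if_neg (not_le.2 hq)
      rw [this.deriv_eq, if_neg h.not_ge]
      exact hr₂ ⟨h, hr.2⟩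

variable [FiniteDimensional ℝ X] {T : ℝ} {u : ℝ → X}

/-- The transition which fills the jump of a BV solution at time `t`. -/
theorem IsBVSolution.exists_isTransition (hT : 0 < T) (hΨ₀ : IsGauge Ψ₀)
    (hΨ : IsViscousPotential Ψ₀ Ψ) (hE : IsAdmissibleEnergy T E)
    (h : IsBVSolution hT.le Ψ₀ Ψ E u) {t : ℝ} (ht : t ∈ Icc 0 T) :
    ∃ θ : ℝ → X, θ (t + Function.leftLim (dissipation T E u) t) = leftValue T u t ∧
      θ (t + dissipation T E u t) = u t ∧
      θ (t + Function.rightLim (dissipation T E u) t) = rightValue T u t ∧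
      IsTransition Ψ₀ Ψ E t (t + Function.leftLim (dissipation T E u) t)
        (t + Function.rightLim (dissipation T E u) t) θ := by
  have hmono := h.monotone_dissipation hΨ₀ hΨ
  have hl := hmono.leftLim_le (le_refl t)
  have hr := hmono.le_rightLim (le_refl t)
  obtain ⟨hu, -⟩ := id h
  obtain ⟨θ₁, h1, h2, h3⟩ := RateIndependent.exists_isTransition hΨ₀ hΨ hE hT ht
    (a := t + Function.leftLim (dissipation T E u) t) (b := t + dissipation T E u t) (by linarith)
    (x := leftValue T u t) (y := u t)
    (by rw [leftLim_dissipation hE hT hu ht, dissipation_of_mem ht]; ring)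
    (by rw [add_sub_add_left_eq_sub]; exact h.finslerCost_left_le hΨ₀ hΨ ht)
  obtain ⟨θ₂, h4, h5, h6⟩ := RateIndependent.exists_isTransition hΨ₀ hΨ hE hT ht
    (a := t + dissipation T E u t) (b := t + Function.rightLim (dissipation T E u) t) (by linarith)
    (x := u t) (y := rightValue T u t)
    (by rw [rightLim_dissipation hE hT hu ht, dissipation_of_mem ht]; ring)
    (by rw [add_sub_add_left_eq_sub]; exact h.finslerCost_right_le hΨ₀ hΨ ht)
  refine ⟨_, ?_, ?_, ?_, h3.glue hΨ₀ h6 (by linarith) (h2.trans h4.symm)⟩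
  · rw [if_pos (by linarith), h1]
  · rw [if_pos le_rfl, h2]
  · split_ifs with hle
    · have heq : Function.rightLim (dissipation T E u) t = dissipation T E u t := by linarith
      rw [heq, h2, ← h4, ← heq, h5]
    · exact h5

end Glue

/-! ### Inverting the completed graph of a monotone function plus the identity. -/

section ArcLength

variable {W : ℝ → ℝ}

/-- `τ` is the inverse of the completed graph of `t ↦ t + W t`. -/
def IsGraphInverse (W τ : ℝ → ℝ) : Prop :=
  ∀ s, s ∈ Icc (τ s + Function.leftLim W (τ s)) (τ s + Function.rightLim W (τ s))

theorem exists_isGraphInverse (hW : Monotone W) : ∃ τ : ℝ → ℝ, IsGraphInverse W τ := by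
  have h : ∀ s : ℝ, ∃ t, s ∈ Icc (t + Function.leftLim W t) (t + Function.rightLim W t) := by
    intro s
    set A := {r : ℝ | r + W r ≤ s}
    have hne : A.Nonempty := by
      -- At a point r ≤ 0 one has W r ≤ W 0, so r ≤ s - W 0 is enough; the upper bound below is
      -- symmetric.
      refine ⟨min 0 (s - W 0), ?_⟩
      have := hW (min_le_left 0 (s - W 0))
      have h2 := min_le_right 0 (s - W 0)
      change min 0 (s - W 0) + W (min 0 (s - W 0)) ≤ s
      linarith
    have hbdd : BddAbove A := by
      refine ⟨max 0 (s - W 0), fun r hr => ?_⟩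
      rcases le_total r 0 with h0 | h0
      · exact h0.trans (le_max_left _ _)
      · have := hW h0
        have h2 : r + W r ≤ s := hr
        exact le_max_of_le_right (by linarith)
    refine ⟨sSup A, ?_, ?_⟩
    · refine le_of_tendsto ((tendsto_id.mono_left nhdsWithin_le_nhds).add
        (hW.tendsto_leftLim (sSup A))) ?_
      filter_upwards [self_mem_nhdsWithin] with r hr
      obtain ⟨q, hq, hrq⟩ := exists_lt_of_lt_csSup hne hr
      have h1 := hW hrq.le
      have h2 : q + W q ≤ s := hq
      simp only [id]
      linarith
    · refine ge_of_tendsto ((tendsto_id.mono_left nhdsWithin_le_nhds).add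
        (hW.tendsto_rightLim (sSup A))) ?_
      filter_upwards [self_mem_nhdsWithin] with r hr
      by_contra! hcon
      exact not_lt.2 (le_csSup hbdd (show r ∈ A from hcon.le)) hr
  choose τ hτ using h
  exact ⟨τ, hτ⟩

variable {τ : ℝ → ℝ}

/-- Arclength grows at least as fast as time, since W(t₊) ≤ W(t'₋). Uniqueness, monotonicity and the
Lipschitz bound for the inverse all come from this. -/
theorem sub_le_of_completed_graph (hW : Monotone W) {s t s' t' : ℝ}
    (hst : s ≤ t + Function.rightLim W t) (hst' : t' + Function.leftLim W t' ≤ s') (htt : t < t') :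
    t' - t ≤ s' - s := by
  have := hW.rightLim_le_leftLim htt
  linarith

theorem IsGraphInverse.eq_of_mem (h : IsGraphInverse W τ) (hW : Monotone W) {s t : ℝ}
    (hs : s ∈ Icc (t + Function.leftLim W t) (t + Function.rightLim W t)) : τ s = t := by
  rcases lt_trichotomy (τ s) t with hlt | heq | hlt
  · linarith [sub_le_of_completed_graph hW (h s).2 hs.1 hlt]
  · exact heq
  · linarith [sub_le_of_completed_graph hW hs.2 (h s).1 hlt]

theorem IsGraphInverse.eq_of_add (h : IsGraphInverse W τ) (hW : Monotone W) (t : ℝ) :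
    τ (t + W t) = t :=
  h.eq_of_mem hW ⟨by linarith [hW.leftLim_le (le_refl t)], by linarith [hW.le_rightLim (le_refl t)]⟩

theorem IsGraphInverse.monotone (h : IsGraphInverse W τ) (hW : Monotone W) : Monotone τ := by
  intro s s' hs
  by_contra! hcon
  linarith [sub_le_of_completed_graph hW (h s').2 (h s).1 hcon]

theorem IsGraphInverse.sub_le (h : IsGraphInverse W τ) (hW : Monotone W) {s s' : ℝ} (hs : s ≤ s') :
    τ s' - τ s ≤ s' - s := by
  rcases (h.monotone hW hs).eq_or_lt with heq | hlt
  · rw [heq]; linarith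
  · exact sub_le_of_completed_graph hW (h s).2 (h s').1 hlt

theorem IsGraphInverse.lipschitzWith (h : IsGraphInverse W τ) (hW : Monotone W) :
    LipschitzWith 1 τ := by
  refine LipschitzWith.of_le_add fun x y => ?_
  rcases le_total x y with hxy | hxy
  · exact (h.monotone hW hxy).trans (le_add_of_nonneg_right dist_nonneg)
  · have := h.sub_le hW hxy
    rw [Real.dist_eq]
    linarith [le_abs_self (x - y)]

end ArcLength

/-! ### The interpolated parametrized curve; part (ii). -/

section Parametrization

variable {X : Type*} [NormedAddCommGroup X] [NormedSpace ℝ X]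
  {T : ℝ} {Ψ₀ Ψ : X → ℝ} {E : ℝ → X → ℝ} {u : ℝ → X} {τ : ℝ → ℝ} {θ : ℝ → ℝ → X}

/-- The inverse `τ` of the arclength `t + dissipation T E u t`, and a family of transitions `θ t`
filling the jumps of `u`. -/
structure IsJumpFilling (T : ℝ) (Ψ₀ Ψ : X → ℝ) (E : ℝ → X → ℝ) (u : ℝ → X) (τ : ℝ → ℝ)
    (θ : ℝ → ℝ → X) : Prop where
  inverse : IsGraphInverse (dissipation T E u) τ
  left : ∀ t ∈ Icc 0 T, θ t (t + Function.leftLim (dissipation T E u) t) = leftValue T u t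
  mid : ∀ t ∈ Icc 0 T, θ t (t + dissipation T E u t) = u t
  right : ∀ t ∈ Icc 0 T, θ t (t + Function.rightLim (dissipation T E u) t) = rightValue T u t
  transition : ∀ t ∈ Icc 0 T, IsTransition Ψ₀ Ψ E t
    (t + Function.leftLim (dissipation T E u) t) (t + Function.rightLim (dissipation T E u) t) (θ t)

theorem IsJumpFilling.mem (h : IsJumpFilling T Ψ₀ Ψ E u τ θ) (hT : 0 ≤ T)
    (hW : Monotone (dissipation T E u)) {s : ℝ} (hs : s ∈ Icc 0 (T + dissipation T E u T)) :
    τ s ∈ Icc 0 T := by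
  have h0 := h.inverse.eq_of_add hW 0
  rw [dissipation_zero hT, add_zero] at h0
  have h1 := h.inverse.monotone hW hs.1
  have h2 := h.inverse.monotone hW hs.2
  rw [h0] at h1
  rw [h.inverse.eq_of_add hW T] at h2
  exact ⟨h1, h2⟩

variable [FiniteDimensional ℝ X]

theorem IsBVSolution.exists_isJumpFilling (hT : 0 < T) (hΨ₀ : IsGauge Ψ₀)
    (hΨ : IsViscousPotential Ψ₀ Ψ) (hE : IsAdmissibleEnergy T E)
    (h : IsBVSolution hT.le Ψ₀ Ψ E u) : ∃ τ θ, IsJumpFilling T Ψ₀ Ψ E u τ θ := by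
  obtain ⟨τ, hτ⟩ := exists_isGraphInverse (h.monotone_dissipation hΨ₀ hΨ)
  choose! θ h1 h2 h3 h4 using fun t (ht : t ∈ Icc 0 T) => h.exists_isTransition hT hΨ₀ hΨ hE ht
  exact ⟨τ, θ, hτ, h1, h2, h3, h4⟩

/-- The quantity s - τ(s) is the dissipation interpolated across jumps. For different times, pass
through u(τ(s)₊) and u(τ(s')₋): the outer parts lie in transitions and the middle one is the limit
of `dissipation_gauge`. -/
theorem IsJumpFilling.gauge_le (hf : IsJumpFilling T Ψ₀ Ψ E u τ θ) (hT : 0 < T) (hΨ₀ : IsGauge Ψ₀)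
    (hΨ : IsViscousPotential Ψ₀ Ψ) (h : IsBVSolution hT.le Ψ₀ Ψ E u) {s s' : ℝ}
    (hs : 0 ≤ s) (hss : s ≤ s') (hs' : s' ≤ T + dissipation T E u T) :
    Ψ₀ (θ (τ s') s' - θ (τ s) s) ≤ (s' - τ s') - (s - τ s) := by
  have : CompleteSpace X := FiniteDimensional.complete ℝ X
  have hW := h.monotone_dissipation hΨ₀ hΨ
  have hts := hf.mem hT.le hW ⟨hs, hss.trans hs'⟩
  have hts' := hf.mem hT.le hW ⟨hs.trans hss, hs'⟩
  have hi := hf.inverse s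
  have hi' := hf.inverse s'
  rcases (hf.inverse.monotone hW hss).eq_or_lt with heq | hlt
  · rw [← heq] at hi' ⊢
    have := (hf.transition _ hts).gauge_le hi.1 hss hi'.2
    linarith
  · have h1 := (hf.transition _ hts').gauge_le le_rfl hi'.1 hi'.2
    have h2 := (hf.transition _ hts).gauge_le hi.1 hi.2 le_rfl
    rw [hf.left _ hts'] at h1
    rw [hf.right _ hts] at h2
    obtain ⟨hu, -⟩ := id h
    have hBV := boundedVariationOn_extend hT.le hu
    have h3 : Ψ₀ (leftValue T u (τ s') - rightValue T u (τ s)) ≤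
        Function.leftLim (dissipation T E u) (τ s') -
          Function.rightLim (dissipation T E u) (τ s) := by
      have hl := (hBV.tendsto_leftLim (τ s')).comp (tendsto_fst (g := 𝓝[>] (τ s)))
      have hr := (hBV.tendsto_rightLim (τ s)).comp (tendsto_snd (f := 𝓝[<] (τ s')))
      have hlW := (hW.tendsto_leftLim (τ s')).comp (tendsto_fst (g := 𝓝[>] (τ s)))
      have hrW := (hW.tendsto_rightLim (τ s)).comp (tendsto_snd (f := 𝓝[<] (τ s')))
      refine le_of_tendsto_of_tendsto ((hΨ₀.continuous.tendsto _).comp (hl.sub hr))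
        (hlW.sub hrW) ?_
      obtain ⟨m, hm, hm'⟩ := exists_between hlt
      filter_upwards [prod_mem_prod (Ioo_mem_nhdsLT hm') (Ioo_mem_nhdsGT hm)] with p hp
      exact h.dissipation_gauge hΨ₀ hΨ (hp.2.2.trans hp.1.1).le
    linarith [hΨ₀.sub_le (θ (τ s) s) (rightValue T u (τ s)) (θ (τ s') s'),
      hΨ₀.sub_le (rightValue T u (τ s)) (leftValue T u (τ s')) (θ (τ s') s')]

/-- Up to the left limit at τ(s) this is the definition of the dissipation; from there the
transition loses energy at unit rate. -/
theorem IsJumpFilling.energy_eq (hf : IsJumpFilling T Ψ₀ Ψ E u τ θ) (hT : 0 < T)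
    (hΨ₀ : IsGauge Ψ₀) (hΨ : IsViscousPotential Ψ₀ Ψ) (hE : IsAdmissibleEnergy T E)
    (h : IsBVSolution hT.le Ψ₀ Ψ E u) {s : ℝ} (hs : s ∈ Icc 0 (T + dissipation T E u T)) :
    E (τ s) (θ (τ s) s) = E 0 (u 0) + work T E u (τ s) - (s - τ s) := by
  have hts := hf.mem hT.le (h.monotone_dissipation hΨ₀ hΨ) hs
  obtain ⟨hu, -⟩ := id h
  have h1 := leftLim_dissipation hE hT hu hts
  have h2 := (hf.transition _ hts).energy (hf.inverse s)
  rw [hf.left _ hts] at h2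
  linarith

theorem IsJumpFilling.lipschitzOnWith (hf : IsJumpFilling T Ψ₀ Ψ E u τ θ) (hT : 0 < T)
    (hΨ₀ : IsGauge Ψ₀) (hΨ : IsViscousPotential Ψ₀ Ψ) (h : IsBVSolution hT.le Ψ₀ Ψ E u) :
    ∃ K, LipschitzOnWith K (fun s => θ (τ s) s) (Icc 0 (T + dissipation T E u T)) := by
  have hW := h.monotone_dissipation hΨ₀ hΨ
  obtain ⟨C, hC, hCn⟩ := hΨ₀.exists_norm_le
  refine ⟨C.toNNReal, LipschitzOnWith.of_dist_le_mul fun s hs s' hs' => ?_⟩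
  rw [Real.coe_toNNReal _ hC.le]
  wlog hss : s' ≤ s generalizing s s'
  · rw [dist_comm, dist_comm s]
    exact this s' hs' s hs (le_of_not_ge hss)
  · rw [dist_eq_norm, Real.dist_eq, abs_of_nonneg (sub_nonneg.2 hss)]
    refine (hCn _).trans (mul_le_mul_of_nonneg_left ?_ hC.le)
    have h1 := hf.gauge_le hT hΨ₀ hΨ h hs'.1 hss hs.2
    have h2 := hf.inverse.monotone hW hss
    linarith

/-- Where time runs, the interpolated curve is stable and dissipates by the gauge. -/
theorem IsJumpFilling.deriv_of_continuousAt (hf : IsJumpFilling T Ψ₀ Ψ E u τ θ) (hT : 0 < T)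
    (hΨ₀ : IsGauge Ψ₀) (hΨ : IsViscousPotential Ψ₀ Ψ) (hE : IsAdmissibleEnergy T E)
    (h : IsBVSolution hT.le Ψ₀ Ψ E u) {s α : ℝ} {v : X}
    (hs : s ∈ Ioo 0 (T + dissipation T E u T)) (hc : ContinuousAt (dissipation T E u) (τ s))
    (hα : HasDerivAt τ α s) (hv : HasDerivAt (fun r => θ (τ r) r) v s) :
    force E (τ s) (θ (τ s) s) ∈ stableSet Ψ₀ ∧ Ψ₀ v ≤ 1 - α ∧
      force E (τ s) (θ (τ s) s) v = 1 - α := by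
  have hW := h.monotone_dissipation hΨ₀ hΨ
  have hs' := Ioo_subset_Icc_self hs
  have hts := hf.mem hT.le hW hs'
  obtain ⟨hu, hst, -⟩ := id h
  have hcu : ContinuousAt (extend T u) (τ s) := by
    obtain ⟨C, hC, hCn⟩ := hΨ₀.exists_norm_le
    refine continuousAt_of_edist_le (V := fun r => C * dissipation T E u r) (fun x y hxy => ?_)
      (continuousAt_const.mul hc)
    rw [edist_comm, edist_dist, dist_eq_norm]
    refine ENNReal.ofReal_le_ofReal ((hCn _).trans ?_)
    rw [← mul_sub]
    exact mul_le_mul_of_nonneg_left (h.dissipation_gauge hΨ₀ hΨ hxy) hC.le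
  have hval : θ (τ s) s = u (τ s) := by
    have h1 := hW.continuousAt_iff_leftLim_eq_rightLim.1 hc
    have h2 := hf.inverse s
    have h3 := hW.leftLim_le (le_refl (τ s))
    have h4 := hW.le_rightLim (le_refl (τ s))
    have h5 : s = τ s + dissipation T E u (τ s) := by
      have h6 := h2.1
      have h7 := h2.2
      rw [h1] at h6 h3
      linarith
    rw [← hf.mid _ hts, ← h5]
  have hstab : force E (τ s) (u (τ s)) ∈ stableSet Ψ₀ := by
    refine force_mem_stableSet_of_ae hT hE ?_ hts hcu
    filter_upwards [hst, (countable_jumpSet hT.le hu).ae_notMem volume] with t h1 h2 h3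
    exact h1 ⟨Ioo_subset_Icc_self h3, h2⟩
  have hnhds : ∀ᶠ r in 𝓝 s, r ∈ Icc 0 (T + dissipation T E u T) := Icc_mem_nhds hs.1 hs.2
  refine ⟨hval ▸ hstab, ?_, ?_⟩
  · refine hΨ₀.apply_deriv_le hv ((hasDerivAt_id s).sub hα) ?_
    filter_upwards [self_mem_nhdsWithin, hnhds.filter_mono nhdsWithin_le_nhds] with r hr hr'
    exact hf.gauge_le hT hΨ₀ hΨ h hs.1.le (le_of_lt hr) hr'.2
  -- Differentiate the energy once by the chain rule and once through `energy_eq`; the power terms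
  -- cancel.
  · have h1 := hE.hasDerivAt_comp hT hα hv (hnhds.mono fun r hr => hf.mem hT.le hW hr)
    have h2 : HasDerivAt (fun r => E 0 (u 0) + work T E u (τ r) - (r - τ r))
        (power T E u (τ s) * α - (1 - α)) s :=
      (((hasDerivAt_work hT hE hu hcu).comp s hα).const_add _).sub ((hasDerivAt_id s).sub hα)
    have h3 := h1.unique (h2.congr_of_eventuallyEq
      (hnhds.mono fun r hr => hf.energy_eq hT hΨ₀ hΨ hE h hr))
    have h4 : power T E u (τ s) = timeDeriv T E (τ s) (θ (τ s) s) := by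
      rw [power, clamp_of_mem_Icc hts, extend_of_mem u hts, hval]
    rw [h4] at h3
    linarith

/-- Inside a jump, time is frozen. -/
theorem IsJumpFilling.eventually_eq (hf : IsJumpFilling T Ψ₀ Ψ E u τ θ)
    (hW : Monotone (dissipation T E u)) {s t : ℝ}
    (hs : s ∈ Ioo (t + Function.leftLim (dissipation T E u) t)
      (t + Function.rightLim (dissipation T E u) t)) : ∀ᶠ r in 𝓝 s, τ r = t := by
  filter_upwards [isOpen_Ioo.mem_nhds hs] with r hr
  exact hf.inverse.eq_of_mem hW (Ioo_subset_Icc_self hr)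

/-- Either τ(s) is a continuity point of the dissipation, and the force is stable, or s lies in a
jump interval, where time is frozen, the energy has slope -1 and the transition satisfies 𝔭 ≤ 1. -/
theorem IsJumpFilling.ae_deriv (hf : IsJumpFilling T Ψ₀ Ψ E u τ θ) (hT : 0 < T)
    (hΨ₀ : IsGauge Ψ₀) (hΨ : IsViscousPotential Ψ₀ Ψ) (hE : IsAdmissibleEnergy T E)
    (h : IsBVSolution hT.le Ψ₀ Ψ E u) :
    ∀ᵐ s, s ∈ Ioo 0 (T + dissipation T E u T) →
      0 ≤ deriv τ s ∧
      force E (τ s) (θ (τ s) s) (deriv (fun r => θ (τ r) r) s) = 1 - deriv τ s ∧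
      augmentedPotential Ψ₀ Ψ (deriv τ s) (deriv (fun r => θ (τ r) r) s)
        (-timeDeriv T E (τ s) (θ (τ s) s)) (force E (τ s) (θ (τ s) s)) ≤
        ((-deriv (fun r => E (τ r) (θ (τ r) r)) s : ℝ) : EReal) := by
  have hW := h.monotone_dissipation hΨ₀ hΨ
  set W := dissipation T E u with hWdef
  obtain ⟨K, hK⟩ := hf.lipschitzOnWith hT hΨ₀ hΨ h
  have hmono := hf.inverse.monotone hW
  have hD : {t | ¬ ContinuousAt W t}.Countable := hW.countable_not_continuousAt
  -- The exceptional null set depends on the transition, but there are only countably many jump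
  -- times. The end points of the jump intervals are discarded for the same reason.
  have hcontact := (ae_ball_iff hD).2 fun t _ => show ∀ᵐ s, t ∈ Icc 0 T →
      s ∈ Ioo (t + Function.leftLim W t) (t + Function.rightLim W t) →
      contactPotential Ψ (deriv (θ t) s) (force E t (θ t s)) ≤ 1 by
    by_cases ht : t ∈ Icc 0 T
    · filter_upwards [(hf.transition t ht).contact] with s hs _
      exact hs
    · exact Eventually.of_forall fun s h' => absurd h' ht
  have hends := (((hD.image fun t => t + Function.leftLim W t).union
    (hD.image fun t => t + Function.rightLim W t)).ae_notMem volume)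
  filter_upwards [(hf.inverse.lipschitzWith hW).ae_differentiableAt_real,
    ae_differentiableAt_of_lipschitzOnWith hK, hcontact, hends] with s hα hv hct hend hs
  replace hv := hv hs
  have hts := hf.mem hT.le hW (Ioo_subset_Icc_self hs)
  have hnhds : ∀ᶠ r in 𝓝 s, r ∈ Icc 0 (T + W T) := Icc_mem_nhds hs.1 hs.2
  have hα0 : 0 ≤ deriv τ s := hmono.deriv_nonneg
  have hchain := hE.hasDerivAt_comp hT hα.hasDerivAt hv.hasDerivAt
    (hnhds.mono fun r hr => hf.mem hT.le hW hr)
  by_cases hc : ContinuousAt W (τ s)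
  · obtain ⟨hstab, hle, heq⟩ := hf.deriv_of_continuousAt hT hΨ₀ hΨ hE h hs hc hα.hasDerivAt
      hv.hasDerivAt
    refine ⟨hα0, heq, ?_⟩
    rw [hchain.deriv, augmentedPotential, if_pos hstab, hΨ.contactPotential_eq_of_stable hstab]
    split_ifs with hpos
    · exact EReal.coe_le_coe_iff.2 (by linarith)
    · have hzero : deriv τ s = 0 := le_antisymm (not_lt.1 hpos) hα0
      rw [hzero] at heq hle ⊢
      exact EReal.coe_le_coe_iff.2 (by linarith)
  · have hi := hf.inverse s
    have hs' : s ∈ Ioo (τ s + Function.leftLim W (τ s)) (τ s + Function.rightLim W (τ s)) :=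
      ⟨lt_of_le_of_ne hi.1 fun heq => hend (Or.inl ⟨τ s, hc, heq⟩),
        lt_of_le_of_ne hi.2 fun heq => hend (Or.inr ⟨τ s, hc, heq.symm⟩)⟩
    have hev := hf.eventually_eq hW hs'
    have hτ0 : deriv τ s = 0 := by
      rw [EventuallyEq.deriv_eq (f := fun _ => τ s) hev, deriv_const]
    have hd : deriv (fun r => θ (τ r) r) s = deriv (θ (τ s)) s :=
      EventuallyEq.deriv_eq (hev.mono fun r hr => congrArg (fun t => θ t r) hr)
    have hd2 : HasDerivAt (fun r => E (τ r) (θ (τ r) r)) (-1) s := by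
      have h2 : HasDerivAt (fun r => E 0 (u 0) + work T E u (τ s) - (r - τ s)) (-1) s := by
        simpa using ((hasDerivAt_id s).sub_const (τ s)).const_sub (E 0 (u 0) + work T E u (τ s))
      refine h2.congr_of_eventuallyEq ?_
      filter_upwards [hev, hnhds] with r hr hr'
      rw [hf.energy_eq hT hΨ₀ hΨ hE h hr', hr]
    have heq := hchain.unique hd2
    refine ⟨hα0, by rw [hτ0] at heq ⊢; linarith, ?_⟩
    rw [hd2.deriv, hτ0, augmentedPotential, if_neg (lt_irrefl _), hd]
    exact EReal.coe_le_coe_iff.2 (by simpa using hct (τ s) hc hts hs')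

/-- Every BV solution is a time section of a nondegenerate surjective parametrized solution. -/
theorem IsBVSolution.exists_isParametrizedSolution (hT : 0 < T) (hΨ₀ : IsGauge Ψ₀)
    (hΨ : IsViscousPotential Ψ₀ Ψ) (hE : IsAdmissibleEnergy T E)
    (h : IsBVSolution hT.le Ψ₀ Ψ E u) :
    ∃ (S : ℝ) (tt : ℝ → ℝ) (uu : ℝ → X), 0 < S ∧ IsParametrizedSolution T Ψ₀ Ψ E 0 S tt uu ∧
      IsNondegenerate Ψ₀ 0 S tt uu ∧ IsSurjective T 0 S tt ∧
      ∀ t ∈ Icc 0 T, u t ∈ uu '' timeSection S tt t := by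
  have hW := h.monotone_dissipation hΨ₀ hΨ
  obtain ⟨τ, θ, hf⟩ := h.exists_isJumpFilling hT hΨ₀ hΨ hE
  obtain ⟨K, hK⟩ := hf.lipschitzOnWith hT hΨ₀ hΨ h
  have hτ := hf.inverse.lipschitzWith hW
  have hae := hf.ae_deriv hT hΨ₀ hΨ hE h
  have hV0 : dissipation T E u 0 = 0 := dissipation_zero hT.le
  -- The parameter length is elapsed time plus total dissipation, and u(t) is found at the parameter
  -- t + W(t).
  refine ⟨T + dissipation T E u T, τ, fun s => θ (τ s) s, ?_,
    ⟨fun s hs => hf.mem hT.le hW hs, ⟨1, hτ.lipschitzOnWith⟩, ⟨K, hK⟩,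
      (hf.inverse.monotone hW).monotoneOn _, fun s₁ s₂ h1 h12 h2 => ?_⟩, ?_, ⟨?_, ?_⟩,
    fun t ht => ⟨t + dissipation T E u t, ⟨⟨?_, ?_⟩, hf.inverse.eq_of_add hW t⟩, ?_⟩⟩
  · linarith [hW hT.le]
  · have hsub : Icc s₁ s₂ ⊆ Icc 0 (T + dissipation T E u T) := Icc_subset_Icc h1 h2
    obtain ⟨M, hM⟩ := hE.exists_lipschitzOnWith_comp
      (fun s hs => hf.mem hT.le hW (hsub hs)) (hτ.lipschitzOnWith) (hK.mono hsub)
    refine erealIntegral_add_le h12 hM ?_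
    filter_upwards [hae] with s hs hs12
    exact (hs ⟨h1.trans_lt hs12.1, hs12.2.trans_le h2⟩).2.2
  · filter_upwards [hae] with s hs hsI
    obtain ⟨h0, h1, -⟩ := hs hsI
    -- If both terms vanished, the identity ⟨w, υ̇⟩ = 1 - τ̇ would read 0 = 1.
    by_contra! hcon
    have hg := hΨ₀.nonneg (deriv (fun r => θ (τ r) r) s)
    have hv : deriv (fun r => θ (τ r) r) s = 0 := by
      by_contra hne
      linarith [hΨ₀.pos _ hne]
    rw [hv, map_zero] at h1
    linarith
  · have := hf.inverse.eq_of_add hW 0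
    rwa [hV0, add_zero] at this
  · exact hf.inverse.eq_of_add hW T
  · linarith [hW ht.1, ht.1]
  · linarith [hW ht.2, ht.2]
  · beta_reduce
    rw [hf.inverse.eq_of_add hW t]
    exact hf.mid t ht

end Parametrization

end RateIndependent

end

theorem theorem5p6 {X : Type*} [NormedAddCommGroup X] [NormedSpace ℝ X] [FiniteDimensional ℝ X]
    (T : ℝ) (hT : 0 < T) (Ψ₀ Ψ : X → ℝ) (E : ℝ → X → ℝ)
    (hΨ₀ : RateIndependent.IsGauge Ψ₀) (hΨ : RateIndependent.IsViscousPotential Ψ₀ Ψ)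
    (hE : RateIndependent.IsAdmissibleEnergy T E) :
    (∀ (S : ℝ) (tt : ℝ → ℝ) (uu : ℝ → X), 0 < S →
      RateIndependent.IsParametrizedSolution T Ψ₀ Ψ E 0 S tt uu →
      RateIndependent.IsNondegenerate Ψ₀ 0 S tt uu →
      RateIndependent.IsSurjective T 0 S tt →
      ∀ u : ℝ → X, (∀ t ∈ Set.Icc 0 T, u t ∈ uu '' RateIndependent.timeSection S tt t) →
        RateIndependent.IsBVSolution hT.le Ψ₀ Ψ E u) ∧
    (∀ u : ℝ → X, RateIndependent.IsBVSolution hT.le Ψ₀ Ψ E u →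
      ∃ (S : ℝ) (tt : ℝ → ℝ) (uu : ℝ → X), 0 < S ∧
        RateIndependent.IsParametrizedSolution T Ψ₀ Ψ E 0 S tt uu ∧
        RateIndependent.IsNondegenerate Ψ₀ 0 S tt uu ∧
        RateIndependent.IsSurjective T 0 S tt ∧
        ∀ t ∈ Set.Icc 0 T, u t ∈ uu '' RateIndependent.timeSection S tt t) :=
  ⟨fun _ _ _ hS hp hnd hsurj _ hu =>
      RateIndependent.isBVSolution_of_isParametrizedSolution hT hΨ₀ hΨ hE hS hp hnd hsurj hu,
    fun _ h => h.exists_isParametrizedSolution hT hΨ₀ hΨ hE⟩
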